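/- Let $k\in\mathbb Z$, $p\ge 0$, and let $f$ be a meromorphic quasi-modular form of weight $k$ and depth at most $p$ on $\mathrm{SL}_2(\mathbb Z)$ with component functions $f_0,\dots,f_p$. That is, $f$ and the $f_r$ are meromorphic functions on the upper half-plane; each $f_r$ is meromorphic at infinity, i.e. $f_r(\tau)=\sum_{n\ge -N}a_{f_r}(n)e^{2\pi i n\tau}$ for $\operatorname{Im}\tau$ large; and $$(c\tau+d)^{-k}f\Big(\frac{a\tau+b}{c\tau+d}\Big)=\sum_{r=0}^{p}f_r(\tau)\Big(\frac{c}{c\tau+d}\Big)^r\qquad\text{for all }\begin{pmatrix}a&b\\c&d\end{pmatrix}\in\mathrm{SL}_2(\mathbb Z)$$ (so $f_0=f$). For a function $g$ on $(0,\infty)$ which is analytic up to finitely many poles $c_1<\dots<c_n$, choose $0<a_0<c_1<a_1<\dots<c_n<a_n$ and define the regularized integral $$\int_0^{\infty,*}g(t)\,dt=\int_0^{a_0,*}g(t)\,dt+\sum_{j=1}^n\int_{a_{j-1}}^{a_j,*}g(t)\,dt+\int_{a_n}^{\infty,*}g(t)\,dt$$ as follows. $\int_{T}^{\infty,*}g(t)\,dt$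 is the limit at $w=0$ of the analytic continuation through $\operatorname{Im}w>0$ of $w\mapsto\int_T^\infty e^{-wt}g(t)\,dt$ from large $\operatorname{Re}w$. $\int_0^{T,*}g(t)\,dt=\int_{1/T}^{\infty,*}t^{-2}g(1/t)\,dt$. $\int_{a_{j-1}}^{a_j,*}g(t)\,dt$ is the constant term of the Laurent expansion at $u=0$ of the meromorphic continuation of $u\mapsto\int_{a_{j-1}}^{a_j}|t-c_j|^u g(t)\,dt$ from large $\operatorname{Re}u$. The completed $L$-function is $$\Lambda(f,s)=\int_0^{\infty,*}f(it)\,t^{s-1}\,dt,$$ where, as functions of $s$, the integral over $(a_n,\infty)$, which exists for $\operatorname{Re}s$ sufficiently small, and the integral over $(0,a_0)$, which exists for $\operatorname{Re}s$ sufficiently large, are each continued meromorphically to $\mathbb C$. The functions $\Lambda(f_r,s)$ are defined in the same way. Then: (i) $\Lambda(f,s)$ is well defined (the two continuations exist, the integrals around the poles exist for every $s$, and the sum does not depend on the $a_j$). It is a meromorphic function of $s\in\mathbb C$, it has the value $\int_0^{\infty,*}f(it)t^{s-1}dt$ at every $s$ for which this regularized integral exists, and it satisfies, as an identity of meromorphic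 functions, $$\Lambda(f,s)=\sum_{r=0}^{p}i^{k-r}\Lambda(f_r,k-r-s).$$ (ii) All poles of $\Lambda(f,s)$ are simple, and they are located at $s=0$ or at integers $n$ with $k-p\le n\le k$. With $a_{f_k}(0):=0$ if $k<0$ or $k>p$, $$\operatorname{Res}_{s=0}\Lambda(f,s)=-a_f(0)+a_{f_k}(0),\qquad \operatorname{Res}_{s=n}\Lambda(f,s)=i^{n}a_{f_{k-n}}(0)\quad(n\ne0,\ k-p\le n\le k).$$ (iii) For $0\le m\le p$, the function $\Lambda(f_m,s)$ is well defined and meromorphic on $\mathbb C$ in the same sense, and $$\Lambda(f_m,s)=\sum_{r=0}^{p-m}i^{k-2m-r}\binom{m+r}{r}\Lambda(f_{m+r},k-2m-r-s).$$ -/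

import Mathlib

open Complex Filter Topology MeasureTheory Set
open scoped MatrixGroups

noncomputable section

namespace QuasiModular

/-! ### Meromorphic quasi-modular forms

A meromorphic function on the upper half-plane is represented by its unique representative
`ℂ → ℂ` in normal form on the upper half-plane: it takes its analytic values away from the poles
and the value `0` at the poles. Values outside of the upper half-plane are irrelevant. -/

/-- The open upper half-plane, as a subset of `ℂ`. -/
def upperHalf : Set ℂ := {τ : ℂ | 0 < τ.im}

/-- `f(τ) = ∑_{n ≥ -N} a(n) q ^ n` with `q = exp (2 π i τ)`, for all `τ` of large imaginary
part. -/
def HasFourierExpansion (f : ℂ → ℂ) (a : ℤ → ℂ) : Prop :=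
  (∃ N : ℕ, ∀ n : ℤ, n < -(N : ℤ) → a n = 0) ∧
  ∃ Y : ℝ, 0 < Y ∧ ∀ τ : ℂ, Y < τ.im →
    HasSum (fun n : ℤ => a n * exp (2 * Real.pi * I * τ) ^ n) (f τ)

/-- `f` is meromorphic at infinity. -/
def MeromorphicAtInfinity (f : ℂ → ℂ) : Prop :=
  ∃ a : ℤ → ℂ, HasFourierExpansion f a

open Classical in
/-- The Fourier coefficient `a_f(n)` of `f` at infinity. -/
def fourierCoefficient (f : ℂ → ℂ) (n : ℤ) : ℂ :=
  if h : MeromorphicAtInfinity f then h.choose n else 0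

/-- `f` is a meromorphic quasi-modular form of weight `k` and depth at most `p` on `SL(2, ℤ)`,
with component functions `F 0, …, F p` (the values `F r` with `p < r` play no role). The
transformation rule is an identity of meromorphic functions, that is, it holds at all points of
the upper half-plane where all the functions in it are regular. -/
structure IsQuasiModular (k : ℤ) (p : ℕ) (f : ℂ → ℂ) (F : ℕ → ℂ → ℂ) : Prop where
  meromorphic : MeromorphicNFOn f upperHalf
  meromorphic_component : ∀ r ≤ p, MeromorphicNFOn (F r) upperHalf
  meromorphicAtInfinity_component : ∀ r ≤ p, MeromorphicAtInfinity (F r)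
  transformation : ∀ γ : SL(2, ℤ), ∀ τ ∈ upperHalf,
    AnalyticAt ℂ f (((γ 0 0 : ℤ) * τ + (γ 0 1 : ℤ)) / ((γ 1 0 : ℤ) * τ + (γ 1 1 : ℤ))) →
    (∀ r ≤ p, AnalyticAt ℂ (F r) τ) →
    ((γ 1 0 : ℤ) * τ + (γ 1 1 : ℤ)) ^ (-k) *
        f (((γ 0 0 : ℤ) * τ + (γ 0 1 : ℤ)) / ((γ 1 0 : ℤ) * τ + (γ 1 1 : ℤ))) =
      ∑ r ∈ Finset.range (p + 1),
        F r τ * ((γ 1 0 : ℤ) / ((γ 1 0 : ℤ) * τ + (γ 1 1 : ℤ))) ^ r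

/-! ### Regularized integrals -/

/-- The regularized integral of `g` over `(T, ∞)` exists and equals `v`: the function
`w ↦ ∫_T^∞ exp (-w t) g(t) dt`, which is defined for `Re w` large, has an analytic continuation
to the upper half-plane `Im w > 0`, and this continuation extends to `w = 0` with value `v`.
(The continuation may have branch points on the positive real axis, e.g. for
`g(t) = exp (2 π n t) t ^ (s - 1)`. Continuing through `Im w > 0` is the choice of branch of the
incomplete Gamma function `Γ(s, z)` for which the cut is a ray of angle in `(π, 3 π / 2)`.) -/
def HasTailIntegral (g : ℝ → ℂ) (T : ℝ) (v : ℂ) : Prop :=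
  ∃ (R : ℝ) (G : ℂ → ℂ),
    (∀ w : ℂ, R < w.re →
      IntegrableOn (fun t : ℝ => exp (-w * t) * g t) (Ioi T) ∧
      G w = ∫ t in Ioi T, exp (-w * t) * g t) ∧
    DifferentiableOn ℂ G {w : ℂ | 0 < w.im} ∧
    Tendsto G (𝓝[{w : ℂ | 0 < w.im}] 0) (𝓝 v)

/-- The regularized integral of `g` over `(0, T)` exists and equals `v`; it is defined by the
reflection `t ↦ 1 / t`. -/
def HasHeadIntegral (g : ℝ → ℂ) (T : ℝ) (v : ℂ) : Prop :=
  HasTailIntegral (fun t : ℝ => 1 / (t : ℂ) ^ 2 * g (1 / t)) (1 / T) v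

/-- The constant term of the Laurent expansion of `Φ` at `0` is `v`. -/
def HasConstantTerm (Φ : ℂ → ℂ) (v : ℂ) : Prop :=
  ∃ (N : ℕ) (d : ℕ → ℂ),
    Tendsto (fun u : ℂ => Φ u - ∑ j ∈ Finset.range N, d j / u ^ (j + 1)) (𝓝[≠] 0) (𝓝 v)

/-- The regularized integral of `g` over `[a, b]`, where `g` has a pole at `c`, exists and equals
`v`: the function `u ↦ ∫_a^b |t - c| ^ u g(t) dt`, which is defined for `Re u` large, has a
meromorphic continuation to a half-plane containing `0`, and `v` is the constant term of its
Laurent expansion at `u = 0`. -/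
def HasFinitePartIntegral (g : ℝ → ℂ) (a b c : ℝ) (v : ℂ) : Prop :=
  ∃ (δ σ : ℝ) (Φ : ℂ → ℂ), 0 < δ ∧ MeromorphicOn Φ {u : ℂ | -δ < u.re} ∧
    (∀ u : ℂ, σ < u.re →
      IntegrableOn (fun t : ℝ => ((|t - c| : ℝ) : ℂ) ^ u * g t) (Icc a b) ∧
      Φ u = ∫ t in a..b, ((|t - c| : ℝ) : ℂ) ^ u * g t) ∧
    HasConstantTerm Φ v

/-- `g` has exactly the poles `c 0 < … < c (n - 1)` on `(0, ∞)` and is analytic elsewhere on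
`(0, ∞)`, and the points `0 < a 0 < … < a n` separate the poles: `c j` lies in the open interval
`(a j, a (j + 1))`. -/
structure IsSplitting (g : ℝ → ℂ) {n : ℕ} (a : Fin (n + 1) → ℝ) (c : Fin n → ℝ) : Prop where
  pos : 0 < a 0
  strictMono : StrictMono a
  mem : ∀ j, c j ∈ Ioo (a j.castSucc) (a j.succ)
  pole : ∀ j, meromorphicOrderAt g (c j) < 0
  analytic : ∀ t : ℝ, 0 < t → (∀ j, t ≠ c j) → AnalyticAt ℝ g t

/-- The regularized integral of `g` over `(0, ∞)` exists and equals `v`. -/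
def HasRegularizedIntegral (g : ℝ → ℂ) (v : ℂ) : Prop :=
  ∃ (n : ℕ) (a : Fin (n + 1) → ℝ) (c : Fin n → ℝ) (v₀ v₁ : ℂ) (m : Fin n → ℂ),
    IsSplitting g a c ∧
    HasHeadIntegral g (a 0) v₀ ∧
    (∀ j, HasFinitePartIntegral g (a j.castSucc) (a j.succ) (c j) (m j)) ∧
    HasTailIntegral g (a (Fin.last n)) v₁ ∧
    v = v₀ + ∑ j, m j + v₁

/-! ### The completed `L`-function -/

/-- The integrand `t ↦ f(i t) t ^ (s - 1)`. -/
def mellinIntegrand (f : ℂ → ℂ) (s : ℂ) (t : ℝ) : ℂ :=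
  f (I * t) * (t : ℂ) ^ (s - 1)

/-- `L` is the completed `L`-function `Λ(f, ·)`, that is, the meromorphic function on `ℂ`
(in normal form, so with value `0` at its poles) given by the regularized integral
`∫_0^∞ f(i t) t ^ (s - 1) dt`. Here `(0, ∞)` is split as in the definition of the regularized
integral. A nonzero constant term of `f` at infinity restricts the existence of the regularized
integral over `(a n, ∞)` to a left half-plane of `s`, and constant terms of the components restrict
that over `(0, a 0)` to a right half-plane, and these can be disjoint; as functions of `s`,
the two parts therefore stand for their meromorphic continuations `A` and `B`. -/
def IsCompletedLFunction (f : ℂ → ℂ) (L : ℂ → ℂ) : Prop :=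
  MeromorphicNFOn L univ ∧
  ∃ (n : ℕ) (a : Fin (n + 1) → ℝ) (c : Fin n → ℝ) (A B : ℂ → ℂ) (M : Fin n → ℂ → ℂ),
    IsSplitting (fun t : ℝ => f (I * t)) a c ∧
    MeromorphicOn A univ ∧
    (∃ σ : ℝ, ∀ s : ℂ, s.re < σ →
      HasTailIntegral (mellinIntegrand f s) (a (Fin.last n)) (A s)) ∧
    MeromorphicOn B univ ∧
    (∃ σ : ℝ, ∀ s : ℂ, σ < s.re → HasHeadIntegral (mellinIntegrand f s) (a 0) (B s)) ∧
    (∀ j s, HasFinitePartIntegral (mellinIntegrand f s) (a j.castSucc) (a j.succ) (c j) (M j s)) ∧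
    L =ᶠ[codiscrete ℂ] fun s => B s + ∑ j, M j s + A s

open Classical in
/-- The completed `L`-function `Λ(f, s)` (and `0` if it does not exist). -/
def completedL (f : ℂ → ℂ) : ℂ → ℂ :=
  if h : ∃ L : ℂ → ℂ, IsCompletedLFunction f L then h.choose else 0

/-- The completed `L`-function of `f` exists, does not depend on the choice of the splitting of
`(0, ∞)`, and extends the function `s ↦ ∫_0^∞ f(i t) t ^ (s - 1) dt` defined by the regularized
integral wherever that exists. -/
def HasMeromorphicExtension (f : ℂ → ℂ) : Prop :=
  (∃! L : ℂ → ℂ, IsCompletedLFunction f L) ∧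
  IsCompletedLFunction f (completedL f) ∧
  ∀ s v : ℂ, HasRegularizedIntegral (mellinIntegrand f s) v → completedL f s = v

end QuasiModular

end

noncomputable section

namespace QuasiModular

/-! ### Parametric integrals -/

/-! For `γ = S` the transformation rule reads `f(i/t) = ∑ i^(k-r) t^(k-r) f_r(it)`, so `t ↦ 1/t`
turns the head of the Mellin integral of `f` at `s` into a combination of tails for the `f_r` at `k
- r - s`. The proof is Riemann's argument for this symmetry; the work lies in showing that the
regularized pieces obey the rules of ordinary integrals.

Tails. For large `t`, `f(it)` is a finite sum of growing exponentials, a constant `a`, and an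
exponentially small rest. When `Im w > 0` the path `(T, ∞)` can be rotated to `T - i(0, ∞)`, where
`exp(-wt)` decays; this is the continuation in `w`. The growing exponentials and the rest yield
entire functions of `s`, while the constant yields `-a T^s / s` for `Re s < 0`. A tail is thus an
entire function minus `a / s`. Conversely, by `HasTailIntegral.limit_eq_zero`, no regularized tail
exists if `a ≠ 0` and `Re s ≥ 0`; hence wherever the regularized integral exists, the continuations
are regular and have its value.

Poles on the axis. Away from the poles, `f(it) t^(s-1)` has a primitive `P s`, entire in `s`, that
near each pole `c` is a multiple of `log |t - c|` plus a polynomial in `1/(t - c)` plus `o(1)`. This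
normalization ties the constants on the two sides of a pole together, so `P s` is unique up to one
constant (`IsLogPrimitive.const_of_zero`), and the finite part integral over `[a, b]` is `P s b - P
s a`. Writing the tail as `A s - P s T` and the head as `B s + P s T`, the middle terms telescope
and `Λ = A + B`, independently of the splitting.

Functional equation. The reflected primitive of `f` and the combination of the primitives of the
`f_r` differ by an entire function `κ s`. Reflecting the head of `f` gives `B s = ∑ C_r A_r(k-r-s) +
κ s`; reflecting the heads of the `f_r` gives `∑ C_r B_r(k-r-s) = A s + κ s`. Together these give `A
+ B = ∑ C_r (A_r + B_r)(k-r-s)`. The poles are those of `-a/s` in `A` and in the `A_r`, which gives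
the residues.

Components. Two matrices carrying `-1/τ` and `τ` to the same point `-1/(τ - c)` give, for `c = 0, …,
p`, a polynomial identity whose coefficients express `f_m(-1/τ)` through the `f_(m+r)(τ)`. So each
`f_m` has an inversion formula of the same shape, and the same argument applies. -/

/-- Integrability on an open set of parameters already dominates the derivative: `‖l‖ exp(δ‖l‖)` is
at most a constant times the sum of the four exponentials obtained by moving `w` by `±4δ` and
`±4δi`. All holomorphy in `w`, `s` or `u` below comes from this, with `l` equal to `-t`, `log t`,
`log |t - c|` or a complex logarithm. -/
theorem hasDerivAt_integral_exp_mul {α : Type*} [MeasurableSpace α] {μ : Measure α} {l φ : α → ℂ}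
    (hl : AEStronglyMeasurable l μ) (hφ : AEStronglyMeasurable φ μ) {U : Set ℂ} (hU : IsOpen U)
    (h : ∀ w ∈ U, Integrable (fun x => exp (w * l x) * φ x) μ) {w : ℂ} (hw : w ∈ U) :
    Integrable (fun x => l x * exp (w * l x) * φ x) μ ∧
      HasDerivAt (fun w => ∫ x, exp (w * l x) * φ x ∂μ) (∫ x, l x * exp (w * l x) * φ x ∂μ) w := by
  obtain ⟨ε, hε, hball⟩ := Metric.isOpen_iff.1 hU w hw
  set δ : ℝ := ε / 8 with hδ
  have hδ0 : 0 < δ := by positivity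
  have hmem : ∀ κ : ℂ, ‖κ‖ = 4 * δ → w + κ ∈ U := fun κ hκ => hball (by
    rw [Metric.mem_ball, dist_eq_norm, add_sub_cancel_left, hκ, hδ]; linarith)
  have n1 : ‖((4 * δ : ℝ) : ℂ)‖ = 4 * δ := by
    rw [Complex.norm_real, Real.norm_of_nonneg (by positivity)]
  have n2 : ‖-((4 * δ : ℝ) : ℂ)‖ = 4 * δ := by rw [norm_neg, n1]
  have n3 : ‖((4 * δ : ℝ) : ℂ) * I‖ = 4 * δ := by rw [norm_mul, n1, norm_I, mul_one]
  have n4 : ‖-(((4 * δ : ℝ) : ℂ) * I)‖ = 4 * δ := by rw [norm_neg, n3]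
  have hmeas : ∀ z : ℂ, AEStronglyMeasurable (fun x => exp (z * l x)) μ := fun z =>
    continuous_exp.comp_aestronglyMeasurable (hl.const_mul z)
  refine hasDerivAt_integral_of_dominated_loc_of_deriv_le
    (F := fun w x => exp (w * l x) * φ x) (F' := fun w x => l x * exp (w * l x) * φ x)
    (bound := fun x => (1 / δ) * (‖exp ((w + ((4 * δ : ℝ) : ℂ)) * l x) * φ x‖ +
      ‖exp ((w + -((4 * δ : ℝ) : ℂ)) * l x) * φ x‖ +
      ‖exp ((w + ((4 * δ : ℝ) : ℂ) * I) * l x) * φ x‖ +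
      ‖exp ((w + -(((4 * δ : ℝ) : ℂ) * I)) * l x) * φ x‖))
    (Metric.ball_mem_nhds w hδ0) ?_ (h w hw) ?_ ?_ ?_ ?_
  · exact Eventually.of_forall fun z => (hmeas z).mul hφ
  · exact (hl.mul (hmeas w)).mul hφ
  · refine Eventually.of_forall fun x z hz => ?_
    rw [Metric.mem_ball, dist_eq_norm] at hz
    simp only [norm_mul, norm_exp]
    have e : (w + ((4 * δ : ℝ) : ℂ)) * l x = w * l x + ((4 * δ : ℝ) : ℂ) * l x := by ring
    have e2 : (w + -((4 * δ : ℝ) : ℂ)) * l x = w * l x + ((-(4 * δ) : ℝ) : ℂ) * l x := by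
      push_cast; ring
    have e3 : (w + ((4 * δ : ℝ) : ℂ) * I) * l x = w * l x + ((4 * δ : ℝ) : ℂ) * (I * l x) := by ring
    have e4 : (w + -(((4 * δ : ℝ) : ℂ) * I)) * l x =
      w * l x + ((-(4 * δ) : ℝ) : ℂ) * (I * l x) := by push_cast; ring
    rw [e, e2, e3, e4]
    simp only [add_re, re_ofReal_mul, I_mul_re]
    set A := (w * l x).re
    have hz' : (z * l x).re ≤ A + δ * ‖l x‖ := by
      have : z * l x = w * l x + (z - w) * l x := by ring
      rw [this, add_re]
      have h1 : ((z - w) * l x).re ≤ ‖(z - w) * l x‖ := re_le_norm _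
      rw [norm_mul] at h1
      have := mul_le_mul_of_nonneg_right hz.le (norm_nonneg (l x))
      linarith
    have h1 : ‖l x‖ ≤ 1 / δ * Real.exp (δ * ‖l x‖) := by
      have := Real.add_one_le_exp (δ * ‖l x‖)
      rw [div_mul_eq_mul_div, one_mul, le_div_iff₀ hδ0]; linarith
    have h2 : ‖l x‖ * Real.exp (z * l x).re ≤ 1 / δ * Real.exp (A + 2 * δ * ‖l x‖) := by
      calc _ ≤ (1 / δ * Real.exp (δ * ‖l x‖)) * Real.exp (A + δ * ‖l x‖) := by gcongr
        _ = _ := by rw [mul_assoc, ← Real.exp_add]; ring_nf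
    -- Since `‖l‖ ≤ 2 max(|Re l|, |Im l|)`, one of the four exponentials dominates.
    have h3 : Real.exp (A + 2 * δ * ‖l x‖) ≤ Real.exp (A + 4 * δ * (l x).re) +
        Real.exp (A + -(4 * δ) * (l x).re) + Real.exp (A + 4 * δ * (-(l x).im)) +
        Real.exp (A + -(4 * δ) * (-(l x).im)) := by
      have hn := norm_le_abs_re_add_abs_im (l x)
      have p1 := Real.exp_pos (A + 4 * δ * (l x).re)
      have p2 := Real.exp_pos (A + -(4 * δ) * (l x).re)
      have p3 := Real.exp_pos (A + 4 * δ * (-(l x).im))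
      have p4 := Real.exp_pos (A + -(4 * δ) * (-(l x).im))
      rcases le_total |(l x).re| |(l x).im| with hle | hle
      · have hn' : 2 * δ * ‖l x‖ ≤ 4 * δ * |(l x).im| := by nlinarith
        rcases abs_cases (l x).im with ⟨hh, _⟩ | ⟨hh, _⟩ <;> rw [hh] at hn'
        · have : Real.exp (A + 2 * δ * ‖l x‖) ≤ Real.exp (A + -(4 * δ) * (-(l x).im)) :=
            Real.exp_le_exp.2 (by linarith)
          linarith
        · have : Real.exp (A + 2 * δ * ‖l x‖) ≤ Real.exp (A + (4 * δ) * (-(l x).im)) :=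
            Real.exp_le_exp.2 (by linarith)
          linarith
      · have hn' : 2 * δ * ‖l x‖ ≤ 4 * δ * |(l x).re| := by nlinarith
        rcases abs_cases (l x).re with ⟨hh, _⟩ | ⟨hh, _⟩ <;> rw [hh] at hn'
        · have : Real.exp (A + 2 * δ * ‖l x‖) ≤ Real.exp (A + (4 * δ) * ((l x).re)) :=
            Real.exp_le_exp.2 (by linarith)
          linarith
        · have : Real.exp (A + 2 * δ * ‖l x‖) ≤ Real.exp (A + -(4 * δ) * ((l x).re)) :=
            Real.exp_le_exp.2 (by linarith)
          linarith
    calc _ ≤ (1 / δ * Real.exp (A + 2 * δ * ‖l x‖)) * ‖φ x‖ := by gcongr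
      _ ≤ (1 / δ * (Real.exp (A + 4 * δ * (l x).re) +
        Real.exp (A + -(4 * δ) * (l x).re) + Real.exp (A + 4 * δ * (-(l x).im)) +
        Real.exp (A + -(4 * δ) * (-(l x).im)))) * ‖φ x‖ := by gcongr
      _ = _ := by ring
  · exact ((((h _ (hmem _ n1)).norm.add (h _ (hmem _ n2)).norm).add
      (h _ (hmem _ n3)).norm).add (h _ (hmem _ n4)).norm).const_mul _
  · refine Eventually.of_forall fun x z _ => ?_
    have := (((hasDerivAt_id z).mul_const (l x)).cexp).mul_const (φ x)
    exact this.congr_deriv (by simp only [id]; ring)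

/-- A holomorphic function decaying exponentially in a quadrant has the same integral along both
edges of the quadrant. -/
theorem integral_horizontal_eq_vertical {Φ : ℂ → ℂ} {T Y C κ : ℝ} (hYT : Y < T) (hκ : 0 < κ)
    (hd : DifferentiableOn ℂ Φ {τ : ℂ | Y < τ.im})
    (hb : ∀ x y : ℝ, 0 ≤ x → T ≤ y → ‖Φ (x + y * I)‖ ≤ C * Real.exp (-κ * (x + y))) :
    IntegrableOn (fun x : ℝ => Φ (x + T * I)) (Ioi 0) ∧
    IntegrableOn (fun y : ℝ => Φ (y * I)) (Ioi T) ∧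
    ∫ x in Ioi (0 : ℝ), Φ (x + T * I) = I * ∫ y in Ioi T, Φ (y * I) := by
  have hexp : ∀ S : ℝ, IntegrableOn (fun x => Real.exp (-κ * x)) (Ioi S) := fun S =>
    integrableOn_exp_mul_Ioi (by linarith) S
  have hc : ContinuousOn Φ {τ : ℂ | Y < τ.im} := hd.continuousOn
  have i1 : IntegrableOn (fun x : ℝ => Φ (x + T * I)) (Ioi 0) := by
    refine Integrable.mono' ((hexp 0).const_mul (C * Real.exp (-κ * T))) ?_ ?_
    · refine (Continuous.continuousOn (hc.comp_continuous (by fun_prop) fun x => ?_)).aestronglyMeasurable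
        measurableSet_Ioi
      simpa using hYT
    · refine (ae_restrict_iff' measurableSet_Ioi).2 (Eventually.of_forall fun x hx => ?_)
      refine (hb x T (le_of_lt hx) le_rfl).trans (le_of_eq ?_)
      rw [mul_assoc, ← Real.exp_add]; ring_nf
  have i2 : IntegrableOn (fun y : ℝ => Φ (y * I)) (Ioi T) := by
    refine Integrable.mono' ((hexp T).const_mul C) ?_ ?_
    · refine (hc.comp (by fun_prop) fun y hy => ?_).aestronglyMeasurable measurableSet_Ioi
      simpa using hYT.trans hy
    · refine (ae_restrict_iff' measurableSet_Ioi).2 (Eventually.of_forall fun y hy => ?_)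
      simpa using hb 0 y le_rfl (le_of_lt hy)
  refine ⟨i1, i2, ?_⟩
  have hC : 0 ≤ C := by
    have := (norm_nonneg _).trans (hb 0 T le_rfl le_rfl)
    exact nonneg_of_mul_nonneg_left this (Real.exp_pos _)
  -- Cauchy's theorem on the square with opposite corners `iT` and `n + i(T + n)`; the two far sides
  -- are `O(n exp(-κ n))`.
  have hrect : ∀ n : ℕ, (∫ x : ℝ in (0:ℝ)..n, Φ (x + T * I)) - (∫ x : ℝ in (0:ℝ)..n, Φ (x + ((T + n : ℝ) : ℂ) * I))
      + I * (∫ y : ℝ in T..(T + n), Φ (((n : ℝ) : ℂ) + y * I)) - I * (∫ y : ℝ in T..(T + n), Φ (y * I)) = 0 := by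
    intro n
    have hsub : uIcc (T * I : ℂ).re (((n : ℝ) : ℂ) + ((T + n : ℝ) : ℂ) * I).re ×ℂ
        uIcc (T * I : ℂ).im (((n : ℝ) : ℂ) + ((T + n : ℝ) : ℂ) * I).im ⊆ {τ : ℂ | Y < τ.im} := by
      intro τ hτ
      have h2 := hτ.2
      simp only [mul_im, ofReal_re, I_im, mul_one, ofReal_im, I_re, mul_zero, add_zero, add_im,
        zero_add, mem_preimage] at h2
      rw [uIcc_of_le (by simp)] at h2
      exact hYT.trans_le h2.1
    have := Complex.integral_boundary_rect_eq_zero_of_differentiableOn Φ (T * I)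
      (((n : ℝ) : ℂ) + ((T + n : ℝ) : ℂ) * I) (hd.mono hsub)
    simpa using this
  have hn : Tendsto (fun n : ℕ => (n : ℝ)) atTop atTop := tendsto_natCast_atTop_atTop
  have hTn : Tendsto (fun n : ℕ => T + (n : ℝ)) atTop atTop := tendsto_atTop_add_const_left _ _ hn
  have t1 := intervalIntegral_tendsto_integral_Ioi 0 i1 hn
  have t2 := intervalIntegral_tendsto_integral_Ioi T i2 hTn
  have hdec : Tendsto (fun n : ℕ => C * Real.exp (-κ * T) * ((n : ℝ) * Real.exp (-κ * n))) atTop (𝓝 0) := by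
    have h := (Real.tendsto_pow_mul_exp_neg_atTop_nhds_zero 1).comp (hn.const_mul_atTop hκ)
    have h2 := (h.const_mul (1 / κ)).const_mul (C * Real.exp (-κ * T))
    simp only [mul_zero] at h2
    refine h2.congr fun n => ?_
    simp only [Function.comp, pow_one]
    field_simp
  have t3 : Tendsto (fun n : ℕ => ∫ x : ℝ in (0:ℝ)..n, Φ (x + ((T + n : ℝ) : ℂ) * I)) atTop (𝓝 0) := by
    refine squeeze_zero_norm (fun n => ?_) hdec
    have := intervalIntegral.norm_integral_le_of_norm_le_const (a := 0) (b := n)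
      (C := C * Real.exp (-κ * T) * Real.exp (-κ * n))
      (f := fun x : ℝ => Φ (x + ((T + n : ℝ) : ℂ) * I)) (fun x hx => ?_)
    · rw [sub_zero, abs_of_nonneg (Nat.cast_nonneg n)] at this
      linarith
    · rw [uIoc_of_le (Nat.cast_nonneg n)] at hx
      refine (hb x (T + n) hx.1.le (by simp)).trans ?_
      rw [mul_assoc, ← Real.exp_add]
      gcongr
      nlinarith [hx.1]
  have t4 : Tendsto (fun n : ℕ => ∫ y : ℝ in T..(T + n), Φ (((n : ℝ) : ℂ) + y * I)) atTop (𝓝 0) := by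
    refine squeeze_zero_norm (fun n => ?_) hdec
    have := intervalIntegral.norm_integral_le_of_norm_le_const (a := T) (b := T + n)
      (C := C * Real.exp (-κ * T) * Real.exp (-κ * n))
      (f := fun y : ℝ => Φ (((n : ℝ) : ℂ) + y * I)) (fun y hy => ?_)
    · rw [add_sub_cancel_left, abs_of_nonneg (Nat.cast_nonneg n)] at this
      linarith
    · rw [uIoc_of_le (by simp)] at hy
      refine (hb n y (Nat.cast_nonneg n) hy.1.le).trans ?_
      rw [mul_assoc, ← Real.exp_add]
      gcongr
      nlinarith [hy.1]
  have := ((t1.sub t3).add (t4.const_mul I)).sub (t2.const_mul I)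
  have h0 := tendsto_nhds_unique (this.congr hrect) tendsto_const_nhds
  linear_combination h0

theorem rpow_le_const_mul_exp (a : ℝ) {T ε : ℝ} (hT : 0 < T) (hε : 0 < ε) :
    ∃ C : ℝ, 0 < C ∧ ∀ x : ℝ, T ≤ x → x ^ a ≤ C * Real.exp (ε * x) := by
  rcases le_or_gt a 0 with ha | ha
  · refine ⟨T ^ a, by positivity, fun x hx => ?_⟩
    have h1 : x ^ a ≤ T ^ a := Real.rpow_le_rpow_of_nonpos hT hx ha
    have h2 : 1 ≤ Real.exp (ε * x) := Real.one_le_exp (by nlinarith)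
    have : 0 < T ^ a := by positivity
    nlinarith
  · refine ⟨(a / ε) ^ a, by positivity, fun x hx => ?_⟩
    have hx0 : 0 < x := hT.trans_le hx
    have h1 : ε * x / a ≤ Real.exp (ε * x / a) := by
      linarith [Real.add_one_le_exp (ε * x / a)]
    calc x ^ a = (a / ε) ^ a * (ε * x / a) ^ a := by
          rw [← Real.mul_rpow (by positivity) (by positivity)]
          congr 1; field_simp
      _ ≤ (a / ε) ^ a * Real.exp (ε * x / a) ^ a := by gcongr
      _ = _ := by rw [← Real.exp_mul]; congr 2; field_simp

theorem norm_cpow_le_rpow_mul_exp {z : ℂ} (hz : z ≠ 0) (s : ℂ) :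
    ‖z ^ s‖ ≤ ‖z‖ ^ s.re * Real.exp (Real.pi * |s.im|) := by
  rw [norm_cpow_of_ne_zero hz, div_eq_mul_inv, ← Real.exp_neg]
  gcongr
  have h1 := abs_arg_le_pi z
  calc -(z.arg * s.im) ≤ |z.arg * s.im| := neg_le_abs _
    _ = |z.arg| * |s.im| := abs_mul _ _
    _ ≤ _ := by gcongr

theorem norm_cpow_le_const_mul_exp (s : ℂ) {T ε : ℝ} (hT : 0 < T) (hε : 0 < ε) :
    ∃ C : ℝ, 0 < C ∧ ∀ z : ℂ, T ≤ ‖z‖ → ‖z ^ s‖ ≤ C * Real.exp (ε * ‖z‖) := by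
  obtain ⟨C, hC, h⟩ := rpow_le_const_mul_exp s.re hT hε
  refine ⟨C * Real.exp (Real.pi * |s.im|), by positivity, fun z hz => ?_⟩
  have hz0 : z ≠ 0 := norm_pos_iff.1 (hT.trans_le hz)
  refine (norm_cpow_le_rpow_mul_exp hz0 s).trans ?_
  calc _ ≤ (C * Real.exp (ε * ‖z‖)) * Real.exp (Real.pi * |s.im|) := by
        gcongr; exact h _ hz
    _ = _ := by ring

/-! ### Regularized integrals over `(T, ∞)` -/

theorem isPreconnected_im_pos : IsPreconnected {w : ℂ | 0 < w.im} :=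
  (convex_halfSpace_im_gt 0).isPreconnected

theorem isOpen_im_gt (Y : ℝ) : IsOpen {w : ℂ | Y < w.im} := isOpen_lt continuous_const continuous_im

theorem isOpen_re_gt (Y : ℝ) : IsOpen {w : ℂ | Y < w.re} := isOpen_lt continuous_const continuous_re

theorem isOpen_re_lt (Y : ℝ) : IsOpen {w : ℂ | w.re < Y} := isOpen_lt continuous_re continuous_const

instance neBot_nhdsWithin_im_pos (x : ℝ) : (𝓝[{w : ℂ | 0 < w.im}] (x : ℂ)).NeBot := by
  rw [← mem_closure_iff_nhdsWithin_neBot, closure_setOfPred_lt_im]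
  simp

instance neBot_nhdsWithin_im_pos_zero : (𝓝[{w : ℂ | 0 < w.im}] (0 : ℂ)).NeBot := by
  simpa using neBot_nhdsWithin_im_pos 0

/-- Two continuations agree for large `Re w`, hence on the connected half-plane `Im w > 0`, which
accumulates at `0`. -/
theorem HasTailIntegral.unique {g : ℝ → ℂ} {T : ℝ} {v v' : ℂ} (h : HasTailIntegral g T v)
    (h' : HasTailIntegral g T v') : v = v' := by
  obtain ⟨R, G, hG, hGd, hGt⟩ := h
  obtain ⟨R', G', hG', hGd', hGt'⟩ := h'
  have heq : EqOn G G' {w : ℂ | 0 < w.im} := by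
    refine (hGd.analyticOnNhd (isOpen_im_gt 0)).eqOn_of_preconnected_of_eventuallyEq
      (hGd'.analyticOnNhd (isOpen_im_gt 0)) isPreconnected_im_pos
      (z₀ := ((max R R' + 1 : ℝ) : ℂ) + I) (by simp) ?_
    have : {w : ℂ | max R R' < w.re} ∈ 𝓝 (((max R R' + 1 : ℝ) : ℂ) + I) :=
      (isOpen_re_gt _).mem_nhds (by
        have := le_max_left R R'; have := le_max_right R R'
        simp only [mem_ofPred_eq, add_re, ofReal_re, I_re]; linarith)
    filter_upwards [this] with w hw
    rw [(hG w ((le_max_left _ _).trans_lt hw)).2, (hG' w ((le_max_right _ _).trans_lt hw)).2]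
  refine tendsto_nhds_unique (hGt.congr' ?_) hGt'
  filter_upwards [self_mem_nhdsWithin] with w hw using heq hw

theorem HasTailIntegral.congr {g g' : ℝ → ℂ} {T : ℝ} {v : ℂ} (h : HasTailIntegral g T v)
    (hg : ∀ t, T < t → g t = g' t) : HasTailIntegral g' T v := by
  obtain ⟨R, G, hG, hGd, hGt⟩ := h
  refine ⟨R, G, fun w hw => ?_, hGd, hGt⟩
  have heq : EqOn (fun t : ℝ => exp (-w * t) * g t) (fun t : ℝ => exp (-w * t) * g' t) (Ioi T) :=
    fun t ht => by simp only [hg t ht]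
  rw [(hG w hw).2, setIntegral_congr_fun measurableSet_Ioi heq]
  exact ⟨(hG w hw).1.congr_fun heq measurableSet_Ioi, rfl⟩

theorem HasTailIntegral.add {g g' : ℝ → ℂ} {T : ℝ} {v v' : ℂ} (h : HasTailIntegral g T v)
    (h' : HasTailIntegral g' T v') : HasTailIntegral (fun t => g t + g' t) T (v + v') := by
  obtain ⟨R, G, hG, hGd, hGt⟩ := h
  obtain ⟨R', G', hG', hGd', hGt'⟩ := h'
  refine ⟨max R R', fun w => G w + G' w, fun w hw => ?_, hGd.add hGd', hGt.add hGt'⟩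
  obtain ⟨i, e⟩ := hG w ((le_max_left _ _).trans_lt hw)
  obtain ⟨i', e'⟩ := hG' w ((le_max_right _ _).trans_lt hw)
  simp only [mul_add]
  exact ⟨i.add i', by rw [e, e', integral_add i i']⟩

theorem HasTailIntegral.const_mul {g : ℝ → ℂ} {T : ℝ} {v : ℂ} (h : HasTailIntegral g T v) (c : ℂ) :
    HasTailIntegral (fun t => c * g t) T (c * v) := by
  obtain ⟨R, G, hG, hGd, hGt⟩ := h
  refine ⟨R, fun w => c * G w, fun w hw => ?_, hGd.const_mul c, hGt.const_mul c⟩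
  obtain ⟨i, e⟩ := hG w hw
  simp only [mul_left_comm _ c]
  exact ⟨i.const_mul c, by rw [e, integral_const_mul]⟩

theorem HasTailIntegral.zero (T : ℝ) : HasTailIntegral (fun _ => 0) T 0 :=
  ⟨0, fun _ => 0, by simp, differentiableOn_const _, tendsto_const_nhds⟩

theorem HasTailIntegral.sum {ι : Type*} {g : ι → ℝ → ℂ} {T : ℝ} {v : ι → ℂ} {s : Finset ι}
    (h : ∀ i ∈ s, HasTailIntegral (g i) T (v i)) :
    HasTailIntegral (fun t => ∑ i ∈ s, g i t) T (∑ i ∈ s, v i) := by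
  classical
  induction s using Finset.induction_on with
  | empty => simpa using HasTailIntegral.zero T
  | insert a s ha ih =>
    simp only [Finset.sum_insert ha]
    exact (h a (by simp)).add (ih fun i hi => h i (by simp [hi]))

/-- The finite integral `w ↦ ∫_a^b exp (-w t) g(t) dt` is entire. -/
theorem differentiable_intervalIntegral_exp_mul {g : ℝ → ℂ} {a b : ℝ}
    (hg : IntervalIntegrable g volume a b) :
    Differentiable ℂ (fun w : ℂ => ∫ t in a..b, exp (-w * t) * g t) := by
  have key : ∀ {a b : ℝ}, IntegrableOn g (Ioc a b) →
      Differentiable ℂ (fun w : ℂ => ∫ t in Ioc a b, exp (-w * t) * g t) := by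
    intro a b hg w
    have := (hasDerivAt_integral_exp_mul (μ := volume.restrict (Ioc a b)) (l := fun t => -(t : ℂ))
      (φ := g) (by fun_prop) hg.aestronglyMeasurable isOpen_univ (fun w _ => ?_) (mem_univ w)).2
    · simpa using this.differentiableAt
    · have hi : IntegrableOn g (Icc a b) := by rwa [integrableOn_Icc_iff_integrableOn_Ioc]
      have hc : ContinuousOn (fun t : ℝ => exp (w * -(t : ℂ))) (Icc a b) := by fun_prop
      exact (hi.continuousOn_mul hc isCompact_Icc).mono_set Ioc_subset_Icc_self
  simp only [intervalIntegral]
  exact (key hg.1).sub (key hg.2)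

/-- The integral over the finite piece is entire in `w`, so it contributes its value at `w = 0`. -/
theorem HasTailIntegral.shift {g : ℝ → ℂ} {T T' : ℝ} {v : ℂ} (h : HasTailIntegral g T v)
    (hg : IntervalIntegrable g volume T' T) : HasTailIntegral g T' (v + ∫ t in T'..T, g t) := by
  obtain ⟨R, G, hG, hGd, hGt⟩ := h
  have hd := differentiable_intervalIntegral_exp_mul hg
  refine ⟨R, fun w => G w + ∫ t in T'..T, exp (-w * t) * g t, fun w hw => ?_,
    hGd.add hd.differentiableOn, hGt.add ?_⟩
  · obtain ⟨i, e⟩ := hG w hw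
    have hi : IntervalIntegrable (fun t : ℝ => exp (-w * t) * g t) volume T' T :=
      hg.continuousOn_mul (by fun_prop)
    have i' : IntegrableOn (fun t : ℝ => exp (-w * t) * g t) (Ioi T') := by
      refine (i.union hi.1).mono_set fun t ht => ?_
      rcases lt_or_ge T t with h | h
      · exact Or.inl h
      · exact Or.inr ⟨ht, h⟩
    refine ⟨i', ?_⟩
    simp only
    rw [e, ← intervalIntegral.integral_Ioi_sub_Ioi' i' i]
    ring
  · have := (hd 0).continuousAt.tendsto
    simp only [neg_zero, zero_mul, Complex.exp_zero, one_mul] at this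
    exact this.mono_left nhdsWithin_le_nhds

/-! ### Rotation of the path of integration -/

/-- The analytic continuation of `w ↦ ∫_T^∞ exp (-w t) φ(i t) t ^ (s - 1) dt` to `Im w > 0`, obtained
by rotating the path of integration to the horizontal half-line from `i T`. -/
def rotatedIntegral (φ : ℂ → ℂ) (T : ℝ) (s w : ℂ) : ℂ :=
  -I * ∫ x in Ioi (0 : ℝ), exp (w * (I * (x + T * I))) * (φ (x + T * I) * (-I * (x + T * I)) ^ (s - 1))

/-- The power of `τ` costs only an arbitrarily small `ε` in the exponents, so decay in `x` is
governed by `Im w` and decay in `y` by `Re w - K`. -/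
theorem norm_integrand_le {φ : ℂ → ℂ} {T C K : ℝ} (hT : 0 < T)
    (hb : ∀ τ : ℂ, T ≤ τ.im → ‖φ τ‖ ≤ C * Real.exp (K * τ.im)) (s : ℂ) {ε : ℝ} (hε : 0 < ε) :
    ∃ C' : ℝ, ∀ (w : ℂ) (x y : ℝ), 0 ≤ x → T ≤ y →
      ‖exp (w * (I * (x + y * I))) * (φ (x + y * I) * (-I * (x + y * I)) ^ (s - 1))‖ ≤
        C' * Real.exp (-(w.im - ε) * x - (w.re - K - ε) * y) := by
  obtain ⟨C', hC', h⟩ := norm_cpow_le_const_mul_exp (s - 1) hT hε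
  have hC : 0 ≤ C := by
    have := (norm_nonneg _).trans (hb (T * I) (by simp))
    exact nonneg_of_mul_nonneg_left this (Real.exp_pos _)
  refine ⟨C * C', fun w x y hx hy => ?_⟩
  have hn : ‖-I * ((x : ℂ) + y * I)‖ = ‖(x : ℂ) + y * I‖ := by simp
  have him : ((x : ℂ) + y * I).im = y := by simp
  have hle : ‖(x : ℂ) + y * I‖ ≤ x + y := by
    refine (norm_add_le _ _).trans (le_of_eq ?_)
    simp [abs_of_nonneg hx, abs_of_pos (hT.trans_le hy)]
  have hge : T ≤ ‖(x : ℂ) + y * I‖ := by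
    refine hy.trans ?_
    have := abs_im_le_norm ((x : ℂ) + y * I)
    rw [him] at this
    exact (le_abs_self y).trans this
  have h1 := hb (x + y * I) (by rwa [him])
  rw [him] at h1
  have h2 := h (-I * (x + y * I)) (by rwa [hn])
  rw [hn] at h2
  have h3 : ‖exp (w * (I * (x + y * I)))‖ = Real.exp (-w.im * x - w.re * y) := by
    rw [norm_exp]; congr 1; simp; ring
  rw [norm_mul, norm_mul, h3]
  calc _ ≤ Real.exp (-w.im * x - w.re * y) * ((C * Real.exp (K * y)) * (C' * Real.exp (ε * (x + y)))) := by
        gcongr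
        refine h2.trans ?_
        gcongr
    _ = C * C' * (Real.exp (-w.im * x - w.re * y) * Real.exp (K * y) * Real.exp (ε * (x + y))) := by ring
    _ = _ := by rw [← Real.exp_add, ← Real.exp_add]; congr 2; ring

theorem rotated_slit {x y : ℝ} (hy : 0 < y) : -I * ((x : ℂ) + y * I) ∈ slitPlane := by
  rw [mem_slitPlane_iff]; left; simp [hy]

section rotated

variable {φ : ℂ → ℂ} {T Y C K : ℝ}

theorem aestronglyMeasurable_rotated (hY : 0 ≤ Y) (hYT : Y < T)
    (hd : DifferentiableOn ℂ φ {τ : ℂ | Y < τ.im}) (s : ℂ) :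
    Continuous (fun x : ℝ => φ (x + T * I) * (-I * (x + T * I)) ^ (s - 1)) := by
  refine (hd.continuousOn.comp_continuous (by fun_prop) fun x => by simpa using hYT).mul ?_
  refine Continuous.cpow (by fun_prop) continuous_const fun x => rotated_slit (hY.trans_lt hYT)

theorem integrableOn_rotated (hY : 0 ≤ Y) (hYT : Y < T)
    (hd : DifferentiableOn ℂ φ {τ : ℂ | Y < τ.im})
    (hb : ∀ τ : ℂ, T ≤ τ.im → ‖φ τ‖ ≤ C * Real.exp (K * τ.im)) (s : ℂ) {w : ℂ} (hw : 0 < w.im) :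
    IntegrableOn (fun x : ℝ => exp (w * (I * (x + T * I))) *
      (φ (x + T * I) * (-I * (x + T * I)) ^ (s - 1))) (Ioi 0) := by
  obtain ⟨C', h⟩ := norm_integrand_le (hY.trans_lt hYT) hb s (half_pos hw)
  refine Integrable.mono' ((integrableOn_exp_mul_Ioi (a := -(w.im - w.im / 2)) (by linarith) 0).const_mul
    (C' * Real.exp (-(w.re - K - w.im / 2) * T))) ?_ ?_
  · exact ((by fun_prop : Continuous fun x : ℝ => exp (w * (I * (x + T * I)))).mul
      (aestronglyMeasurable_rotated hY hYT hd s)).aestronglyMeasurable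
  · refine (ae_restrict_iff' measurableSet_Ioi).2 (Eventually.of_forall fun x hx => ?_)
    refine (h w x T (le_of_lt hx) le_rfl).trans (le_of_eq ?_)
    rw [mul_assoc, ← Real.exp_add]; ring_nf

theorem differentiableOn_rotatedIntegral (hY : 0 ≤ Y) (hYT : Y < T)
    (hd : DifferentiableOn ℂ φ {τ : ℂ | Y < τ.im})
    (hb : ∀ τ : ℂ, T ≤ τ.im → ‖φ τ‖ ≤ C * Real.exp (K * τ.im)) (s : ℂ) :
    DifferentiableOn ℂ (rotatedIntegral φ T s) {w : ℂ | 0 < w.im} := fun w hw =>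
  ((hasDerivAt_integral_exp_mul (μ := volume.restrict (Ioi 0))
    (l := fun x : ℝ => I * (x + T * I)) (by fun_prop)
    (aestronglyMeasurable_rotated hY hYT hd s).aestronglyMeasurable (isOpen_im_gt 0)
    (fun _ hw => integrableOn_rotated hY hYT hd hb s hw) hw).2.differentiableAt.const_mul
      (-I)).differentiableWithinAt

theorem integrableOn_direct (hY : 0 ≤ Y) (hYT : Y < T)
    (hd : DifferentiableOn ℂ φ {τ : ℂ | Y < τ.im})
    (hb : ∀ τ : ℂ, T ≤ τ.im → ‖φ τ‖ ≤ C * Real.exp (K * τ.im)) (s : ℂ) {w : ℂ} (hw : K < w.re) :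
    IntegrableOn (fun t : ℝ => exp (-w * t) * (φ (I * t) * (t : ℂ) ^ (s - 1))) (Ioi T) := by
  have hT : 0 < T := hY.trans_lt hYT
  obtain ⟨C', h⟩ := norm_integrand_le hT hb s (ε := (w.re - K) / 2) (by linarith)
  refine Integrable.mono' ((integrableOn_exp_mul_Ioi (a := -(w.re - K) / 2) (by linarith) T).const_mul C') ?_ ?_
  · refine ContinuousOn.aestronglyMeasurable ?_ measurableSet_Ioi
    refine ContinuousOn.mul (by fun_prop) (ContinuousOn.mul ?_ ?_)
    · exact hd.continuousOn.comp (by fun_prop) fun t ht => by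
        simpa using hYT.trans ht
    · refine ContinuousOn.cpow (by fun_prop) continuousOn_const fun t ht => ?_
      exact ofReal_mem_slitPlane.2 (hT.trans ht)
  · refine (ae_restrict_iff' measurableSet_Ioi).2 (Eventually.of_forall fun t ht => ?_)
    have := h w 0 t le_rfl (le_of_lt ht)
    have e1 : -I * ((0 : ℝ) + (t : ℂ) * I) = t := by
      push_cast; linear_combination -(t : ℂ) * I_mul_I
    have e2 : I * ((0 : ℝ) + (t : ℂ) * I) = -t := by
      push_cast; linear_combination (t : ℂ) * I_mul_I
    rw [e1, e2, ofReal_zero, zero_add, mul_comm (t : ℂ) I, mul_neg, ← neg_mul] at this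
    refine this.trans (le_of_eq ?_)
    congr 2; ring

/-- In the quadrant `Im w > 0`, `Re w > K` the integrand decays in both directions, so the two paths
give the same integral; this makes the rotated integral the continuation required by the definition.
-/
theorem rotatedIntegral_eq (hY : 0 ≤ Y) (hYT : Y < T)
    (hd : DifferentiableOn ℂ φ {τ : ℂ | Y < τ.im})
    (hb : ∀ τ : ℂ, T ≤ τ.im → ‖φ τ‖ ≤ C * Real.exp (K * τ.im)) (s : ℂ) {w : ℂ} (hw : 0 < w.im)
    (hw' : K < w.re) :
    rotatedIntegral φ T s w = ∫ t in Ioi T, exp (-w * t) * (φ (I * t) * (t : ℂ) ^ (s - 1)) := by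
  have hT : 0 < T := hY.trans_lt hYT
  set κ : ℝ := min w.im (w.re - K) / 2 with hκ
  have hκ0 : 0 < κ := half_pos (lt_min hw (by linarith))
  have hκ1 : 2 * κ ≤ w.im := by rw [hκ]; linarith [min_le_left w.im (w.re - K)]
  have hκ2 : 2 * κ ≤ w.re - K := by rw [hκ]; linarith [min_le_right w.im (w.re - K)]
  obtain ⟨C', h⟩ := norm_integrand_le hT hb s hκ0
  have hC' : 0 ≤ C' := by
    have := (norm_nonneg _).trans (h w 0 T le_rfl le_rfl)
    exact nonneg_of_mul_nonneg_left this (Real.exp_pos _)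
  have := (integral_horizontal_eq_vertical (Φ := fun τ => exp (w * (I * τ)) * (φ τ * (-I * τ) ^ (s - 1)))
    (C := C') hYT hκ0 ?_ ?_).2.2
  · simp only [rotatedIntegral]
    rw [this, ← mul_assoc, neg_mul, I_mul_I, neg_neg, one_mul]
    refine setIntegral_congr_fun measurableSet_Ioi fun t ht => ?_
    have e1 : -I * ((t : ℂ) * I) = t := by linear_combination -(t : ℂ) * I_mul_I
    have e2 : w * (I * ((t : ℂ) * I)) = -w * t := by linear_combination w * (t : ℂ) * I_mul_I
    simp only [e1, e2]
    rw [mul_comm (t : ℂ) I]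
  · refine DifferentiableOn.mul (by fun_prop) (hd.mul ?_)
    refine DifferentiableOn.cpow_const (by fun_prop) fun τ hτ => ?_
    rw [mem_slitPlane_iff]; left
    simpa using hY.trans_lt hτ
  · intro x y hx hy
    refine (h w x y hx hy).trans ?_
    gcongr
    nlinarith [hT.trans_le hy]

theorem hasTailIntegral_of_tendsto_rotatedIntegral (hY : 0 ≤ Y) (hYT : Y < T)
    (hd : DifferentiableOn ℂ φ {τ : ℂ | Y < τ.im})
    (hb : ∀ τ : ℂ, T ≤ τ.im → ‖φ τ‖ ≤ C * Real.exp (K * τ.im)) {s v : ℂ}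
    (hv : Tendsto (rotatedIntegral φ T s) (𝓝[{w : ℂ | 0 < w.im}] 0) (𝓝 v)) :
    HasTailIntegral (fun t => φ (I * t) * (t : ℂ) ^ (s - 1)) T v := by
  classical
  -- The continuation must be holomorphic only for `Im w > 0` and agree with the integral for `Re w
  -- > K`, so the two formulas may be used on the two regions.
  refine ⟨K, fun w => if 0 < w.im then rotatedIntegral φ T s w else
    ∫ t in Ioi T, exp (-w * t) * (φ (I * t) * (t : ℂ) ^ (s - 1)), fun w hw =>
    ⟨integrableOn_direct hY hYT hd hb s hw, ?_⟩, ?_, ?_⟩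
  · dsimp only
    split_ifs with h
    · exact rotatedIntegral_eq hY hYT hd hb s h hw
    · rfl
  · exact (differentiableOn_rotatedIntegral hY hYT hd hb s).congr fun w hw => if_pos hw
  · refine hv.congr' ?_
    filter_upwards [self_mem_nhdsWithin] with w hw using (if_pos hw).symm

/-- If `φ` decays exponentially, then the regularized integral is an ordinary integral. -/
theorem hasTailIntegral_of_exp_decay (hY : 0 ≤ Y) (hYT : Y < T) (hK : K < 0)
    (hd : DifferentiableOn ℂ φ {τ : ℂ | Y < τ.im})
    (hb : ∀ τ : ℂ, T ≤ τ.im → ‖φ τ‖ ≤ C * Real.exp (K * τ.im)) (s : ℂ) :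
    HasTailIntegral (fun t => φ (I * t) * (t : ℂ) ^ (s - 1)) T
      (∫ t in Ioi T, φ (I * t) * (t : ℂ) ^ (s - 1)) := by
  refine hasTailIntegral_of_tendsto_rotatedIntegral hY hYT hd hb ?_
  have hcont : ContinuousOn (fun t : ℝ => φ (I * t) * (t : ℂ) ^ (s - 1)) (Ioi T) := by
    refine ContinuousOn.mul ?_ ?_
    · exact hd.continuousOn.comp (by fun_prop) fun t ht => by
        simpa using hYT.trans ht
    · refine ContinuousOn.cpow (by fun_prop) continuousOn_const fun t ht => ?_
      exact ofReal_mem_slitPlane.2 ((hY.trans_lt hYT).trans ht)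
  have h := (hasDerivAt_integral_exp_mul (μ := volume.restrict (Ioi T)) (U := {w : ℂ | K < w.re})
    (l := fun t : ℝ => -(t : ℂ)) (φ := fun t : ℝ => φ (I * t) * (t : ℂ) ^ (s - 1)) (by fun_prop)
    (hcont.aestronglyMeasurable measurableSet_Ioi) (isOpen_re_gt K)
    (fun w hw => by
      have := integrableOn_direct hY hYT hd hb s hw
      simpa only [IntegrableOn, neg_mul, mul_neg] using this)
    (w := 0) (by simpa using hK)).2.continuousAt.tendsto
  simp only [zero_mul, Complex.exp_zero, one_mul] at h
  refine (h.mono_left nhdsWithin_le_nhds).congr' ?_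
  filter_upwards [self_mem_nhdsWithin, mem_nhdsWithin_of_mem_nhds
    ((isOpen_re_gt K).mem_nhds (x := (0 : ℂ)) (by simpa using hK))] with w hw hw'
  rw [rotatedIntegral_eq hY hYT hd hb s hw hw']
  simp

/-- With `t^(s-1) = exp(s log t) t^(-1)` this is the parametric integral for `l = log t`. -/
theorem differentiable_integral_exp_decay (hY : 0 ≤ Y) (hYT : Y < T) (hK : K < 0)
    (hd : DifferentiableOn ℂ φ {τ : ℂ | Y < τ.im})
    (hb : ∀ τ : ℂ, T ≤ τ.im → ‖φ τ‖ ≤ C * Real.exp (K * τ.im)) :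
    Differentiable ℂ (fun s : ℂ => ∫ t in Ioi T, φ (I * t) * (t : ℂ) ^ (s - 1)) := by
  have hT : 0 < T := hY.trans_lt hYT
  have e : ∀ s : ℂ, ∀ t ∈ Ioi T, φ (I * t) * (t : ℂ) ^ (s - 1) =
      exp (s * Real.log t) * (φ (I * t) * (t : ℂ) ^ ((0 : ℂ) - 1)) := fun s t ht => by
    have ht0 : (t : ℂ) ≠ 0 := ofReal_ne_zero.2 (hT.trans ht).ne'
    rw [mul_left_comm, ofReal_log (hT.trans ht).le, mul_comm s, ← cpow_def_of_ne_zero ht0,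
      ← cpow_add _ _ ht0]
    congr 2; ring
  intro s
  have hc : ContinuousOn (fun t : ℝ => φ (I * t) * (t : ℂ) ^ ((0 : ℂ) - 1)) (Ioi T) := by
    refine ContinuousOn.mul ?_ ?_
    · exact hd.continuousOn.comp (by fun_prop) fun t ht => by
        simpa using hYT.trans ht
    · refine ContinuousOn.cpow (by fun_prop) continuousOn_const fun t ht => ?_
      exact ofReal_mem_slitPlane.2 (hT.trans ht)
  have := (hasDerivAt_integral_exp_mul (μ := volume.restrict (Ioi T)) (U := univ)
    (l := fun t : ℝ => ((Real.log t : ℝ) : ℂ)) (φ := fun t : ℝ => φ (I * t) * (t : ℂ) ^ ((0 : ℂ) - 1))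
    (Complex.measurable_ofReal.comp Real.measurable_log).aestronglyMeasurable
    (hc.aestronglyMeasurable measurableSet_Ioi) isOpen_univ (fun s _ => ?_)
    (w := s) (mem_univ s)).2.differentiableAt
  · refine this.congr_of_eventuallyEq (Eventually.of_forall fun z => ?_)
    exact setIntegral_congr_fun measurableSet_Ioi (e z)
  · have h0 := integrableOn_direct hY hYT hd hb s (w := 0) (by simpa using hK)
    refine h0.congr_fun (fun t ht => ?_) measurableSet_Ioi
    simpa using e s t ht

end rotated

/-! ### Tail integrals of `exp (λ t) t ^ (s - 1)` -/

section power

variable {T : ℝ}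

theorem hasDerivAt_rotated_cpow (hT : 0 < T) (s : ℂ) (x : ℝ) :
    HasDerivAt (fun x : ℝ => (-I * ((x : ℂ) + T * I)) ^ s)
      (-I * s * (-I * ((x : ℂ) + T * I)) ^ (s - 1)) x := by
  have h1 : HasDerivAt (fun x : ℝ => -I * ((x : ℂ) + T * I)) (-I * 1) x :=
    ((hasDerivAt_id x).ofReal_comp.add_const (T * I)).const_mul (-I)
  have h2 := (hasDerivAt_id (-I * ((x : ℂ) + T * I))).cpow_const (c := s) (rotated_slit hT)
  have := HasDerivAt.comp x h2 h1
  exact this.congr_deriv (by simp only [id]; ring)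

/-- Integration by parts on the rotated path. Read from right to left with `z ≠ 0`, it extends
statements known for small `Re s` one unit to the right. -/
theorem rotatedIntegral_one_add_one (hT : 0 < T) (s : ℂ) {z : ℂ} (hz : 0 < z.im) :
    z * rotatedIntegral (fun _ => 1) T (s + 1) z =
      exp (-z * T) * (T : ℂ) ^ s + s * rotatedIntegral (fun _ => 1) T s z := by
  have hY : T / 2 < T := by linarith
  have hint : ∀ s : ℂ, _ := fun s => integrableOn_rotated (φ := fun _ => (1 : ℂ)) (C := 1) (K := 0)
    (half_pos hT).le hY (differentiableOn_const _) (by simp) s hz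
  have i1 := hint (s + 1)
  have i2 := hint s
  simp only [add_sub_cancel_right, one_mul] at i1 i2
  have hder : ∀ x : ℝ, HasDerivAt
      (fun x : ℝ => exp (z * (I * ((x : ℂ) + T * I))) * (-I * ((x : ℂ) + T * I)) ^ s)
      (z * I * (exp (z * (I * ((x : ℂ) + T * I))) * (-I * ((x : ℂ) + T * I)) ^ s) -
        I * s * (exp (z * (I * ((x : ℂ) + T * I))) * (-I * ((x : ℂ) + T * I)) ^ (s - 1))) x := by
    intro x
    have h1 : HasDerivAt (fun x : ℝ => z * (I * ((x : ℂ) + T * I))) (z * (I * 1)) x :=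
      (((hasDerivAt_id x).ofReal_comp.add_const (T * I)).const_mul I).const_mul z
    exact (h1.cexp.mul (hasDerivAt_rotated_cpow hT s x)).congr_deriv (by ring)
  have i3 := (i1.const_mul (z * I)).sub (i2.const_mul (I * s))
  have ht := tendsto_zero_of_hasDerivAt_of_integrableOn_Ioi (a := 0) (fun x _ => hder x) i3 i1
  have := integral_Ioi_of_hasDerivAt_of_tendsto' (a := 0) (fun x _ => hder x) i3 ht
  rw [integral_sub (i1.const_mul (z * I)) (i2.const_mul (I * s)), integral_const_mul,
    integral_const_mul] at this
  have e : -I * (((0 : ℝ) : ℂ) + T * I) = T := by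
    push_cast; linear_combination -(T : ℂ) * I_mul_I
  have e' : z * (I * (((0 : ℝ) : ℂ) + T * I)) = -z * T := by
    push_cast; linear_combination z * (T : ℂ) * I_mul_I
  rw [e, e'] at this
  simp only [rotatedIntegral, add_sub_cancel_right, one_mul]
  linear_combination -this

theorem norm_rotated_cpow_le (hT : 0 < T) {s : ℂ} (hs : s.re < 0) {x : ℝ} (hx : 0 ≤ x) :
    ‖(-I * ((x : ℂ) + T * I)) ^ (s - 1)‖ ≤
      Real.exp (Real.pi * |s.im|) * 2 ^ (1 - s.re) * (x + T) ^ (s.re - 1) := by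
  have h0 := slitPlane_ne_zero (rotated_slit (x := x) hT)
  have hn : ‖-I * ((x : ℂ) + T * I)‖ = ‖(x : ℂ) + T * I‖ := by simp
  have hge : (x + T) / 2 ≤ ‖(x : ℂ) + T * I‖ := by
    have h1 := abs_im_le_norm ((x : ℂ) + T * I)
    have h2 := abs_re_le_norm ((x : ℂ) + T * I)
    simp only [add_re, ofReal_re, mul_re, I_re, mul_zero, ofReal_im, I_im, mul_one, sub_self,
      add_zero, add_im, mul_im, zero_add, abs_of_pos hT, abs_of_nonneg hx] at h1 h2
    linarith
  refine (norm_cpow_le_rpow_mul_exp h0 _).trans ?_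
  rw [hn]
  simp only [sub_re, one_re, sub_im, one_im, sub_zero]
  have h1 : ‖(x : ℂ) + T * I‖ ^ (s.re - 1) ≤ ((x + T) / 2) ^ (s.re - 1) :=
    Real.rpow_le_rpow_of_nonpos (by positivity) hge (by linarith)
  have h2 : ((x + T) / 2) ^ (s.re - 1) = 2 ^ (1 - s.re) * (x + T) ^ (s.re - 1) := by
    rw [Real.div_rpow (by positivity) (by positivity), div_eq_inv_mul,
      ← Real.rpow_neg (by positivity)]
    congr 2; ring
  rw [h2] at h1
  calc _ ≤ (2 ^ (1 - s.re) * (x + T) ^ (s.re - 1)) * Real.exp (Real.pi * |s.im|) := by gcongr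
    _ = _ := by ring

theorem integrableOn_rpow_bound (hT : 0 < T) {s : ℂ} (hs : s.re < 0) (c : ℝ) :
    IntegrableOn (fun x : ℝ => c * (x + T) ^ (s.re - 1)) (Ioi 0) :=
  (integrableOn_add_rpow_Ioi_of_lt (by linarith) (by linarith)).const_mul c

theorem continuous_rotated_cpow (hT : 0 < T) (s : ℂ) :
    Continuous (fun x : ℝ => (-I * ((x : ℂ) + T * I)) ^ s) :=
  Continuous.cpow (by fun_prop) continuous_const fun _ => rotated_slit hT

theorem integrableOn_rotated_cpow (hT : 0 < T) {s z : ℂ} (hs : s.re < 0) (hz : 0 ≤ z.im) :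
    IntegrableOn (fun x : ℝ => exp (z * (I * ((x : ℂ) + T * I))) *
      (-I * ((x : ℂ) + T * I)) ^ (s - 1)) (Ioi 0) := by
  refine Integrable.mono' (integrableOn_rpow_bound hT hs
    (Real.exp (-z.re * T) * (Real.exp (Real.pi * |s.im|) * 2 ^ (1 - s.re)))) ?_ ?_
  · exact ((by fun_prop : Continuous fun x : ℝ => exp (z * (I * ((x : ℂ) + T * I)))).mul
      (continuous_rotated_cpow hT _)).aestronglyMeasurable
  · refine (ae_restrict_iff' measurableSet_Ioi).2 (Eventually.of_forall fun x hx => ?_)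
    have h := norm_rotated_cpow_le hT hs (le_of_lt (mem_Ioi.1 hx))
    have h2 : ‖exp (z * (I * ((x : ℂ) + T * I)))‖ ≤ Real.exp (-z.re * T) := by
      rw [norm_exp, Real.exp_le_exp]
      have : (z * (I * ((x : ℂ) + T * I))).re = -z.im * x - z.re * T := by simp; ring
      rw [this]
      nlinarith [mem_Ioi.1 hx]
    rw [norm_mul, mul_assoc]
    gcongr

theorem rotatedIntegral_one_zero (hT : 0 < T) {s : ℂ} (hs : s.re < 0) :
    rotatedIntegral (fun _ => 1) T s 0 = -(T : ℂ) ^ s / s := by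
  have hs0 : s ≠ 0 := by rintro rfl; simp at hs
  have i := integrableOn_rotated_cpow hT hs (z := 0) le_rfl
  simp only [zero_mul, Complex.exp_zero, one_mul] at i
  have ht : Tendsto (fun x : ℝ => (-I * ((x : ℂ) + T * I)) ^ s) atTop (𝓝 0) := by
    have h1 : Tendsto (fun x : ℝ => x ^ s.re * Real.exp (Real.pi * |s.im|)) atTop (𝓝 0) := by
      have := (tendsto_rpow_neg_atTop (y := -s.re) (by linarith)).mul_const
        (Real.exp (Real.pi * |s.im|))
      simpa using this
    refine squeeze_zero_norm' ?_ h1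
    filter_upwards [eventually_gt_atTop 0] with x hx
    refine (norm_cpow_le_rpow_mul_exp (slitPlane_ne_zero (rotated_slit hT)) _).trans ?_
    gcongr ?_ * _
    refine Real.rpow_le_rpow_of_nonpos hx ?_ hs.le
    have h2 := abs_re_le_norm ((x : ℂ) + T * I)
    have hn : ‖-I * ((x : ℂ) + T * I)‖ = ‖(x : ℂ) + T * I‖ := by simp
    rw [hn]
    simp only [add_re, ofReal_re, mul_re, I_re, mul_zero, ofReal_im, I_im, mul_one, sub_self,
      add_zero] at h2
    exact (le_abs_self x).trans h2
  have := integral_Ioi_of_hasDerivAt_of_tendsto' (a := 0)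
    (fun x _ => hasDerivAt_rotated_cpow hT s x) (i.const_mul (-I * s)) ht
  have e : -I * (((0 : ℝ) : ℂ) + T * I) = T := by
    push_cast; linear_combination -(T : ℂ) * I_mul_I
  rw [integral_const_mul, e] at this
  simp only [rotatedIntegral, zero_mul, Complex.exp_zero, one_mul]
  rw [eq_div_iff hs0]
  linear_combination this

/-- For `Re s < 0` the power alone is integrable on the rotated path, so dominated convergence
reaches the real boundary. -/
theorem tendsto_rotatedIntegral_one (hT : 0 < T) {s : ℂ} (hs : s.re < 0) (y : ℝ) :
    Tendsto (rotatedIntegral (fun _ => 1) T s) (𝓝[{w : ℂ | 0 < w.im}] y)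
      (𝓝 (rotatedIntegral (fun _ => 1) T s y)) := by
  unfold rotatedIntegral
  refine Tendsto.const_mul _ ?_
  simp only [one_mul]
  refine tendsto_integral_filter_of_dominated_convergence
    (fun x => Real.exp ((|y| + 1) * T) * (Real.exp (Real.pi * |s.im|) * 2 ^ (1 - s.re)) * (x + T) ^ (s.re - 1)) ?_ ?_
    (integrableOn_rpow_bound hT hs _) ?_
  · exact Eventually.of_forall fun z =>
      ((by fun_prop : Continuous fun x : ℝ => exp (z * (I * ((x : ℂ) + T * I)))).mul
      (continuous_rotated_cpow hT _)).aestronglyMeasurable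
  · have : {w : ℂ | -(|y| + 1) < w.re} ∈ 𝓝 (y : ℂ) := (isOpen_re_gt _).mem_nhds (by
      simp only [mem_ofPred_eq, ofReal_re]; linarith [neg_abs_le y])
    filter_upwards [self_mem_nhdsWithin, mem_nhdsWithin_of_mem_nhds this] with z hz hz'
    refine (ae_restrict_iff' measurableSet_Ioi).2 (Eventually.of_forall fun x hx => ?_)
    have h := norm_rotated_cpow_le hT hs (le_of_lt (mem_Ioi.1 hx))
    have h2 : ‖exp (z * (I * ((x : ℂ) + T * I)))‖ ≤ Real.exp ((|y| + 1) * T) := by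
      rw [norm_exp, Real.exp_le_exp]
      have : (z * (I * ((x : ℂ) + T * I))).re = -z.im * x - z.re * T := by simp; ring
      rw [this]
      have : 0 < z.im * x := mul_pos hz hx
      have : -(|y| + 1) < z.re := hz'
      nlinarith
    rw [norm_mul, mul_assoc]
    gcongr
  · refine Eventually.of_forall fun x => ?_
    have : Continuous fun z : ℂ => exp (z * (I * ((x : ℂ) + T * I))) *
      (-I * ((x : ℂ) + T * I)) ^ (s - 1) := by fun_prop
    exact this.continuousAt.tendsto.mono_left nhdsWithin_le_nhds

theorem differentiableOn_rotatedIntegral_one (hT : 0 < T) {z : ℂ} (hz : 0 ≤ z.im) :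
    DifferentiableOn ℂ (fun s => rotatedIntegral (fun _ => 1) T s z) {s | s.re < 0} := by
  intro s hs
  have e : ∀ (s : ℂ) (x : ℝ), exp (z * (I * ((x : ℂ) + T * I))) * (-I * ((x : ℂ) + T * I)) ^ (s - 1) =
      exp (s * log (-I * ((x : ℂ) + T * I))) *
        (exp (z * (I * ((x : ℂ) + T * I))) * (-I * ((x : ℂ) + T * I)) ^ ((0 : ℂ) - 1)) := by
    intro s x
    have h0 := slitPlane_ne_zero (rotated_slit (x := x) hT)
    have h1 : exp (s * log (-I * ((x : ℂ) + T * I))) = (-I * ((x : ℂ) + T * I)) ^ s := by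
      rw [cpow_def_of_ne_zero h0, mul_comm]
    have h2 : (-I * ((x : ℂ) + T * I)) ^ (s - 1) =
        (-I * ((x : ℂ) + T * I)) ^ s * (-I * ((x : ℂ) + T * I)) ^ ((0 : ℂ) - 1) := by
      rw [← cpow_add _ _ h0]; congr 1; ring
    rw [h1, h2]; ring
  have := (hasDerivAt_integral_exp_mul (μ := volume.restrict (Ioi 0))
    (l := fun x : ℝ => log (-I * ((x : ℂ) + T * I)))
    (φ := fun x : ℝ => exp (z * (I * ((x : ℂ) + T * I))) * (-I * ((x : ℂ) + T * I)) ^ ((0 : ℂ) - 1))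
    (Continuous.clog (by fun_prop) fun _ => rotated_slit hT).aestronglyMeasurable
    ((by fun_prop : Continuous fun x : ℝ => exp (z * (I * ((x : ℂ) + T * I)))).mul
      (continuous_rotated_cpow hT _)).aestronglyMeasurable (isOpen_re_lt 0)
    (fun s hs => by simpa only [IntegrableOn, e s] using integrableOn_rotated_cpow hT hs hz) hs).2
  have h2 := (this.const_mul (-I)).differentiableAt
  refine (h2.congr_of_eventuallyEq (Eventually.of_forall fun z' => ?_)).differentiableWithinAt
  simp only [rotatedIntegral, one_mul]
  congr 1
  exact integral_congr_ae (Eventually.of_forall fun x => e z' x)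

/-- The boundary values of the rotated integral at nonzero real points are entire in `s`. -/
theorem exists_tendsto_rotatedIntegral_one (hT : 0 < T) {y : ℝ} (hy : y ≠ 0) :
    ∃ E : ℂ → ℂ, Differentiable ℂ E ∧ ∀ s, Tendsto (rotatedIntegral (fun _ => 1) T s)
      (𝓝[{w : ℂ | 0 < w.im}] y) (𝓝 (E s)) := by
  have hT0 : (T : ℂ) ≠ 0 := ofReal_ne_zero.2 hT.ne'
  -- Each use of the recursion extends the half-plane by one; dividing by `z` in the limit is
  -- allowed because `y ≠ 0`.
  have key : ∀ m : ℕ, ∃ J : ℂ → ℂ, DifferentiableOn ℂ J {s | s.re < m} ∧ ∀ s : ℂ, s.re < m →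
      Tendsto (rotatedIntegral (fun _ => 1) T s) (𝓝[{w : ℂ | 0 < w.im}] y) (𝓝 (J s)) := by
    intro m
    induction m with
    | zero =>
      refine ⟨fun s => rotatedIntegral (fun _ => 1) T s y, ?_, fun s hs => ?_⟩
      · simpa using differentiableOn_rotatedIntegral_one hT (z := (y : ℂ)) (by simp)
      · exact tendsto_rotatedIntegral_one hT (by simpa using hs) y
    | succ m ih =>
      obtain ⟨J, hJ, hJt⟩ := ih
      have hm : ∀ s : ℂ, s.re < (m + 1 : ℕ) → (s - 1).re < m := fun s hs => by
        push_cast at hs; simp only [sub_re, one_re]; linarith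
      refine ⟨fun s => (exp (-y * T) * (T : ℂ) ^ (s - 1) + (s - 1) * J (s - 1)) / y, ?_, fun s hs => ?_⟩
      · refine DifferentiableOn.div_const ?_ _
        refine DifferentiableOn.add ?_ ?_
        · refine DifferentiableOn.const_mul ?_ _
          exact (Differentiable.const_cpow (by fun_prop) (Or.inl hT0)).differentiableOn
        · exact DifferentiableOn.mul (by fun_prop) (hJ.comp (by fun_prop) fun s hs => hm s hs)
      · have hid : Tendsto (fun z : ℂ => z) (𝓝[{w : ℂ | 0 < w.im}] y) (𝓝 (y : ℂ)) :=
          tendsto_id.mono_left nhdsWithin_le_nhds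
        have h1 : Tendsto (fun z : ℂ => exp (-z * T) * (T : ℂ) ^ (s - 1))
            (𝓝[{w : ℂ | 0 < w.im}] y) (𝓝 (exp (-y * T) * (T : ℂ) ^ (s - 1))) := by
          have : Continuous fun z : ℂ => exp (-z * T) * (T : ℂ) ^ (s - 1) := by fun_prop
          exact this.continuousAt.tendsto.mono_left nhdsWithin_le_nhds
        have := (h1.add ((hJt (s - 1) (hm s hs)).const_mul (s - 1))).div hid (ofReal_ne_zero.2 hy)
        refine this.congr' ?_
        filter_upwards [self_mem_nhdsWithin] with z hz
        have hz' : 0 < z.im := hz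
        have hz0 : z ≠ 0 := by rintro rfl; simp at hz'
        have := rotatedIntegral_one_add_one hT (s - 1) hz'
        rw [sub_add_cancel] at this
        change _ / z = _
        rw [div_eq_iff hz0]
        linear_combination -this
  choose J hJ hJt using key
  have hlt : ∀ s : ℂ, s.re < (⌊s.re⌋₊ + 1 : ℕ) := fun s => by
    push_cast; exact Nat.lt_floor_add_one _
  -- The functions on the growing half-planes agree where both are defined, being limits of the same
  -- function.
  refine ⟨fun s => J (⌊s.re⌋₊ + 1) s, fun s => ?_, fun s => hJt _ s (hlt s)⟩
  have hmem : {z : ℂ | z.re < (⌊s.re⌋₊ + 1 : ℕ)} ∈ 𝓝 s := (isOpen_re_lt _).mem_nhds (hlt s)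
  refine ((hJ (⌊s.re⌋₊ + 1)).differentiableAt hmem).congr_of_eventuallyEq ?_
  filter_upwards [hmem] with z hz
  exact tendsto_nhds_unique (hJt _ z (hlt z)) (hJt _ z hz)

theorem hasTailIntegral_cpow (hT : 0 < T) {s : ℂ} (hs : s.re < 0) :
    HasTailIntegral (fun t => (t : ℂ) ^ (s - 1)) T (-(T : ℂ) ^ s / s) := by
  have := hasTailIntegral_of_tendsto_rotatedIntegral (φ := fun _ => (1 : ℂ)) (C := 1) (K := 0)
    (half_pos hT).le (half_lt_self hT) (differentiableOn_const _) (by simp) (s := s)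
    (v := -(T : ℂ) ^ s / s) (by
      have := tendsto_rotatedIntegral_one hT hs 0
      rwa [ofReal_zero, rotatedIntegral_one_zero hT hs] at this)
  exact this.congr fun t _ => by simp

/-- The factor `exp(y t)` translates `w` to `w - y`, so the value at `w = 0` is the boundary value
of the pure power integral at the nonzero real point `-y`, approached from above. -/
theorem exists_hasTailIntegral_exp_mul_cpow (hT : 0 < T) {y : ℝ} (hy : y ≠ 0) :
    ∃ E : ℂ → ℂ, Differentiable ℂ E ∧
      ∀ s, HasTailIntegral (fun t => exp (y * t) * (t : ℂ) ^ (s - 1)) T (E s) := by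
  obtain ⟨E, hE, hEt⟩ := exists_tendsto_rotatedIntegral_one hT (neg_ne_zero.2 hy)
  refine ⟨E, hE, fun s => ?_⟩
  have := hasTailIntegral_of_tendsto_rotatedIntegral (φ := fun τ => exp (-(y : ℂ) * (I * τ))) (C := 1) (K := y)
    (half_pos hT).le (half_lt_self hT) (by fun_prop) (fun τ _ => by simp [norm_exp]) (s := s)
    (v := E s) ?_
  · refine this.congr fun t _ => ?_
    congr 2
    linear_combination -(y : ℂ) * t * I_mul_I
  · have h1 : Tendsto (fun w : ℂ => w - y) (𝓝[{w : ℂ | 0 < w.im}] 0)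
        (𝓝[{w : ℂ | 0 < w.im}] ((-y : ℝ) : ℂ)) := by
      refine tendsto_nhdsWithin_of_tendsto_nhds_of_eventually_within _ ?_ ?_
      · have : Continuous fun w : ℂ => w - y := by fun_prop
        have := this.continuousAt (x := 0) |>.tendsto
        simp only [zero_sub] at this
        rw [ofReal_neg]
        exact this.mono_left nhdsWithin_le_nhds
      · filter_upwards [self_mem_nhdsWithin] with w hw
        simpa using hw
    refine ((hEt s).comp h1).congr fun w => ?_
    simp only [Function.comp, rotatedIntegral, one_mul]
    congr 1
    refine integral_congr_ae (Eventually.of_forall fun x => ?_)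
    have h2 : exp ((w - y) * (I * ((x : ℂ) + T * I))) =
        exp (w * (I * ((x : ℂ) + T * I))) * exp (-(y : ℂ) * (I * ((x : ℂ) + T * I))) := by
      rw [← Complex.exp_add]; congr 1; ring
    simp only [h2]; ring

end power

/-! ### Fourier expansions and tail integrals -/

theorem norm_exp_two_pi_I_mul (τ : ℂ) :
    ‖exp (2 * Real.pi * I * τ)‖ = Real.exp (-(2 * Real.pi) * τ.im) := by
  rw [norm_exp]; congr 1; simp

/-- The principal part of the `q`-expansion is split off; the remainder decays exponentially. -/
theorem HasFourierExpansion.exists_remainder {f : ℂ → ℂ} {a : ℤ → ℂ} (h : HasFourierExpansion f a) :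
    ∃ (N : ℕ) (Y : ℝ) (ρ : ℂ → ℂ), 0 < Y ∧ DifferentiableOn ℂ ρ {τ : ℂ | Y < τ.im} ∧
      (∀ T, Y < T → ∃ C : ℝ, ∀ τ : ℂ, T ≤ τ.im → ‖ρ τ‖ ≤ C * Real.exp (-(2 * Real.pi) * τ.im)) ∧
      ∀ τ : ℂ, Y < τ.im → f τ = (∑ m ∈ Finset.range N,
        a (-((m : ℤ) + 1)) * exp (2 * Real.pi * I * τ) ^ (-((m : ℤ) + 1))) + a 0 + ρ τ := by
  obtain ⟨⟨N, hN⟩, Y, hY, hsum⟩ := h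
  -- Absolute convergence at `τ = iT` is a Weierstrass majorant for `Im τ ≥ T`.
  have hnat : ∀ T, Y < T → Summable (fun n : ℕ => ‖a (n + 1)‖ * Real.exp (-(2 * Real.pi) * T) ^ (n + 1)) := by
    intro T hT
    have h1 := (hsum (T * I) (by simpa using hT)).summable.norm
    have h2 := h1.comp_injective (i := fun n : ℕ => (n : ℤ) + 1) (fun a b hab => by simpa using hab)
    refine h2.congr fun n => ?_
    have : ((n : ℤ) + 1) = ((n + 1 : ℕ) : ℤ) := by simp
    simp only [Function.comp, norm_mul]
    rw [this, zpow_natCast, norm_pow, norm_exp_two_pi_I_mul]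
    simp
  have hle : ∀ T (τ : ℂ), T ≤ τ.im → ‖exp (2 * Real.pi * I * τ)‖ ≤ Real.exp (-(2 * Real.pi) * T) := by
    intro T τ hτ
    rw [norm_exp_two_pi_I_mul, Real.exp_le_exp]
    nlinarith [Real.pi_pos]
  refine ⟨N, Y, fun τ => ∑' n : ℕ, a (n + 1) * exp (2 * Real.pi * I * τ) ^ (n + 1), hY, ?_, ?_, ?_⟩
  · intro τ hτ
    obtain ⟨T, hYT, hTτ⟩ := exists_between (show Y < τ.im from hτ)
    have := Complex.differentiableOn_tsum_of_summable_norm (hnat T hYT)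
      (F := fun (n : ℕ) (τ : ℂ) => a (n + 1) * exp (2 * Real.pi * I * τ) ^ (n + 1))
      (U := {τ : ℂ | T < τ.im}) (fun n => by fun_prop) (isOpen_im_gt T) (fun n τ hτ => by
        rw [norm_mul, norm_pow]
        gcongr
        exact hle T τ (le_of_lt hτ))
    exact (this.differentiableAt ((isOpen_im_gt T).mem_nhds hTτ)).differentiableWithinAt
  · intro T hT
    -- One factor `q` is kept for the decay; the others are bounded by their size at height `T`.
    refine ⟨∑' n : ℕ, ‖a (n + 1)‖ * Real.exp (-(2 * Real.pi) * T) ^ n, fun τ hτ => ?_⟩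
    have hs0 : Summable (fun n : ℕ => ‖a (n + 1)‖ * Real.exp (-(2 * Real.pi) * T) ^ n) := by
      refine ((hnat T hT).mul_right (Real.exp (-(2 * Real.pi) * T))⁻¹).congr fun n => ?_
      have := (Real.exp_pos (-(2 * Real.pi) * T)).ne'
      rw [pow_succ]; field_simp
    rw [← tsum_mul_right]
    refine tsum_of_norm_bounded (hs0.mul_right _).hasSum fun n => ?_
    rw [norm_mul, norm_pow, pow_succ, norm_exp_two_pi_I_mul, mul_assoc]
    have := hle T τ hτ
    rw [norm_exp_two_pi_I_mul] at this
    gcongr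
  · intro τ hτ
    have h1 := hsum τ hτ
    obtain ⟨u, hu⟩ : ∃ u : ℤ → ℂ, u = fun n : ℤ => a n * exp (2 * Real.pi * I * τ) ^ n := ⟨_, rfl⟩
    rw [← hu] at h1
    have hs := h1.summable
    have hp : Summable (fun n : ℕ => u n) := hs.comp_injective Nat.cast_injective
    have hm : Summable (fun n : ℕ => u (-((n : ℤ) + 1))) :=
      hs.comp_injective (i := fun n : ℕ => (-((n : ℤ) + 1))) (fun a b hab => by
        have : -((a : ℤ) + 1) = -((b : ℤ) + 1) := hab
        omega)
    have hfin : ∑' n : ℕ, u (-((n : ℤ) + 1)) = ∑ n ∈ Finset.range N, u (-((n : ℤ) + 1)) :=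
      tsum_eq_sum fun n hn => by
        rw [hu]; dsimp only
        rw [hN _ (by simp at hn; omega), zero_mul]
    have hpos : ∀ n : ℕ, u ((n + 1 : ℕ) : ℤ) = a (n + 1) * exp (2 * Real.pi * I * τ) ^ (n + 1) :=
      fun n => by
        rw [hu]; dsimp only
        rw [zpow_natCast]; push_cast; rfl
    rw [← h1.tsum_eq, tsum_of_nat_of_neg_add_one hp hm, hp.tsum_eq_zero_add, hfin]
    simp only [hpos]
    simp only [hu, Nat.cast_zero, zpow_zero, mul_one]
    ring

/-- Up to its constant term, a function with a Fourier expansion has regularized tail integrals for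
all `s`, which are entire in `s`. -/
theorem HasFourierExpansion.exists_tail {f : ℂ → ℂ} {a : ℤ → ℂ} (h : HasFourierExpansion f a) :
    ∃ Y : ℝ, 0 < Y ∧ DifferentiableOn ℂ f {τ : ℂ | Y < τ.im} ∧ ∀ T, Y < T →
      ∃ E : ℂ → ℂ, Differentiable ℂ E ∧ ∀ s,
        HasTailIntegral (fun t => mellinIntegrand f s t - a 0 * (t : ℂ) ^ (s - 1)) T (E s) := by
  obtain ⟨N, Y, ρ, hY, hd, hb, hf⟩ := h.exists_remainder
  refine ⟨Y, hY, ?_, fun T hT => ?_⟩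
  · refine DifferentiableOn.congr ?_ hf
    refine (DifferentiableOn.add_const _ ?_).add hd
    refine DifferentiableOn.fun_sum fun m _ => DifferentiableOn.const_mul ?_ _
    refine DifferentiableOn.zpow (by fun_prop) (Or.inl fun τ _ => exp_ne_zero _)
  · obtain ⟨C, hC⟩ := hb T hT
    have hT0 : 0 < T := hY.trans hT
    have hneg : -(2 * Real.pi) < 0 := by linarith [Real.pi_pos]
    have hpos : ∀ m : ℕ, 2 * Real.pi * ((m : ℝ) + 1) ≠ 0 := fun m => by
      have := Real.pi_pos; positivity
    -- On the imaginary axis `q^(-(m+1))` is `exp(2π(m+1)t)`, with nonzero rate, so its tails are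
    -- entire in `s`.
    choose E hE hEt using fun m : ℕ => exists_hasTailIntegral_exp_mul_cpow hT0 (hpos m)
    refine ⟨fun s => (∑ m ∈ Finset.range N, a (-((m : ℤ) + 1)) * E m s) +
      ∫ t in Ioi T, ρ (I * t) * (t : ℂ) ^ (s - 1), ?_, fun s => ?_⟩
    · refine Differentiable.add ?_ (differentiable_integral_exp_decay hY.le hT hneg hd hC)
      exact Differentiable.fun_sum fun m _ => (hE m).const_mul _
    · refine ((HasTailIntegral.sum fun m _ => (hEt m s).const_mul _).add
        (hasTailIntegral_of_exp_decay hY.le hT hneg hd hC s)).congr fun t ht => ?_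
      rw [mellinIntegrand, hf (I * t) (by simpa using hT.trans ht)]
      have : ∀ m : ℕ, exp (2 * Real.pi * I * (I * t)) ^ (-((m : ℤ) + 1)) =
          exp ((2 * Real.pi * ((m : ℝ) + 1) : ℝ) * t) := fun m => by
        rw [← exp_int_mul]
        congr 1
        push_cast
        linear_combination -(2 * (Real.pi : ℂ) * t * (m + 1)) * I_mul_I
      simp only [this]
      simp only [← mul_assoc, ← Finset.sum_mul]
      ring

/-! ### Nonexistence of tail integrals -/

theorem integrableOn_exp_neg_mul_rpow {a c : ℝ} (ha : -1 < a) (hc : 0 < c) :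
    IntegrableOn (fun x : ℝ => Real.exp (-c * x) * x ^ a) (Ioi 0) := by
  have := integrableOn_rpow_mul_exp_neg_mul_rpow (p := 1) ha one_pos hc
  simpa [mul_comm] using this

theorem integrableOn_exp_neg_mul_cpow {w β : ℂ} (hw : 0 < w.re) (hβ : -1 < β.re) :
    IntegrableOn (fun x : ℝ => exp (w * -(x : ℂ)) * (x : ℂ) ^ β) (Ioi 0) := by
  refine Integrable.mono' (integrableOn_exp_neg_mul_rpow hβ hw) ?_ ?_
  · refine ContinuousOn.aestronglyMeasurable ?_ measurableSet_Ioi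
    exact ContinuousOn.mul (by fun_prop)
      (ContinuousOn.cpow (by fun_prop) continuousOn_const fun t ht => ofReal_mem_slitPlane.2 ht)
  · refine (ae_restrict_iff' measurableSet_Ioi).2 (Eventually.of_forall fun x hx => ?_)
    rw [norm_mul, norm_exp, norm_cpow_eq_rpow_re_of_pos hx]
    simp

/-- If `q` has a nonzero limit at infinity and `0 ≤ Re β`, then `t ^ (β - 1) q(t)` has no
regularized tail integral. -/
theorem HasTailIntegral.limit_eq_zero {q : ℝ → ℂ} {T C : ℝ} {β v b : ℂ} (hT : 0 < T)
    (hβ : 0 ≤ β.re) (hq : ContinuousOn q (Ioi T)) (hC : ∀ t, T < t → ‖q t‖ ≤ C)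
    (hb : Tendsto q atTop (𝓝 b)) (h : HasTailIntegral (fun t => (t : ℂ) ^ (β - 1) * q t) T v) :
    b = 0 := by
  obtain ⟨R, G, hG, hGd, hGt⟩ := h
  have hC0 : 0 ≤ C := (norm_nonneg _).trans (hC (T + 1) (by linarith))
  set g : ℝ → ℂ := fun t => (t : ℂ) ^ (β - 1) * q t with hg
  have hcpow : ∀ z : ℂ, ContinuousOn (fun t : ℝ => (t : ℂ) ^ z) (Ioi 0) := fun z =>
    ContinuousOn.cpow (by fun_prop) continuousOn_const fun t ht => ofReal_mem_slitPlane.2 ht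
  have hsub : Ioi T ⊆ Ioi (0 : ℝ) := fun t ht => hT.trans ht
  have hgm : AEStronglyMeasurable g (volume.restrict (Ioi T)) :=
    (((hcpow (β - 1)).mono hsub).mul hq).aestronglyMeasurable measurableSet_Ioi
  have hint : ∀ w ∈ {w : ℂ | 0 < w.re}, IntegrableOn (fun t : ℝ => exp (w * -(t : ℂ)) * g t) (Ioi T) := by
    intro w hw
    obtain ⟨C', hC', hle⟩ := rpow_le_const_mul_exp (β.re - 1) hT (half_pos hw)
    refine Integrable.mono' ((integrableOn_exp_mul_Ioi (a := -w.re / 2)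
      (by have : 0 < w.re := hw; linarith) T).const_mul (C' * C)) ?_ ?_
    · exact ((by fun_prop : Continuous fun t : ℝ => exp (w * -(t : ℂ))).aestronglyMeasurable).mul hgm
    · refine (ae_restrict_iff' measurableSet_Ioi).2 (Eventually.of_forall fun t ht => ?_)
      have ht0 : 0 < t := hT.trans ht
      have h1 : ‖exp (w * -(t : ℂ))‖ = Real.exp (-w.re * t) := by rw [norm_exp]; simp
      rw [hg, norm_mul, norm_mul, h1, norm_cpow_eq_rpow_re_of_pos ht0, sub_re, one_re]
      calc _ ≤ Real.exp (-w.re * t) * ((C' * Real.exp (w.re / 2 * t)) * C) := by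
            gcongr
            · exact hle t (le_of_lt ht)
            · exact hC t ht
        _ = C' * C * (Real.exp (-w.re * t) * Real.exp (w.re / 2 * t)) := by ring
        _ = _ := by rw [← Real.exp_add]; ring_nf
  have hL := fun w (hw : w ∈ {w : ℂ | 0 < w.re}) => (hasDerivAt_integral_exp_mul
    (μ := volume.restrict (Ioi T)) (l := fun t : ℝ => -(t : ℂ)) (φ := g) (by fun_prop) hgm
    (isOpen_re_gt 0) hint hw).2
  -- The boundedness of `q` makes the Laplace integral converge for all `Re w > 0`; by the identity
  -- theorem it equals `G` on the first quadrant.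
  have hder : ∀ w : ℂ, 0 < w.re → 0 < w.im →
      deriv G w = ∫ t in Ioi T, -(t : ℂ) * exp (w * -(t : ℂ)) * g t := by
    have hopen : IsOpen ({w : ℂ | 0 < w.re} ∩ {w : ℂ | 0 < w.im}) :=
      (isOpen_re_gt 0).inter (isOpen_im_gt 0)
    have heq : EqOn G (fun w => ∫ t in Ioi T, exp (w * -(t : ℂ)) * g t)
        ({w : ℂ | 0 < w.re} ∩ {w : ℂ | 0 < w.im}) := by
      have hd2 : DifferentiableOn ℂ (fun w => ∫ t in Ioi T, exp (w * -(t : ℂ)) * g t)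
        ({w : ℂ | 0 < w.re} ∩ {w : ℂ | 0 < w.im}) := fun w hw =>
          (hL w hw.1).differentiableAt.differentiableWithinAt
      refine ((hGd.mono inter_subset_right).analyticOnNhd hopen).eqOn_of_preconnected_of_eventuallyEq
        (hd2.analyticOnNhd hopen)
        (((convex_halfSpace_re_gt 0).inter (convex_halfSpace_im_gt 0)).isPreconnected)
        (z₀ := ((|R| + 1 : ℝ) : ℂ) + I) ⟨by
          simp only [mem_ofPred_eq, add_re, ofReal_re, I_re]; positivity, by simp⟩ ?_
      have : {w : ℂ | R < w.re} ∈ 𝓝 (((|R| + 1 : ℝ) : ℂ) + I) :=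
        (isOpen_re_gt _).mem_nhds (by
          simp only [mem_ofPred_eq, add_re, ofReal_re, I_re]; linarith [le_abs_self R])
      filter_upwards [this] with w hw
      rw [(hG w hw).2]
      simp only [hg, mul_neg, neg_mul]
    intro w hw hw'
    have : G =ᶠ[𝓝 w] fun w => ∫ t in Ioi T, exp (w * -(t : ℂ)) * g t :=
      heq.eventuallyEq_of_mem (hopen.mem_nhds ⟨hw, hw'⟩)
    rw [this.deriv_eq, (hL w hw).deriv]
  -- The quantity `ε^(β+1) G'(εω)` has two limits as `ε → 0+`. It tends to `0`, by Cauchy's estimate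
  -- for `G` near its limit `v` and `Re β ≥ 0`; after rescaling it tends to `-b ∫ exp(-ωx) x^β dx`.
  have key : ∀ ω : ℂ, 0 < ω.re → 0 < ω.im →
      (∫ x in Ioi (0 : ℝ), exp (-ω * x) * (x : ℂ) ^ β) * b = 0 := by
    intro ω hω hω'
    have hcauchy : Tendsto (fun ε : ℝ => (ε : ℂ) * deriv G (ε * ω)) (𝓝[>] 0) (𝓝 0) := by
      rw [Metric.tendsto_nhds]
      intro η hη
      have h1 := Metric.tendsto_nhds.1 hGt (η * ω.im / 4) (by positivity)
      obtain ⟨δ, hδ, hball⟩ := Metric.mem_nhdsWithin_iff.1 h1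
      filter_upwards [self_mem_nhdsWithin, mem_nhdsWithin_of_mem_nhds (Iio_mem_nhds (show (0:ℝ) < δ / (‖ω‖ + ω.im) by positivity))]
        with ε hε hεδ
      have hε : 0 < ε := hε
      have hεδ : ε < δ / (‖ω‖ + ω.im) := hεδ
      rw [lt_div_iff₀ (by positivity)] at hεδ
      -- The disc of this radius about `εω` stays inside `Im w > 0`, and inside the ball where `G`
      -- is close to `v`.
      have hr : 0 < ε * ω.im / 2 := by positivity
      have hsubset : Metric.closedBall ((ε : ℂ) * ω) (ε * ω.im / 2) ⊆ Metric.ball 0 δ ∩ {w : ℂ | 0 < w.im} := by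
        intro z hz
        rw [Metric.mem_closedBall, dist_eq_norm] at hz
        refine ⟨?_, ?_⟩
        · rw [mem_ball_zero_iff]
          have h2 : ‖(ε : ℂ) * ω‖ = ε * ‖ω‖ := by
            rw [norm_mul, norm_real, Real.norm_of_nonneg hε.le]
          have h3 : ‖z‖ ≤ ‖z - (ε : ℂ) * ω‖ + ‖(ε : ℂ) * ω‖ := by
            simpa using norm_add_le (z - (ε : ℂ) * ω) ((ε : ℂ) * ω)
          nlinarith
        · have := (abs_im_le_norm _).trans hz
          have := (abs_le.1 this).1
          simp at this
          simp only [mem_ofPred_eq]; linarith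
      have hdiff : DiffContOnCl ℂ (fun z => G z - v) (Metric.ball ((ε : ℂ) * ω) (ε * ω.im / 2)) := by
        refine DifferentiableOn.diffContOnCl ?_
        rw [closure_ball _ (by positivity)]
        exact (hGd.mono (hsubset.trans inter_subset_right)).sub_const v
      have h4 := Complex.norm_deriv_le_of_forall_mem_sphere_norm_le (C := η * ω.im / 4) hr hdiff
        (fun z hz => by
          have := hball (hsubset (Metric.sphere_subset_closedBall hz))
          rw [mem_ofPred_eq, dist_eq_norm] at this
          exact this.le)
      rw [deriv_sub_const_fun] at h4
      rw [dist_zero_right, norm_mul, norm_real, Real.norm_of_nonneg hε.le]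
      calc _ ≤ ε * (η * ω.im / 4 / (ε * ω.im / 2)) := by gcongr
        _ = η / 2 := by field_simp; norm_num
        _ < η := by linarith
    -- rescaling
    set F : ℝ → ℝ → ℂ := fun ε => indicator (Ioi (ε * T))
      (fun x => exp (-ω * x) * (x : ℂ) ^ β * q (x / ε)) with hF
    have hscale : ∀ ε : ℝ, 0 < ε → ∫ x in Ioi (0 : ℝ), F ε x =
        -((ε : ℂ) ^ β * (ε * deriv G (ε * ω))) := by
      intro ε hε
      have hε0 : (ε : ℂ) ≠ 0 := ofReal_ne_zero.2 hε.ne'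
      rw [hder _ (by simpa using mul_pos hε hω) (by simpa using mul_pos hε hω'), hF, setIntegral_indicator measurableSet_Ioi,
        inter_eq_right.2 (Ioi_subset_Ioi (by positivity : (0 : ℝ) ≤ ε * T))]
      have h1 := integral_comp_mul_left_Ioi (fun x : ℝ => exp (-ω * x) * (x : ℂ) ^ β * q (x / ε)) T hε
      have h2 : ∫ x in Ioi (ε * T), exp (-ω * x) * (x : ℂ) ^ β * q (x / ε) =
          ε * ∫ x in Ioi T, exp (-ω * ((ε * x : ℝ) : ℂ)) * ((ε * x : ℝ) : ℂ) ^ β * q (ε * x / ε) := by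
        rw [h1, real_smul, ofReal_inv, mul_inv_cancel_left₀ hε0]
      rw [h2, ← integral_const_mul, ← integral_const_mul, ← integral_const_mul, ← integral_neg]
      refine setIntegral_congr_fun measurableSet_Ioi fun t ht => ?_
      have ht0 : 0 < t := hT.trans ht
      have e1 : ((ε * t : ℝ) : ℂ) ^ β = (ε : ℂ) ^ β * (t * (t : ℂ) ^ (β - 1)) := by
        rw [ofReal_mul, mul_cpow_ofReal_nonneg hε.le ht0.le, cpow_sub _ _ (ofReal_ne_zero.2 ht0.ne'),
          cpow_one, mul_div_cancel₀ _ (ofReal_ne_zero.2 ht0.ne')]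
      have e2 : ε * t / ε = t := by field_simp
      have e3 : -ω * ((ε * t : ℝ) : ℂ) = ε * ω * -(t : ℂ) := by push_cast; ring
      simp only [hg, e1, e2, e3]
      ring
    have hlim0 : Tendsto (fun ε : ℝ => ∫ x in Ioi (0 : ℝ), F ε x) (𝓝[>] 0) (𝓝 0) := by
      refine squeeze_zero_norm' ?_ (by simpa only [norm_zero] using hcauchy.norm)
      filter_upwards [self_mem_nhdsWithin, mem_nhdsWithin_of_mem_nhds (Iio_mem_nhds one_pos)] with ε hε hε1
      rw [hscale ε hε, norm_neg, norm_mul, norm_cpow_eq_rpow_re_of_pos hε]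
      exact mul_le_of_le_one_left (norm_nonneg _) (Real.rpow_le_one (le_of_lt hε) (le_of_lt hε1) hβ)
    have hlim1 : Tendsto (fun ε : ℝ => ∫ x in Ioi (0 : ℝ), F ε x) (𝓝[>] 0)
        (𝓝 (∫ x in Ioi (0 : ℝ), exp (-ω * x) * (x : ℂ) ^ β * b)) := by
      have hbd : IntegrableOn (fun x : ℝ => C * (Real.exp (-ω.re * x) * x ^ β.re)) (Ioi 0) :=
        (integrableOn_exp_neg_mul_rpow (by linarith) hω).const_mul C
      refine tendsto_integral_filter_of_dominated_convergence _ ?_ ?_ hbd ?_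
      · filter_upwards [self_mem_nhdsWithin] with ε hε
        have hε : 0 < ε := hε
        refine (aestronglyMeasurable_indicator_iff measurableSet_Ioi).2 ?_
        rw [Measure.restrict_restrict measurableSet_Ioi,
          inter_eq_left.2 (Ioi_subset_Ioi (by positivity : (0 : ℝ) ≤ ε * T))]
        refine ContinuousOn.aestronglyMeasurable ?_ measurableSet_Ioi
        refine ContinuousOn.mul (ContinuousOn.mul (by fun_prop) ((hcpow β).mono
          (Ioi_subset_Ioi (by positivity)))) (hq.comp (by fun_prop) fun x hx => ?_)
        rw [mem_Ioi, lt_div_iff₀ hε, mul_comm]; exact hx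
      · filter_upwards [self_mem_nhdsWithin] with ε hε
        have hε : 0 < ε := hε
        refine (ae_restrict_iff' measurableSet_Ioi).2 (Eventually.of_forall fun x hx => ?_)
        have hx0 : 0 < x := hx
        simp only [hF, indicator]
        split_ifs with hxT
        · have h1 : ‖exp (-ω * x)‖ = Real.exp (-ω.re * x) := by rw [norm_exp]; simp
          rw [norm_mul, norm_mul, h1, norm_cpow_eq_rpow_re_of_pos hx0, mul_comm C]
          gcongr
          exact hC _ (by rw [lt_div_iff₀ hε, mul_comm]; exact hxT)
        · rw [norm_zero]; positivity
      · refine (ae_restrict_iff' measurableSet_Ioi).2 (Eventually.of_forall fun x hx => ?_)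
        have hx0 : 0 < x := hx
        have h1 : Tendsto (fun ε : ℝ => x / ε) (𝓝[>] 0) atTop := by
          simp only [div_eq_mul_inv]
          exact tendsto_inv_nhdsGT_zero.const_mul_atTop hx0
        refine ((hb.comp h1).const_mul (exp (-ω * x) * (x : ℂ) ^ β)).congr' ?_
        have h2 : ∀ᶠ ε in 𝓝[>] (0 : ℝ), T < x / ε := h1.eventually_gt_atTop T
        filter_upwards [self_mem_nhdsWithin, h2] with ε hε hε2
        have hε : 0 < ε := hε
        rw [lt_div_iff₀ hε, mul_comm] at hε2
        simp only [hF, Function.comp]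
        rw [indicator_of_mem (show x ∈ Ioi (ε * T) from hε2)]
    have h0 := tendsto_nhds_unique hlim1 hlim0
    rwa [integral_mul_const] at h0
  by_contra hb0
  have hint0 : ∀ w ∈ {w : ℂ | 0 < w.re},
      IntegrableOn (fun x : ℝ => exp (w * -(x : ℂ)) * (x : ℂ) ^ β) (Ioi 0) := fun w hw =>
    integrableOn_exp_neg_mul_cpow hw (by linarith)
  have hcont := (hasDerivAt_integral_exp_mul (μ := volume.restrict (Ioi 0)) (l := fun x : ℝ => -(x : ℂ))
    (φ := fun x : ℝ => (x : ℂ) ^ β) (by fun_prop) ((hcpow β).aestronglyMeasurable measurableSet_Ioi)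
    (isOpen_re_gt 0) hint0 (w := 1) (by simp)).2.continuousAt.tendsto
  -- Only `ω` with `Im ω > 0` are available; letting `ω → 1` turns the integral into `Γ(β + 1)`,
  -- which is nonzero.
  have hzero : Tendsto (fun y : ℝ => (1 : ℂ) + y * I) (𝓝[>] 0) (𝓝 1) := by
    have : Continuous fun y : ℝ => (1 : ℂ) + y * I := by fun_prop
    simpa using (this.tendsto 0).mono_left nhdsWithin_le_nhds
  have h1 := tendsto_nhds_unique ((hcont.comp hzero).congr' ?_) (tendsto_const_nhds (x := (0 : ℂ)))
  · have hΓ := Complex.integral_cpow_mul_exp_neg_mul_Ioi (a := β + 1) (r := 1)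
      (by simp; linarith) one_pos
    refine Gamma_ne_zero_of_re_pos (s := β + 1) (by simp; linarith) ?_
    rw [ofReal_one, div_one, one_cpow, one_mul] at hΓ
    rw [← hΓ, ← h1]
    refine setIntegral_congr_fun measurableSet_Ioi fun t ht => ?_
    simp [mul_comm]
  · filter_upwards [self_mem_nhdsWithin] with y hy
    have := (mul_eq_zero.1 (key (1 + y * I) (by simp) (by simpa using hy))).resolve_right hb0
    rw [← this]
    simp only [Function.comp, mul_neg, neg_mul]

/-- A combination of the powers `t ^ (α - r - 1)` only has a regularized tail integral if it does so
for trivial reasons. -/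
theorem HasTailIntegral.sum_cpow_coeff {n : ℕ} {b : ℕ → ℂ} {α v : ℂ} {T : ℝ} (hT : 0 < T)
    (h : HasTailIntegral (fun t => ∑ r ∈ Finset.range n, b r * (t : ℂ) ^ (α - r - 1)) T v) :
    ∀ r < n, b r = 0 ∨ (α - r).re < 0 := by
  intro r
  induction r using Nat.strong_induction_on with
  | _ r ih =>
    intro hr
    by_contra! hcon
    obtain ⟨hbr, hre⟩ := hcon
    -- If the `r`-th exponent is not admissible, neither are the earlier, larger ones, so their
    -- coefficients vanish and `t^(α-r-1)` factors out with a cofactor tending to `b r`.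
    have hzero : ∀ j < r, b j = 0 := fun j hj => by
      refine (ih j hj (hj.trans hr)).resolve_right fun hlt => ?_
      simp only [sub_re, natCast_re] at hre hlt
      have : (j : ℝ) < r := by exact_mod_cast hj
      linarith
    set q : ℝ → ℂ := fun t => ∑ j ∈ Finset.range n, b j * ((t : ℂ) ^ (j - r))⁻¹ with hq
    refine hbr (HasTailIntegral.limit_eq_zero (q := q) (β := α - r) (v := v)
      (C := ∑ j ∈ Finset.range n, ‖b j‖ * (T ^ (j - r))⁻¹) hT hre ?_ ?_ ?_ (h.congr fun t ht => ?_))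
    · refine continuousOn_finsetSum _ fun j _ => ContinuousOn.mul continuousOn_const ?_
      exact ContinuousOn.inv₀ (by fun_prop) fun t ht =>
        pow_ne_zero _ (ofReal_ne_zero.2 (hT.trans ht).ne')
    · intro t ht
      refine (norm_sum_le _ _).trans (Finset.sum_le_sum fun j _ => ?_)
      rw [norm_mul, norm_inv, norm_pow, norm_real, Real.norm_of_nonneg (hT.trans ht).le]
      gcongr
    · have : Tendsto q atTop (𝓝 (∑ j ∈ Finset.range n, if j = r then b r else 0)) := by
        refine tendsto_finsetSum _ fun j _ => ?_
        split_ifs with hj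
        · subst hj; simp
        · rcases lt_or_gt_of_ne hj with hj | hj
          · simp [hzero j hj]
          · have h1 : Tendsto (fun t : ℝ => (((t ^ (j - r))⁻¹ : ℝ) : ℂ)) atTop (𝓝 ((0 : ℝ) : ℂ)) :=
              (continuous_ofReal.tendsto 0).comp
                (tendsto_inv_atTop_zero.comp (tendsto_pow_atTop (by omega)))
            simpa using h1.const_mul (b j)
      rwa [Finset.sum_ite_eq' , if_pos (Finset.mem_range.2 hr)] at this
    · rw [hq, Finset.mul_sum]
      refine Finset.sum_congr rfl fun j _ => ?_
      rcases lt_or_ge j r with hj | hj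
      · simp [hzero j hj]
      · have ht0 : (t : ℂ) ≠ 0 := ofReal_ne_zero.2 (hT.trans ht).ne'
        have : α - j - 1 = (α - r - 1) - ((j - r : ℕ) : ℂ) := by
          rw [Nat.cast_sub hj]; ring
        rw [this, cpow_sub _ _ ht0, cpow_natCast]
        ring

/-! ### Primitives with logarithmic singularities -/

/-- Near `c`, the function `P` is the sum of a multiple of `log |t - c|`, a polynomial in
`(t - c)⁻¹` and a function tending to zero. -/
def HasLogExpansionAt (P : ℝ → ℂ) (c : ℝ) : Prop :=
  ∃ (l : ℂ) (Q : Polynomial ℂ), Tendsto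
    (fun t : ℝ => P t - l * Real.log (t - c) - Q.eval (((t - c : ℝ) : ℂ)⁻¹)) (𝓝[≠] c) (𝓝 0)

theorem HasLogExpansionAt.of_tendsto {P : ℝ → ℂ} {c : ℝ} {v : ℂ} (h : Tendsto P (𝓝[≠] c) (𝓝 v)) :
    HasLogExpansionAt P c :=
  ⟨0, Polynomial.C v, by simpa using h.sub_const v⟩

theorem HasLogExpansionAt.of_continuousAt {P : ℝ → ℂ} {c : ℝ} (h : ContinuousAt P c) :
    HasLogExpansionAt P c := .of_tendsto (h.tendsto.mono_left nhdsWithin_le_nhds)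

theorem HasLogExpansionAt.add {P P' : ℝ → ℂ} {c : ℝ} (h : HasLogExpansionAt P c)
    (h' : HasLogExpansionAt P' c) : HasLogExpansionAt (fun t => P t + P' t) c := by
  obtain ⟨l, Q, hQ⟩ := h
  obtain ⟨l', Q', hQ'⟩ := h'
  refine ⟨l + l', Q + Q', ?_⟩
  have := hQ.add hQ'
  rw [add_zero] at this
  refine this.congr fun t => ?_
  rw [Polynomial.eval_add]; ring

theorem HasLogExpansionAt.const_mul {P : ℝ → ℂ} {c : ℝ} (h : HasLogExpansionAt P c) (b : ℂ) :
    HasLogExpansionAt (fun t => b * P t) c := by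
  obtain ⟨l, Q, hQ⟩ := h
  refine ⟨b * l, Polynomial.C b * Q, ?_⟩
  have := hQ.const_mul b
  rw [mul_zero] at this
  refine this.congr fun t => ?_
  rw [Polynomial.eval_mul, Polynomial.eval_C]; ring

theorem tendsto_one_div_nhdsNE {c : ℝ} (hc : c ≠ 0) :
    Tendsto (fun t : ℝ => 1 / t) (𝓝[≠] c) (𝓝[≠] (1 / c)) := by
  refine tendsto_nhdsWithin_of_tendsto_nhds_of_eventually_within _ ?_ ?_
  · simp only [one_div]
    exact (tendsto_inv₀ hc).mono_left nhdsWithin_le_nhds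
  · filter_upwards [self_mem_nhdsWithin] with t ht
    simpa using ht

/-- Logarithmic expansions are preserved by the reflection `t ↦ 1 / t`. -/
theorem HasLogExpansionAt.one_div {P : ℝ → ℂ} {c : ℝ} (hc : 0 < c) (h : HasLogExpansionAt P c) :
    HasLogExpansionAt (fun t => P (1 / t)) (1 / c) := by
  obtain ⟨l, Q, hQ⟩ := h
  have hc' : 0 < 1 / c := by positivity
  have h1 := hQ.comp (by simpa using tendsto_one_div_nhdsNE hc'.ne' :
    Tendsto (fun t : ℝ => 1 / t) (𝓝[≠] (1 / c)) (𝓝[≠] c))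
  have hlog : Tendsto (fun t : ℝ => ((Real.log c - Real.log t : ℝ) : ℂ)) (𝓝[≠] (1 / c))
      (𝓝 ((Real.log c - Real.log (1 / c) : ℝ) : ℂ)) := by
    refine (continuous_ofReal.tendsto _).comp (tendsto_const_nhds.sub ?_)
    exact (Real.continuousAt_log hc'.ne').tendsto.mono_left nhdsWithin_le_nhds
  have h2 := h1.add ((hlog.sub_const ((Real.log c - Real.log (1 / c) : ℝ) : ℂ)).const_mul l)
  refine ⟨l, Q.comp (Polynomial.C (-(1 / (c : ℂ))) + Polynomial.C (-(1 / (c : ℂ) ^ 2)) * Polynomial.X)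
    + Polynomial.C (l * ((Real.log c - Real.log (1 / c) : ℝ) : ℂ)), ?_⟩
  rw [sub_self, mul_zero, add_zero] at h2
  refine h2.congr' ?_
  have hpos : ∀ᶠ t in 𝓝[≠] (1 / c), 0 < t :=
    mem_nhdsWithin_of_mem_nhds (Ioi_mem_nhds hc')
  filter_upwards [self_mem_nhdsWithin, hpos] with t ht ht0
  have htc : t - 1 / c ≠ 0 := sub_ne_zero.2 ht
  have e1 : 1 / t - c = -(c * (t - 1 / c) / t) := by field_simp; ring
  have e2 : Real.log (1 / t - c) = Real.log c + Real.log (t - 1 / c) - Real.log t := by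
    rw [e1, Real.log_neg_eq_log, Real.log_div (mul_ne_zero hc.ne' htc) ht0.ne',
      Real.log_mul hc.ne' htc]
  -- The reflection acts on `1/(t - c)` by an affine map, so polynomials in it stay polynomials;
  -- `log` changes only by a continuous term because `Real.log` ignores signs.
  have e3 : (((1 / t - c : ℝ) : ℂ))⁻¹ = -(1 / (c : ℂ)) + -(1 / (c : ℂ) ^ 2) * (((t - 1 / c : ℝ) : ℂ))⁻¹ := by
    rw [e1]
    have h1 : (t : ℂ) ≠ 0 := ofReal_ne_zero.2 ht0.ne'
    have h2 : (c : ℂ) ≠ 0 := ofReal_ne_zero.2 hc.ne'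
    have h3 : ((t - 1 / c : ℝ) : ℂ) ≠ 0 := ofReal_ne_zero.2 htc
    have h4 : (t : ℂ) = ((t - 1 / c : ℝ) : ℂ) + 1 / c := by push_cast; ring
    rw [ofReal_neg, ofReal_div, ofReal_mul]
    generalize ((t - 1 / c : ℝ) : ℂ) = y at *
    rw [inv_neg, inv_div, h4]
    field_simp
    ring
  simp only [Function.comp, e2, e3, Polynomial.eval_add, Polynomial.eval_comp, Polynomial.eval_mul,
    Polynomial.eval_C, Polynomial.eval_X]
  push_cast
  ring

/-- Comparing `y` with `2y` eliminates the logarithm: the polynomial `Q(2y) - Q(y) - l log 2` tends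
to `0`, hence vanishes, and its coefficients are `(2^n - 1) q_n` for `n > 0` and `-l log 2` for `n =
0`. -/
theorem eq_C_of_tendsto_eval_sub_log {Q : Polynomial ℂ} {l d : ℂ}
    (h : Tendsto (fun y : ℝ => Q.eval (y : ℂ) - l * Real.log y) atTop (𝓝 d)) :
    l = 0 ∧ Q = Polynomial.C d := by
  have h2 : Tendsto (fun y : ℝ => (2 : ℝ) * y) atTop atTop := tendsto_id.const_mul_atTop two_pos
  set R : Polynomial ℂ := Q.comp (Polynomial.C 2 * Polynomial.X) - Q - Polynomial.C (l * Real.log 2) with hR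
  have hRt : Tendsto (fun y : ℝ => R.eval (y : ℂ)) atTop (𝓝 0) := by
    have := (h.comp h2).sub h
    rw [sub_self] at this
    refine this.congr' ?_
    filter_upwards [eventually_gt_atTop 0] with y hy
    simp only [Function.comp, hR, Polynomial.eval_sub, Polynomial.eval_comp, Polynomial.eval_mul,
      Polynomial.eval_C, Polynomial.eval_X, ofReal_mul, Real.log_mul two_ne_zero hy.ne', ofReal_add]
    push_cast; ring
  have hdeg : R.degree ≤ 0 := by
    by_contra! hcon
    have := R.tendsto_norm_atTop hcon (l := atTop) (z := fun y : ℝ => (y : ℂ))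
      (by simpa using tendsto_abs_atTop_atTop)
    exact not_tendsto_nhds_of_tendsto_atTop this _ hRt.norm
  rw [Polynomial.eq_C_of_degree_le_zero hdeg] at hRt
  simp only [Polynomial.eval_C] at hRt
  have hR0 : R = 0 := by
    rw [Polynomial.eq_C_of_degree_le_zero hdeg, tendsto_nhds_unique tendsto_const_nhds hRt,
      Polynomial.C_0]
  have hcoeff : ∀ n : ℕ, Q.coeff n * 2 ^ n - Q.coeff n = if n = 0 then l * Real.log 2 else 0 := by
    intro n
    have := congrArg (fun p => Polynomial.coeff p n) hR0
    simp only [hR, Polynomial.coeff_sub, Polynomial.comp_C_mul_X_coeff, Polynomial.coeff_C,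
      Polynomial.coeff_zero] at this
    linear_combination this
  have hl : l = 0 := by
    have := hcoeff 0
    simp only [pow_zero, mul_one, sub_self, if_true] at this
    refine (mul_eq_zero.1 this.symm).resolve_right ?_
    exact ofReal_ne_zero.2 (Real.log_pos one_lt_two).ne'
  have hQ : Q = Polynomial.C (Q.coeff 0) := by
    ext n
    rcases Nat.eq_zero_or_pos n with rfl | hn
    · simp
    · rw [Polynomial.coeff_C, if_neg hn.ne']
      have := hcoeff n
      rw [if_neg hn.ne', ← mul_sub_one] at this
      refine (mul_eq_zero.1 this).resolve_right ?_
      have h3 : (1 : ℝ) < 2 ^ n := one_lt_pow₀ one_lt_two hn.ne'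
      intro h4
      have : ((2 ^ n - 1 : ℝ) : ℂ) = 0 := by push_cast; exact h4
      rw [ofReal_eq_zero] at this
      linarith
  refine ⟨hl, ?_⟩
  rw [hQ, hl] at h
  simp only [Polynomial.eval_C, zero_mul, sub_zero] at h
  rw [hQ, tendsto_nhds_unique tendsto_const_nhds h]

/-- A function with a logarithmic expansion that is constant on both sides of a point takes the same
value on both sides. -/
theorem HasLogExpansionAt.eq_of_eventually_const {D : ℝ → ℂ} {c : ℝ} {d d' : ℂ}
    (h : HasLogExpansionAt D c) (hr : ∀ᶠ t in 𝓝[>] c, D t = d) (hl : ∀ᶠ t in 𝓝[<] c, D t = d') :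
    d' = d := by
  obtain ⟨l, Q, hQ⟩ := h
  have h1 : Tendsto (fun y : ℝ => c + y⁻¹) atTop (𝓝[>] c) := by
    refine tendsto_nhdsWithin_of_tendsto_nhds_of_eventually_within _ ?_ ?_
    · simpa using tendsto_inv_atTop_zero.const_add c
    · filter_upwards [eventually_gt_atTop 0] with y hy
      simpa using hy
  have h2 := (hQ.mono_left (nhdsWithin_mono c fun t (ht : c < t) => ht.ne')).comp h1
  have h3 : Tendsto (fun y : ℝ => Q.eval (y : ℂ) - l * Real.log y) atTop (𝓝 d) := by
    have := h2.const_sub d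
    rw [sub_zero] at this
    refine this.congr' ?_
    filter_upwards [h1.eventually hr] with y hy
    simp only [Function.comp, hy, add_sub_cancel_left, Real.log_inv, ofReal_inv, inv_inv, ofReal_neg]
    ring
  -- The right side alone forces `l = 0` and `Q` constant; the expansion is two-sided, so the left
  -- limit is the same constant.
  obtain ⟨rfl, rfl⟩ := eq_C_of_tendsto_eval_sub_log h3
  simp only [zero_mul, sub_zero, Polynomial.eval_C] at hQ
  have h4 := hQ.mono_left (nhdsWithin_mono c fun t (ht : t < c) => ht.ne)
  have h5 : Tendsto (fun t : ℝ => D t - d) (𝓝[<] c) (𝓝 (d' - d)) :=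
    tendsto_const_nhds.congr' (by filter_upwards [hl] with t ht using by rw [ht])
  exact sub_eq_zero.1 (tendsto_nhds_unique h5 h4)

theorem eventually_const_of_hasDerivAt_zero {D : ℝ → ℂ} {a b : ℝ} (hab : a < b)
    (h : ∀ t ∈ Ioo a b, HasDerivAt D 0 t) : ∃ d, ∀ t ∈ Ioo a b, D t = d := by
  obtain ⟨x, hx⟩ := exists_between hab
  exact ⟨D x, fun t ht => isOpen_Ioo.is_const_of_deriv_eq_zero isPreconnected_Ioo
    (fun t ht => (h t ht).differentiableAt.differentiableWithinAt) (fun t ht => (h t ht).deriv) ht hx⟩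

/-- `P` is a primitive of `g` on `(0, ∞)` outside of the finite set `S`, at the points of which it has
logarithmic expansions. -/
structure IsLogPrimitive (g P : ℝ → ℂ) (S : Finset ℝ) : Prop where
  hasDerivAt : ∀ t, 0 < t → t ∉ S → HasDerivAt P (g t) t
  expansion : ∀ c, 0 < c → c ∈ S → HasLogExpansionAt P c

namespace IsLogPrimitive

variable {g g' P P' : ℝ → ℂ} {S S' : Finset ℝ}

theorem mono (h : IsLogPrimitive g P S) (hS : S ⊆ S') : IsLogPrimitive g P S' where
  hasDerivAt t ht hn := h.hasDerivAt t ht fun hm => hn (hS hm)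
  expansion c hc _ := by
    by_cases hcS : c ∈ S
    · exact h.expansion c hc hcS
    · exact .of_continuousAt (h.hasDerivAt c hc hcS).continuousAt

theorem congr (h : IsLogPrimitive g P S) (hg : ∀ t, 0 < t → t ∉ S → g t = g' t) :
    IsLogPrimitive g' P S where
  hasDerivAt t ht hn := hg t ht hn ▸ h.hasDerivAt t ht hn
  expansion := h.expansion

theorem add (h : IsLogPrimitive g P S) (h' : IsLogPrimitive g' P' S) :
    IsLogPrimitive (fun t => g t + g' t) (fun t => P t + P' t) S where
  hasDerivAt t ht hn := (h.hasDerivAt t ht hn).add (h'.hasDerivAt t ht hn)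
  expansion c hc hcS := (h.expansion c hc hcS).add (h'.expansion c hc hcS)

theorem const_mul (h : IsLogPrimitive g P S) (b : ℂ) :
    IsLogPrimitive (fun t => b * g t) (fun t => b * P t) S where
  hasDerivAt t ht hn := (h.hasDerivAt t ht hn).const_mul b
  expansion c hc hcS := (h.expansion c hc hcS).const_mul b

theorem zero (S : Finset ℝ) : IsLogPrimitive (fun _ => 0) (fun _ => 0) S where
  hasDerivAt t _ _ := hasDerivAt_const t 0
  expansion _ _ _ := .of_continuousAt continuousAt_const

theorem sum {ι : Type*} {g P : ι → ℝ → ℂ} {s : Finset ι} (h : ∀ i ∈ s, IsLogPrimitive (g i) (P i) S) :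
    IsLogPrimitive (fun t => ∑ i ∈ s, g i t) (fun t => ∑ i ∈ s, P i t) S := by
  classical
  induction s using Finset.induction_on with
  | empty => simpa using zero S
  | insert a s ha ih =>
    simp only [Finset.sum_insert ha]
    exact (h a (by simp)).add (ih fun i hi => h i (by simp [hi]))

theorem one_div (h : IsLogPrimitive g P S) :
    IsLogPrimitive (fun t : ℝ => 1 / (t : ℂ) ^ 2 * g (1 / t)) (fun t => -P (1 / t))
      (S.image fun t => 1 / t) where
  hasDerivAt t ht hn := by
    have hn' : 1 / t ∉ S := fun hm => hn (Finset.mem_image.2 ⟨1 / t, hm, by simp⟩)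
    have h1 := h.hasDerivAt (1 / t) (by positivity) hn'
    have h2 : HasDerivAt (fun t : ℝ => 1 / t) (-(t ^ 2)⁻¹) t := by
      simpa using hasDerivAt_inv ht.ne'
    refine ((HasDerivAt.scomp t h1 h2).neg).congr_deriv ?_
    rw [real_smul]; push_cast; ring
  expansion c hc hcS := by
    obtain ⟨x, hx, rfl⟩ := Finset.mem_image.1 hcS
    have hx0 : 0 < x := by simpa using hc
    simpa using ((h.expansion x hx0 hx).one_div hx0).const_mul (-1)

theorem eventually_hasDerivAt (h : IsLogPrimitive g P S) {c : ℝ} (hc : 0 < c) :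
    ∀ᶠ t in 𝓝[≠] c, HasDerivAt P (g t) t := by
  have h1 : ∀ᶠ t in 𝓝[≠] c, t ∉ S := by
    have : ((S : Set ℝ) \ {c})ᶜ ∈ 𝓝 c :=
      ((S.finite_toSet.sdiff).isClosed.isOpen_compl).mem_nhds (by simp)
    filter_upwards [self_mem_nhdsWithin, mem_nhdsWithin_of_mem_nhds this] with t ht ht' hts
    exact ht' ⟨hts, ht⟩
  filter_upwards [h1, mem_nhdsWithin_of_mem_nhds (Ioi_mem_nhds hc)] with t ht ht0
  exact h.hasDerivAt t ht0 ht

/-- A locally constant function could jump at the points of `S`; the common logarithmic expansion on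
both sides excludes this, and `(0, ∞)` is connected. -/
theorem const_of_zero {D : ℝ → ℂ} (h : IsLogPrimitive (fun _ => 0) D S) {x y : ℝ} (hx : 0 < x)
    (hy : 0 < y) (hxS : x ∉ S) (hyS : y ∉ S) : D x = D y := by
  have hloc : ∀ c : Ioi (0 : ℝ), ∃ d, ∀ᶠ t in 𝓝[≠] (c : ℝ), D t = d := by
    rintro ⟨c, hc⟩
    have h1 := h.eventually_hasDerivAt hc
    obtain ⟨ε, hε, hball⟩ := Metric.mem_nhdsWithin_iff.1 h1
    have hr : ∀ t ∈ Ioo c (c + ε), HasDerivAt D 0 t := fun t ht => hball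
      ⟨by rw [Metric.mem_ball, Real.dist_eq, abs_lt]; constructor <;> linarith [ht.1, ht.2], ht.1.ne'⟩
    have hl : ∀ t ∈ Ioo (c - ε) c, HasDerivAt D 0 t := fun t ht => hball
      ⟨by rw [Metric.mem_ball, Real.dist_eq, abs_lt]; constructor <;> linarith [ht.1, ht.2], ht.2.ne⟩
    obtain ⟨d, hd⟩ := eventually_const_of_hasDerivAt_zero (by linarith) hr
    obtain ⟨d', hd'⟩ := eventually_const_of_hasDerivAt_zero (by linarith) hl
    have her : ∀ᶠ t in 𝓝[>] c, D t = d := by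
      filter_upwards [Ioo_mem_nhdsGT (show c < c + ε by linarith)] with t ht using hd t ht
    have hel : ∀ᶠ t in 𝓝[<] c, D t = d' := by
      filter_upwards [Ioo_mem_nhdsLT (show c - ε < c by linarith)] with t ht using hd' t ht
    have hexp : HasLogExpansionAt D c := (h.mono (Finset.subset_insert c S)).expansion c hc (by simp)
    have hdd := hexp.eq_of_eventually_const her hel
    refine ⟨d, ?_⟩
    rw [← nhdsLT_sup_nhdsGT, eventually_sup]
    exact ⟨hdd ▸ hel, her⟩
  -- `d c` is the value of `D` near but not at `c`, which is defined also at points of `S`.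
  choose d hd using hloc
  have hconst : IsLocallyConstant d := by
    rw [IsLocallyConstant.iff_eventually_eq]
    intro c
    have h1 : ∀ᶠ t : ℝ in 𝓝 (c : ℝ), t ≠ (c : ℝ) → D t = d c := eventually_nhdsWithin_iff.1 (hd c)
    have h2 := h1.eventually_nhds
    have h3 : ∀ᶠ x : Ioi (0 : ℝ) in 𝓝 c, ∀ᶠ t : ℝ in 𝓝 (x : ℝ), t ≠ (c : ℝ) → D t = d c :=
      continuous_subtype_val.continuousAt.eventually h2
    filter_upwards [h3] with x hx
    by_cases hxc : x = c
    · rw [hxc]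
    · have hne : ∀ᶠ t : ℝ in 𝓝 (x : ℝ), t ≠ (c : ℝ) := isOpen_ne.mem_nhds fun h => hxc (Subtype.ext h)
      have h4 : ∀ᶠ t in 𝓝[≠] (x : ℝ), D t = d c :=
        ((hx.and hne).mono fun t ht => ht.1 ht.2).filter_mono nhdsWithin_le_nhds
      obtain ⟨t, ht, ht'⟩ := (h4.and (hd x)).exists
      rw [← ht, ← ht']
  have hval : ∀ c : Ioi (0 : ℝ), (c : ℝ) ∉ S → D c = d c := by
    intro c hc
    have h1 := (h.hasDerivAt c c.2 hc).continuousAt.tendsto.mono_left (nhdsWithin_le_nhds (s := {(c : ℝ)}ᶜ))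
    exact tendsto_nhds_unique h1 (tendsto_const_nhds.congr'
      (by filter_upwards [hd c] with t ht using ht.symm))
  have : PreconnectedSpace (Ioi (0 : ℝ)) := Subtype.preconnectedSpace isPreconnected_Ioi
  rw [hval ⟨x, hx⟩ hxS, hval ⟨y, hy⟩ hyS]
  exact hconst.apply_eq_of_preconnectedSpace _ _

theorem sub_eq_sub (h : IsLogPrimitive g P S) (h' : IsLogPrimitive g P' S) {x y : ℝ} (hx : 0 < x)
    (hy : 0 < y) (hxS : x ∉ S) (hyS : y ∉ S) : P x - P y = P' x - P' y := by
  have := ((h.add (h'.const_mul (-1))).congr (g' := fun _ => 0) fun t _ _ => by ring).const_of_zero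
    hx hy hxS hyS
  linear_combination this

end IsLogPrimitive

/-! ### Meromorphic functions of a real variable -/

/-- Dividing an analytic function by `(t - c)^n` one factor at a time, each `dslope` removes one
polar term. -/
theorem exists_principalPart {g : ℝ → ℂ} {c : ℝ} (hg : MeromorphicAt g c) :
    ∃ (Q : Polynomial ℂ) (h : ℝ → ℂ), AnalyticAt ℝ h c ∧
      ∀ᶠ t in 𝓝[≠] c, g t = h t + Q.eval (((t - c : ℝ) : ℂ)⁻¹) := by
  have key : ∀ (n : ℕ) (F : ℝ → ℂ), AnalyticAt ℝ F c → ∃ (Q : Polynomial ℂ) (h : ℝ → ℂ),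
      AnalyticAt ℝ h c ∧ ∀ t, t ≠ c → (((t - c : ℝ) : ℂ)⁻¹) ^ n * F t =
        h t + Q.eval (((t - c : ℝ) : ℂ)⁻¹) := by
    intro n
    induction n with
    | zero => exact fun F hF => ⟨0, F, hF, by simp⟩
    | succ n ih =>
      intro F hF
      obtain ⟨p, hp⟩ := hF
      obtain ⟨Q, h, hh, heq⟩ := ih (dslope F c) hp.has_fpower_series_dslope_fslope.analyticAt
      refine ⟨Q + Polynomial.C (F c) * Polynomial.X ^ (n + 1), h, hh, fun t ht => ?_⟩
      have hne : ((t - c : ℝ) : ℂ) ≠ 0 := ofReal_ne_zero.2 (sub_ne_zero.2 ht)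
      have h1 := heq t ht
      rw [dslope_of_ne _ ht, slope_def_module, real_smul, ofReal_inv] at h1
      simp only [Polynomial.eval_add, Polynomial.eval_mul, Polynomial.eval_C, Polynomial.eval_pow,
        Polynomial.eval_X]
      rw [← add_assoc, ← h1]
      ring
  obtain ⟨n, hn⟩ := hg
  obtain ⟨Q, h, hh, heq⟩ := key n _ hn
  refine ⟨Q, h, hh, ?_⟩
  filter_upwards [self_mem_nhdsWithin] with t ht
  have hne : ((t - c : ℝ) : ℂ) ≠ 0 := ofReal_ne_zero.2 (sub_ne_zero.2 ht)
  rw [← heq t ht, real_smul, ofReal_pow, inv_pow, inv_mul_cancel_left₀ (pow_ne_zero n hne)]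

theorem HasLogExpansionAt.of_meromorphicAt {g : ℝ → ℂ} {c : ℝ} (hg : MeromorphicAt g c) :
    HasLogExpansionAt g c := by
  obtain ⟨Q, h, hh, heq⟩ := exists_principalPart hg
  refine ⟨0, Q + Polynomial.C (h c), ?_⟩
  have := (hh.continuousAt.tendsto.mono_left (nhdsWithin_le_nhds (s := {c}ᶜ))).sub_const (h c)
  rw [sub_self] at this
  refine this.congr' ?_
  filter_upwards [heq] with t ht
  rw [ht, Polynomial.eval_add, Polynomial.eval_C]
  ring

/-- Two meromorphic functions on a preconnected set that agree near one point agree near every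
point. -/
theorem eventuallyEq_nhdsNE_of_isPreconnected {Φ Ψ : ℂ → ℂ} {U : Set ℂ} (hΦ : MeromorphicOn Φ U)
    (hΨ : MeromorphicOn Ψ U) (hU : IsPreconnected U) {x y : ℂ} (hx : x ∈ U) (hy : y ∈ U)
    (h : Φ =ᶠ[𝓝[≠] x] Ψ) : Φ =ᶠ[𝓝[≠] y] Ψ := by
  have h1 : meromorphicOrderAt (Φ - Ψ) x = ⊤ := by
    rw [meromorphicOrderAt_eq_top_iff]
    filter_upwards [h] with z hz using by simp [hz]
  have h2 : meromorphicOrderAt (Φ - Ψ) y = ⊤ := by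
    by_contra hne
    exact (hΦ.sub hΨ).meromorphicOrderAt_ne_top_of_isPreconnected hU hy hx hne h1
  rw [meromorphicOrderAt_eq_top_iff] at h2
  filter_upwards [h2] with z hz using sub_eq_zero.1 hz

/-! ### Finite part integrals -/

/-- Multiplication by the highest power of `u` isolates the leading coefficient, which must vanish;
this makes constant terms unique. -/
theorem tendsto_zero_of_polar_sum {N : ℕ} {d : ℕ → ℂ} {v : ℂ}
    (h : Tendsto (fun u : ℂ => ∑ j ∈ Finset.range N, d j / u ^ (j + 1)) (𝓝[≠] 0) (𝓝 v)) : v = 0 := by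
  induction N generalizing v with
  | zero =>
    simp only [Finset.range_zero, Finset.sum_empty] at h
    exact (tendsto_nhds_unique tendsto_const_nhds h).symm
  | succ N ih =>
    have hid : Tendsto (fun u : ℂ => u) (𝓝[≠] 0) (𝓝 0) := tendsto_id.mono_left nhdsWithin_le_nhds
    have h1 : Tendsto (fun u : ℂ => u ^ (N + 1) * ∑ j ∈ Finset.range (N + 1), d j / u ^ (j + 1))
        (𝓝[≠] 0) (𝓝 0) := by simpa using (hid.pow (N + 1)).mul h
    have h2 : Tendsto (fun u : ℂ => ∑ j ∈ Finset.range N, d j * u ^ (N - j) + d N)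
        (𝓝[≠] 0) (𝓝 (∑ j ∈ Finset.range N, d j * 0 ^ (N - j) + d N)) := by
      refine Tendsto.add_const _ (tendsto_finsetSum _ fun j _ => (hid.pow _).const_mul _)
    have h3 : ∑ j ∈ Finset.range N, d j * (0 : ℂ) ^ (N - j) + d N = d N := by
      rw [Finset.sum_eq_zero fun j hj => ?_, zero_add]
      have := Finset.mem_range.1 hj
      rw [zero_pow (by omega), mul_zero]
    rw [h3] at h2
    have h4 : d N = 0 := by
      refine tendsto_nhds_unique (h2.congr' ?_) h1
      filter_upwards [self_mem_nhdsWithin] with u hu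
      have hu : u ≠ 0 := hu
      rw [Finset.sum_range_succ, mul_add, Finset.mul_sum]
      congr 1
      · refine Finset.sum_congr rfl fun j hj => ?_
        have : u ^ (N + 1) = u ^ (N - j) * u ^ (j + 1) := by
          rw [← pow_add]; congr 1; have := Finset.mem_range.1 hj; omega
        rw [this]
        field_simp
      · field_simp
    refine ih (h.congr fun u => ?_)
    rw [Finset.sum_range_succ, h4, zero_div, add_zero]

theorem HasConstantTerm.unique {Φ : ℂ → ℂ} {v v' : ℂ} (h : HasConstantTerm Φ v)
    (h' : HasConstantTerm Φ v') : v = v' := by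
  obtain ⟨N, d, hd⟩ := h
  obtain ⟨N', d', hd'⟩ := h'
  have h1 := hd'.sub hd
  have key : ∀ (M N : ℕ) (d : ℕ → ℂ) (u : ℂ), N ≤ M → ∑ j ∈ Finset.range N, d j / u ^ (j + 1) =
      ∑ j ∈ Finset.range M, (if j < N then d j else 0) / u ^ (j + 1) := by
    intro M N d u hle
    rw [← Finset.sum_subset (Finset.range_mono hle)]
    · exact Finset.sum_congr rfl fun j hj => by rw [if_pos (Finset.mem_range.1 hj)]
    · intro j _ hj
      rw [if_neg (by simpa using hj), zero_div]
  have h2 : Tendsto (fun u : ℂ => ∑ j ∈ Finset.range (max N N'),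
      ((if j < N then d j else 0) - (if j < N' then d' j else 0)) / u ^ (j + 1)) (𝓝[≠] 0)
      (𝓝 (v' - v)) := by
    refine h1.congr fun u => ?_
    rw [key (max N N') N d u (le_max_left _ _), key (max N N') N' d' u (le_max_right _ _)]
    simp only [sub_div, Finset.sum_sub_distrib]
    ring
  have := tendsto_zero_of_polar_sum h2
  exact (sub_eq_zero.1 this).symm

theorem HasConstantTerm.congr {Φ Ψ : ℂ → ℂ} {v : ℂ} (h : HasConstantTerm Φ v)
    (he : Φ =ᶠ[𝓝[≠] 0] Ψ) : HasConstantTerm Ψ v := by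
  obtain ⟨N, d, hd⟩ := h
  exact ⟨N, d, hd.congr' (by filter_upwards [he] with u hu using by rw [hu])⟩

/-- Both continuations are meromorphic on the smaller half-plane, which is connected and contains
`0`, and they agree for large `Re u`. -/
theorem HasFinitePartIntegral.unique {g : ℝ → ℂ} {a b c : ℝ} {v v' : ℂ}
    (h : HasFinitePartIntegral g a b c v) (h' : HasFinitePartIntegral g a b c v') : v = v' := by
  obtain ⟨δ, σ, Φ, hδ, hm, hi, hv⟩ := h
  obtain ⟨δ', σ', Φ', hδ', hm', hi', hv'⟩ := h'
  refine hv.unique (hv'.congr ?_)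
  have hsub : {u : ℂ | -(min δ δ') < u.re} ⊆ {u : ℂ | -δ < u.re} := by
    intro u hu
    have hu : -(min δ δ') < u.re := hu
    have := min_le_left δ δ'; show -δ < u.re; linarith
  have hsub' : {u : ℂ | -(min δ δ') < u.re} ⊆ {u : ℂ | -δ' < u.re} := by
    intro u hu
    have hu : -(min δ δ') < u.re := hu
    have := min_le_right δ δ'; show -δ' < u.re; linarith
  have hmin : 0 < min δ δ' := lt_min hδ hδ'
  refine (eventuallyEq_nhdsNE_of_isPreconnected (hm.mono_set hsub) (hm'.mono_set hsub')
    (convex_halfSpace_re_gt _).isPreconnected (x := ((|σ| + |σ'| + 1 : ℝ) : ℂ)) (y := 0) ?_ ?_ ?_).symm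
  · show -(min δ δ') < (((|σ| + |σ'| + 1 : ℝ)) : ℂ).re
    rw [ofReal_re]; have := abs_nonneg σ; have := abs_nonneg σ'; linarith
  · simpa using hmin
  · have h1 : {u : ℂ | max σ σ' < u.re} ∈ 𝓝 ((|σ| + |σ'| + 1 : ℝ) : ℂ) :=
      (isOpen_re_gt _).mem_nhds (by
        simp only [mem_ofPred_eq, ofReal_re, max_lt_iff]
        have := le_abs_self σ; have := le_abs_self σ'; have := abs_nonneg σ; have := abs_nonneg σ'
        constructor <;> linarith)
    filter_upwards [mem_nhdsWithin_of_mem_nhds h1] with u hu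
    rw [(hi u ((le_max_left _ _).trans_lt hu)).2, (hi' u ((le_max_right _ _).trans_lt hu)).2]

/-- The regularized integral `∫_a^b g(t) dt` around `c` exists, and the function in its definition is
regular at `u = 0`. -/
def HasRegularFinitePart (g : ℝ → ℂ) (a b c : ℝ) (v : ℂ) : Prop :=
  ∃ (σ : ℝ) (Φ : ℂ → ℂ), MeromorphicOn Φ {u : ℂ | -(1 / 2 : ℝ) < u.re} ∧
    (∀ u : ℂ, σ < u.re →
      IntegrableOn (fun t : ℝ => ((|t - c| : ℝ) : ℂ) ^ u * g t) (Icc a b) ∧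
      Φ u = ∫ t in a..b, ((|t - c| : ℝ) : ℂ) ^ u * g t) ∧
    Tendsto Φ (𝓝[≠] 0) (𝓝 v)

namespace HasRegularFinitePart

variable {g g' : ℝ → ℂ} {a b c : ℝ} {v v' : ℂ}

theorem hasFinitePartIntegral (h : HasRegularFinitePart g a b c v) :
    HasFinitePartIntegral g a b c v := by
  obtain ⟨σ, Φ, hm, hi, hv⟩ := h
  exact ⟨1 / 2, σ, Φ, by norm_num, hm, hi, 0, fun _ => 0, by simpa using hv⟩

theorem add (hab : a ≤ b) (h : HasRegularFinitePart g a b c v) (h' : HasRegularFinitePart g' a b c v') :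
    HasRegularFinitePart (fun t => g t + g' t) a b c (v + v') := by
  obtain ⟨σ, Φ, hm, hi, hv⟩ := h
  obtain ⟨σ', Φ', hm', hi', hv'⟩ := h'
  refine ⟨max σ σ', fun u => Φ u + Φ' u, hm.add hm', fun u hu => ?_, hv.add hv'⟩
  obtain ⟨i, e⟩ := hi u ((le_max_left _ _).trans_lt hu)
  obtain ⟨i', e'⟩ := hi' u ((le_max_right _ _).trans_lt hu)
  simp only [mul_add]
  refine ⟨i.add i', ?_⟩
  have j := (intervalIntegrable_iff_integrableOn_Icc_of_le hab).2 i
  have j' := (intervalIntegrable_iff_integrableOn_Icc_of_le hab).2 i'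
  rw [e, e', intervalIntegral.integral_add j j']

theorem const_mul (h : HasRegularFinitePart g a b c v) (k : ℂ) :
    HasRegularFinitePart (fun t => k * g t) a b c (k * v) := by
  obtain ⟨σ, Φ, hm, hi, hv⟩ := h
  refine ⟨σ, fun u => k * Φ u, (MeromorphicOn.const k).mul hm, fun u hu => ?_, hv.const_mul k⟩
  obtain ⟨i, e⟩ := hi u hu
  simp only [mul_left_comm _ k]
  exact ⟨i.const_mul k, by rw [e, intervalIntegral.integral_const_mul]⟩

theorem zero : HasRegularFinitePart (fun _ => 0) a b c 0 :=
  ⟨0, fun _ => 0, MeromorphicOn.const 0, by simp, tendsto_const_nhds⟩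

theorem sum {ι : Type*} {g : ι → ℝ → ℂ} {v : ι → ℂ} {s : Finset ι} (hab : a ≤ b)
    (h : ∀ i ∈ s, HasRegularFinitePart (g i) a b c (v i)) :
    HasRegularFinitePart (fun t => ∑ i ∈ s, g i t) a b c (∑ i ∈ s, v i) := by
  classical
  induction s using Finset.induction_on with
  | empty => simpa using zero
  | insert x s hx ih =>
    simp only [Finset.sum_insert hx]
    exact (h x (by simp)).add hab (ih fun i hi => h i (by simp [hi]))

theorem congr (h : HasRegularFinitePart g a b c v) (hg : ∀ t ∈ Icc a b, t ≠ c → g t = g' t) (hab : a ≤ b) :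
    HasRegularFinitePart g' a b c v := by
  obtain ⟨σ, Φ, hm, hi, hv⟩ := h
  refine ⟨σ, Φ, hm, fun u hu => ?_, hv⟩
  obtain ⟨i, e⟩ := hi u hu
  have hae : ∀ᵐ t : ℝ, t ≠ c := by simp [ae_iff]
  have hae' : ∀ s ⊆ Icc a b, MeasurableSet s → (fun t : ℝ => ((|t - c| : ℝ) : ℂ) ^ u * g t)
      =ᵐ[volume.restrict s] fun t : ℝ => ((|t - c| : ℝ) : ℂ) ^ u * g' t := by
    intro s hs hsm
    filter_upwards [ae_restrict_mem hsm, ae_restrict_of_ae hae] with t ht htc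
    rw [hg t (hs ht) htc]
  refine ⟨i.congr (hae' _ subset_rfl measurableSet_Icc), ?_⟩
  rw [e, intervalIntegral.integral_of_le hab, intervalIntegral.integral_of_le hab]
  exact integral_congr_ae (hae' _ Ioc_subset_Icc_self measurableSet_Ioc)

end HasRegularFinitePart

theorem abs_cpow_eq_exp {x : ℝ} (hx : x ≠ 0) (u : ℂ) :
    ((|x| : ℝ) : ℂ) ^ u = exp (u * Real.log x) := by
  rw [cpow_def_of_ne_zero (ofReal_ne_zero.2 (abs_ne_zero.2 hx)), ← ofReal_log (abs_nonneg x),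
    Real.log_abs, mul_comm]

theorem integrableOn_exp_mul_log {u : ℂ} (hu : -1 < u.re) (a b c : ℝ) :
    IntegrableOn (fun t : ℝ => exp (u * Real.log (t - c))) (Icc a b) := by
  rcases le_total a b with hab | hab
  · rw [← intervalIntegrable_iff_integrableOn_Icc_of_le hab]
    have h1 : IntervalIntegrable (fun x : ℝ => (x : ℂ) ^ (u.re : ℂ)) volume (a - c) (b - c) :=
      intervalIntegral.intervalIntegrable_cpow' (by simpa using hu)
    have h2 := (h1.comp_sub_right c).norm
    simp only [sub_add_cancel] at h2
    refine h2.mono_fun ?_ ?_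
    · have : Measurable fun t : ℝ => exp (u * Real.log (t - c)) := by fun_prop
      exact this.aestronglyMeasurable
    · have hae : ∀ᵐ t : ℝ, t ≠ c := by simp [ae_iff]
      filter_upwards [ae_restrict_of_ae hae] with t ht
      rw [norm_norm, norm_cpow_real, norm_exp, re_mul_ofReal, norm_real, Real.norm_eq_abs,
        Real.rpow_def_of_pos (abs_pos.2 (sub_ne_zero.2 ht)), Real.log_abs, mul_comm]
  · rcases hab.eq_or_lt with rfl | hab
    · simp
    · simp [Icc_eq_empty_of_lt hab]

/-- `|t - c|^u` is integrable for `Re u > -1`, a half-plane containing `0`, so nothing needs to be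
continued. -/
theorem hasRegularFinitePart_of_continuousOn {h : ℝ → ℂ} {a b c : ℝ} (hab : a ≤ b)
    (hh : ContinuousOn h (Icc a b)) : HasRegularFinitePart h a b c (∫ t in a..b, h t) := by
  have hint : ∀ u ∈ {u : ℂ | -1 < u.re},
      IntegrableOn (fun t : ℝ => exp (u * Real.log (t - c)) * h t) (Icc a b) := fun u hu =>
    (integrableOn_exp_mul_log hu a b c).mul_continuousOn hh isCompact_Icc
  have hd := fun u hu => (hasDerivAt_integral_exp_mul (μ := volume.restrict (Icc a b))
    (l := fun t : ℝ => ((Real.log (t - c) : ℝ) : ℂ)) (φ := h)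
    (by have : Measurable fun t : ℝ => ((Real.log (t - c) : ℝ) : ℂ) := by fun_prop
        exact this.aestronglyMeasurable)
    (hh.aestronglyMeasurable measurableSet_Icc) (isOpen_re_gt (-1)) hint (w := u) hu).2
  have hae : ∀ᵐ t : ℝ, t ≠ c := by simp [ae_iff]
  have hae' : ∀ u : ℂ, (fun t : ℝ => exp (u * Real.log (t - c)) * h t) =ᵐ[volume.restrict (Icc a b)]
      fun t : ℝ => ((|t - c| : ℝ) : ℂ) ^ u * h t := fun u => by
    filter_upwards [ae_restrict_of_ae hae] with t ht
    rw [abs_cpow_eq_exp (sub_ne_zero.2 ht)]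
  refine ⟨-(1 / 2), fun u => ∫ t in Icc a b, exp (u * Real.log (t - c)) * h t, ?_, fun u hu => ?_, ?_⟩
  · have hd' : DifferentiableOn ℂ (fun u : ℂ => ∫ t in Icc a b, exp (u * Real.log (t - c)) * h t)
      {u : ℂ | -1 < u.re} := fun u hu => (hd u hu).differentiableAt.differentiableWithinAt
    exact fun u hu => (hd'.analyticAt ((isOpen_re_gt _).mem_nhds (by
      have : -(1 / 2 : ℝ) < u.re := hu
      show -1 < u.re; linarith))).meromorphicAt
  · refine ⟨(hint u (by show -1 < u.re; linarith)).congr (hae' u), ?_⟩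
    rw [intervalIntegral.integral_of_le hab, ← integral_Icc_eq_integral_Ioc]
    exact integral_congr_ae (hae' u)
  · have := (hd 0 (by simp)).continuousAt.tendsto
    simp only [zero_mul, Complex.exp_zero, one_mul] at this
    rw [intervalIntegral.integral_of_le hab, ← integral_Icc_eq_integral_Ioc]
    exact this.mono_left nhdsWithin_le_nhds

/-- At `t = c` the expression evaluates to `0` by the conventions for `0 ^ u` and `0⁻¹`, which is
the limit when `Re u > n`. -/
theorem continuous_abs_cpow_mul_inv_pow (c : ℝ) {u : ℂ} {n : ℕ} (hu : n < u.re) :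
    Continuous fun t : ℝ => ((|t - c| : ℝ) : ℂ) ^ u * (((t - c : ℝ) : ℂ)⁻¹) ^ n := by
  have hu0 : u ≠ 0 := by
    rintro rfl
    have : (0 : ℝ) ≤ n := Nat.cast_nonneg n
    simp only [zero_re] at hu; linarith
  rw [continuous_iff_continuousAt]
  intro t
  by_cases ht : t = c
  · subst ht
    have h0 : ((|t - t| : ℝ) : ℂ) ^ u * (((t - t : ℝ) : ℂ)⁻¹) ^ n = 0 := by
      simp [zero_cpow hu0]
    rw [ContinuousAt, h0]
    have h1 : Tendsto (fun s : ℝ => |s - t| ^ (u.re - n)) (𝓝 t) (𝓝 0) := by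
      have : ContinuousAt (fun s : ℝ => |s - t| ^ (u.re - n)) t :=
        ContinuousAt.rpow_const (by fun_prop) (Or.inr (by linarith))
      have h2 := this.tendsto
      simp only [sub_self, abs_zero] at h2
      rwa [Real.zero_rpow (by linarith)] at h2
    refine squeeze_zero_norm (fun s => ?_) h1
    by_cases hs : s = t
    · rw [hs, h0, norm_zero]; positivity
    · have hpos : 0 < |s - t| := abs_pos.2 (sub_ne_zero.2 hs)
      rw [norm_mul, norm_cpow_eq_rpow_re_of_pos hpos, norm_pow, norm_inv, norm_real, Real.norm_eq_abs,
        Real.rpow_sub hpos, Real.rpow_natCast, inv_pow, div_eq_mul_inv]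
  · have hne : t - c ≠ 0 := sub_ne_zero.2 ht
    refine ContinuousAt.mul (ContinuousAt.cpow (by fun_prop) continuousAt_const
      (ofReal_mem_slitPlane.2 (abs_pos.2 hne))) (ContinuousAt.pow (ContinuousAt.inv₀ (by fun_prop) ?_) _)
    exact ofReal_ne_zero.2 hne

theorem hasDerivAt_ofReal_sub (c t : ℝ) : HasDerivAt (fun t : ℝ => ((t - c : ℝ) : ℂ)) 1 t := by
  have := ((hasDerivAt_id t).sub_const c).ofReal_comp
  exact this

theorem hasDerivAt_abs_cpow_mul_inv_pow {c t : ℝ} (ht : t ≠ c) (u : ℂ) (n : ℕ) :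
    HasDerivAt (fun t : ℝ => ((|t - c| : ℝ) : ℂ) ^ u * (((t - c : ℝ) : ℂ)⁻¹) ^ n)
      ((u - n) * (((|t - c| : ℝ) : ℂ) ^ u * (((t - c : ℝ) : ℂ)⁻¹) ^ (n + 1))) t := by
  have hne : t - c ≠ 0 := sub_ne_zero.2 ht
  have hne' : ((t - c : ℝ) : ℂ) ≠ 0 := ofReal_ne_zero.2 hne
  have h1 : HasDerivAt (fun t : ℝ => exp (u * Real.log (t - c)))
      (exp (u * Real.log (t - c)) * (u * ((t - c : ℝ) : ℂ)⁻¹)) t := by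
    have := (((Real.hasDerivAt_log hne).comp t ((hasDerivAt_id t).sub_const c)).ofReal_comp.const_mul u).cexp
    refine this.congr_deriv ?_
    simp
  have h2 : HasDerivAt (fun t : ℝ => (((t - c : ℝ) : ℂ)⁻¹) ^ n)
      (-(n : ℂ) * (((t - c : ℝ) : ℂ)⁻¹) ^ (n + 1)) t := by
    have := ((hasDerivAt_ofReal_sub c t).inv hne').pow n
    refine this.congr_deriv ?_
    rcases n with _ | n
    · simp
    · simp only [Pi.inv_apply, Nat.add_sub_cancel, div_eq_mul_inv, ← inv_pow]
      ring
  refine ((h1.mul h2).congr_deriv ?_).congr_of_eventuallyEq ?_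
  · rw [abs_cpow_eq_exp hne, pow_succ]; ring
  · filter_upwards [isOpen_ne.mem_nhds ht] with s hs
    rw [abs_cpow_eq_exp (sub_ne_zero.2 hs)]; rfl

/-- The primitive of `(t - c) ^ (-(j + 1))`. -/
def polarPrimitive (c : ℝ) (j : ℕ) (t : ℝ) : ℂ :=
  if j = 0 then (Real.log (t - c) : ℂ) else -(1 / (j : ℂ)) * (((t - c : ℝ) : ℂ)⁻¹) ^ j

theorem hasDerivAt_polarPrimitive {c t : ℝ} (ht : t ≠ c) (j : ℕ) :
    HasDerivAt (polarPrimitive c j) ((((t - c : ℝ) : ℂ)⁻¹) ^ (j + 1)) t := by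
  have hne : t - c ≠ 0 := sub_ne_zero.2 ht
  rcases Nat.eq_zero_or_pos j with rfl | hj
  · have := ((Real.hasDerivAt_log hne).comp t ((hasDerivAt_id t).sub_const c)).ofReal_comp
    refine (this.congr_deriv (by simp)).congr_of_eventuallyEq (Eventually.of_forall fun s => ?_)
    simp [polarPrimitive]
  · have h := (hasDerivAt_abs_cpow_mul_inv_pow ht 0 j).const_mul (-(1 / (j : ℂ)))
    have hj0 : (j : ℂ) ≠ 0 := by exact_mod_cast hj.ne'
    refine (h.congr_deriv ?_).congr_of_eventuallyEq (Eventually.of_forall fun s => ?_)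
    · simp only [cpow_zero]; field_simp; ring
    · simp [polarPrimitive, hj.ne']

theorem hasLogExpansionAt_polarPrimitive (c : ℝ) (j : ℕ) : HasLogExpansionAt (polarPrimitive c j) c := by
  rcases Nat.eq_zero_or_pos j with rfl | hj
  · exact ⟨1, 0, by simp [polarPrimitive]⟩
  · refine ⟨0, Polynomial.C (-(1 / (j : ℂ))) * Polynomial.X ^ j, ?_⟩
    simp [polarPrimitive, hj.ne']

/-- For large `Re u`, `|t - c|^u (t - c)^(-j) / (u - j)` is a primitive across `c`, so the integral
is an explicit meromorphic function of `u`. At `u = 0` it is regular: for `j > 0` the denominator is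
nonzero, and for `j = 0` the numerator vanishes and the limit is its derivative, a difference of
logarithms. -/
theorem hasRegularFinitePart_inv_pow {a b c : ℝ} (hac : a < c) (hcb : c < b) (j : ℕ) :
    HasRegularFinitePart (fun t => (((t - c : ℝ) : ℂ)⁻¹) ^ (j + 1)) a b c
      (polarPrimitive c j b - polarPrimitive c j a) := by
  have hab : a ≤ b := (hac.trans hcb).le
  have hb : b - c ≠ 0 := by linarith
  have ha : a - c ≠ 0 := by linarith
  set B : ℂ → ℂ := fun u => exp (u * Real.log (b - c)) * (((b - c : ℝ) : ℂ)⁻¹) ^ j with hB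
  set A : ℂ → ℂ := fun u => exp (u * Real.log (a - c)) * (((a - c : ℝ) : ℂ)⁻¹) ^ j with hA
  have hdiff : Differentiable ℂ fun u => B u - A u := by fun_prop
  refine ⟨j + 1, fun u => (B u - A u) / (u - j), ?_, fun u hu => ?_, ?_⟩
  · exact fun u _ => (hdiff.analyticAt u).meromorphicAt.div (by fun_prop : AnalyticAt ℂ (fun u : ℂ => u - j) u).meromorphicAt
  · have hcont := continuous_abs_cpow_mul_inv_pow c (u := u) (n := j + 1) (by push_cast; linarith)
    refine ⟨hcont.continuousOn.integrableOn_Icc, ?_⟩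
    have hju : u - j ≠ 0 := by
      intro h0
      have := congrArg re h0
      simp only [sub_re, natCast_re, zero_re] at this
      linarith
    have hc' := continuous_abs_cpow_mul_inv_pow c (u := u) (n := j) (by linarith)
    have := MeasureTheory.integral_eq_of_hasDerivAt_off_countable
      (fun t : ℝ => ((|t - c| : ℝ) : ℂ) ^ u * (((t - c : ℝ) : ℂ)⁻¹) ^ j)
      (fun t : ℝ => (u - j) * (((|t - c| : ℝ) : ℂ) ^ u * (((t - c : ℝ) : ℂ)⁻¹) ^ (j + 1)))
      (a := a) (b := b) (countable_singleton c) hc'.continuousOn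
      (fun t ht => hasDerivAt_abs_cpow_mul_inv_pow (fun h => ht.2 h) u j)
      ((hcont.const_mul (u - j)).intervalIntegrable _ _)
    rw [intervalIntegral.integral_const_mul, abs_cpow_eq_exp hb, abs_cpow_eq_exp ha] at this
    simp only [hA, hB]
    rw [← this, mul_div_cancel_left₀ _ hju]
  · rcases Nat.eq_zero_or_pos j with rfl | hj
    · have hB' : HasDerivAt (fun u : ℂ => exp (u * Real.log (b - c)) - exp (u * Real.log (a - c)))
          ((Real.log (b - c) : ℂ) - Real.log (a - c)) 0 := by
        have := ((hasDerivAt_id (0 : ℂ)).mul_const (Real.log (b - c) : ℂ)).cexp.sub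
          ((hasDerivAt_id (0 : ℂ)).mul_const (Real.log (a - c) : ℂ)).cexp
        exact this.congr_deriv (by simp)
      have := hasDerivAt_iff_tendsto_slope_zero.1 hB'
      simp only [polarPrimitive, if_true]
      refine this.congr fun u => ?_
      simp only [zero_add, zero_mul, Complex.exp_zero, sub_self, sub_zero, smul_eq_mul, hA, hB,
        pow_zero, mul_one, Nat.cast_zero]
      rw [div_eq_inv_mul]
    · have hj0 : (j : ℂ) ≠ 0 := by exact_mod_cast hj.ne'
      have hc : ContinuousAt (fun u : ℂ => (B u - A u) / (u - j)) 0 :=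
        hdiff.continuous.continuousAt.div (by fun_prop) (by simpa using hj.ne')
      have h1 := hc.tendsto.mono_left (nhdsWithin_le_nhds (s := {(0 : ℂ)}ᶜ))
      convert h1 using 2
      simp only [polarPrimitive, hj.ne', if_false, hA, hB, zero_mul, Complex.exp_zero, one_mul, zero_sub]
      field_simp
      ring

/-- The regularized integral around a pole is the difference of the values of a primitive with a
logarithmic singularity. -/
theorem IsLogPrimitive.hasFinitePartIntegral {g P : ℝ → ℂ} {S : Finset ℝ} {a b c : ℝ}
    (hP : IsLogPrimitive g P S) (ha0 : 0 < a) (hac : a < c) (hcb : c < b) (hg : MeromorphicAt g c)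
    (hgc : ContinuousOn g (Icc a b \ {c})) (hS : ∀ t ∈ Icc a b, t ≠ c → t ∉ S) :
    HasFinitePartIntegral g a b c (P b - P a) := by
  have hab : a < b := hac.trans hcb
  obtain ⟨Q, h, hh, heq⟩ := exists_principalPart hg
  classical
  -- `g` minus its principal part, filled in continuously at `c`. Its primitive `K` together with
  -- the explicit primitives `p` of the polar terms gives the finite part; `P` can differ from `K +
  -- p` only by a constant, the same on both sides of `c`.
  set k : ℝ → ℂ := fun t => if t = c then h c else g t - Q.eval (((t - c : ℝ) : ℂ)⁻¹) with hk
  have hkc : ∀ t ∈ Icc a b, ContinuousWithinAt k (Icc a b) t := by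
    intro t ht
    by_cases htc : t = c
    · subst htc
      refine (hh.continuousAt.congr ?_).continuousWithinAt
      have : ∀ᶠ s in 𝓝 t, s ≠ t → g s = h s + Q.eval (((s - t : ℝ) : ℂ)⁻¹) :=
        eventually_nhdsWithin_iff.1 heq
      filter_upwards [this] with s hs
      by_cases hst : s = t
      · simp [hk, hst]
      · simp only [hk, if_neg hst, hs hst]; ring
    · have h1 : ContinuousWithinAt (fun t => g t - Q.eval (((t - c : ℝ) : ℂ)⁻¹)) (Icc a b) t := by
        refine ContinuousWithinAt.sub ?_ ?_
        · have h2 := hgc t ⟨ht, htc⟩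
          refine h2.mono_of_mem_nhdsWithin ?_
          exact inter_mem self_mem_nhdsWithin (mem_nhdsWithin_of_mem_nhds (isOpen_ne.mem_nhds htc))
        · refine ContinuousAt.continuousWithinAt ?_
          refine Q.continuous.continuousAt.comp (ContinuousAt.inv₀ (by fun_prop) ?_)
          exact ofReal_ne_zero.2 (sub_ne_zero.2 htc)
      refine h1.congr_of_eventuallyEq ?_ (by simp [hk, htc])
      filter_upwards [mem_nhdsWithin_of_mem_nhds (isOpen_ne.mem_nhds htc)] with s hs
      simp only [hk]; rw [if_neg hs]
  have hkcont : ContinuousOn k (Icc a b) := hkc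
  set N := Q.natDegree
  have hQ : ∀ y : ℂ, Q.eval y = (∑ j ∈ Finset.range N, Q.coeff (j + 1) * y ^ (j + 1)) + Q.coeff 0 := by
    intro y
    rw [Polynomial.eval_eq_sum_range, Finset.sum_range_succ', pow_zero, mul_one]
  set K : ℝ → ℂ := fun t => ∫ s in a..t, k s + Q.coeff 0 with hK
  have hkc0 : ContinuousOn (fun t => k t + Q.coeff 0) (Icc a b) := hkcont.add continuousOn_const
  have hKc : ContinuousOn K (Icc a b) := by
    have := intervalIntegral.continuousOn_primitive_interval (f := fun t => k t + Q.coeff 0) (μ := volume)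
      (a := a) (b := b) (by rw [uIcc_of_le hab.le]; exact hkc0.integrableOn_Icc)
    rwa [uIcc_of_le hab.le] at this
  have hKd : ∀ t ∈ Ioo a b, HasDerivAt K (k t + Q.coeff 0) t := by
    intro t ht
    have hnhds : Icc a b ∈ 𝓝 t := Icc_mem_nhds ht.1 ht.2
    refine intervalIntegral.integral_hasDerivAt_right ?_ ?_ (hkc0.continuousAt hnhds)
    · exact (hkc0.mono (by rw [uIcc_of_le ht.1.le]; exact Icc_subset_Icc_right ht.2.le)).intervalIntegrable
    · exact hkc0.stronglyMeasurableAtFilter_nhdsWithin measurableSet_Icc t |>.filter_mono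
        (by rw [nhdsWithin_eq_nhds.2 hnhds])
  set p : ℝ → ℂ := fun t => ∑ j ∈ Finset.range N, Q.coeff (j + 1) * polarPrimitive c j t with hp
  have hpd : ∀ t, t ≠ c → HasDerivAt p (∑ j ∈ Finset.range N, Q.coeff (j + 1) *
      (((t - c : ℝ) : ℂ)⁻¹) ^ (j + 1)) t := fun t ht =>
    HasDerivAt.fun_sum fun j _ => (hasDerivAt_polarPrimitive ht j).const_mul _
  have hpe : HasLogExpansionAt p c := by
    have : ∀ s : Finset ℕ, HasLogExpansionAt
        (fun t => ∑ j ∈ s, Q.coeff (j + 1) * polarPrimitive c j t) c := by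
      intro s
      induction s using Finset.induction_on with
      | empty => simpa using HasLogExpansionAt.of_continuousAt continuousAt_const
      | insert x s hx ih =>
        simp only [Finset.sum_insert hx]
        exact ((hasLogExpansionAt_polarPrimitive c x).const_mul _).add ih
    exact this _
  have hFP : HasRegularFinitePart g a b c (K b + (p b - p a)) := by
    have h1 := (hasRegularFinitePart_of_continuousOn (c := c) hab.le hkc0).add hab.le
      (HasRegularFinitePart.sum (s := Finset.range N) hab.le fun j _ =>
        (hasRegularFinitePart_inv_pow hac hcb j).const_mul (Q.coeff (j + 1)))
    simp only [hK, hp]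
    rw [← Finset.sum_sub_distrib]
    simp only [← mul_sub]
    refine h1.congr (fun t _ htc => ?_) hab.le
    simp only [hk, if_neg htc, hQ]
    ring
  -- comparison of the two primitives
  set D : ℝ → ℂ := fun t => P t + (-1) * (K t + p t) with hD
  have hDd : ∀ t ∈ Ioo a b, t ≠ c → HasDerivAt D 0 t := by
    intro t ht htc
    have h1 := hP.hasDerivAt t (ha0.trans ht.1) (hS t (Ioo_subset_Icc_self ht) htc)
    refine (h1.add (((hKd t ht).add (hpd t htc)).const_mul (-1))).congr_deriv ?_
    simp only [hk, if_neg htc, hQ]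
    ring
  have hDc : ∀ t ∈ Icc a b, t ≠ c → ContinuousWithinAt D (Icc a b) t := by
    intro t ht htc
    have h1 := (hP.hasDerivAt t (ha0.trans_le ht.1) (hS t ht htc)).continuousAt.continuousWithinAt (s := Icc a b)
    exact h1.add (((hKc t ht).add (hpd t htc).continuousAt.continuousWithinAt).const_mul (-1))
  have hDe : HasLogExpansionAt D c := by
    have h1 := (hP.mono (Finset.subset_insert c S)).expansion c (ha0.trans hac) (by simp)
    have h2 : HasLogExpansionAt K c := .of_continuousAt (hKd c ⟨hac, hcb⟩).continuousAt
    exact h1.add ((h2.add hpe).const_mul (-1))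
  obtain ⟨d, hd⟩ := eventually_const_of_hasDerivAt_zero hcb (D := D)
    fun t ht => hDd t ⟨hac.trans ht.1, ht.2⟩ ht.1.ne'
  obtain ⟨d', hd'⟩ := eventually_const_of_hasDerivAt_zero hac (D := D)
    fun t ht => hDd t ⟨ht.1, ht.2.trans hcb⟩ ht.2.ne
  have hdd := hDe.eq_of_eventually_const (d := d) (d' := d')
    (by filter_upwards [Ioo_mem_nhdsGT hcb] with t ht using hd t ht)
    (by filter_upwards [Ioo_mem_nhdsLT hac] with t ht using hd' t ht)
  have hDb : D b = d := by
    have h1 := (hDc b ⟨hab.le, le_rfl⟩ hcb.ne').tendsto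
    have h2 : Tendsto D (𝓝[<] b) (𝓝 (D b)) := h1.mono_left
      (nhdsWithin_le_of_mem (mem_of_superset (Ioo_mem_nhdsLT hab) Ioo_subset_Icc_self))
    refine tendsto_nhds_unique h2 (tendsto_const_nhds.congr' ?_)
    filter_upwards [Ioo_mem_nhdsLT hcb] with t ht using (hd t ht).symm
  have hDa : D a = d' := by
    have h1 := (hDc a ⟨le_rfl, hab.le⟩ hac.ne).tendsto
    have h2 : Tendsto D (𝓝[>] a) (𝓝 (D a)) := h1.mono_left
      (nhdsWithin_le_of_mem (mem_of_superset (Ioo_mem_nhdsGT hab) Ioo_subset_Icc_self))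
    refine tendsto_nhds_unique h2 (tendsto_const_nhds.congr' ?_)
    filter_upwards [Ioo_mem_nhdsGT hac] with t ht using (hd' t ht).symm
  have hKa : K a = 0 := by simp [hK]
  have : P b - P a = K b + (p b - p a) := by
    have h1 : D b = D a := by rw [hDb, hDa, hdd]
    simp only [hD, hKa] at h1
    linear_combination h1
  rw [this]
  exact hFP.hasFinitePartIntegral

/-! ### Holomorphic families of primitives -/

theorem continuousOn_ofReal_cpow (z : ℂ) : ContinuousOn (fun t : ℝ => (t : ℂ) ^ z) (Ioi 0) :=
  ContinuousOn.cpow (by fun_prop) continuousOn_const fun _ ht => ofReal_mem_slitPlane.2 ht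

theorem uIcc_subset_Ioi {a b : ℝ} (ha : 0 < a) (hb : 0 < b) : uIcc a b ⊆ Ioi 0 := fun _ hx =>
  (lt_min ha hb).trans_le hx.1

theorem intervalIntegrable_mul_cpow {φ : ℝ → ℂ} {a b : ℝ} (ha : 0 < a) (hb : 0 < b)
    (hφ : IntervalIntegrable φ volume a b) (z : ℂ) :
    IntervalIntegrable (fun x => φ x * (x : ℂ) ^ z) volume a b :=
  hφ.mul_continuousOn ((continuousOn_ofReal_cpow z).mono (uIcc_subset_Ioi ha hb))

theorem differentiable_intervalIntegral_mul_cpow {φ : ℝ → ℂ} {a b : ℝ} (ha : 0 < a) (hb : 0 < b)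
    (hφ : IntervalIntegrable φ volume a b) :
    Differentiable ℂ (fun s : ℂ => ∫ x in a..b, φ x * (x : ℂ) ^ (s - 1)) := by
  have e : ∀ (s : ℂ) (x : ℝ), 0 < x → φ x * (x : ℂ) ^ (s - 1) =
      exp (s * Real.log x) * (φ x * (x : ℂ) ^ (-1 : ℂ)) := by
    intro s x hx
    have hx0 : (x : ℂ) ≠ 0 := ofReal_ne_zero.2 hx.ne'
    have h1 : exp (s * Real.log x) = (x : ℂ) ^ s := by
      rw [cpow_def_of_ne_zero hx0, ofReal_log hx.le, mul_comm]
    rw [h1, sub_eq_add_neg, cpow_add _ _ hx0]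
    ring
  have key : ∀ {a b : ℝ}, 0 < a → IntegrableOn φ (Ioc a b) →
      Differentiable ℂ (fun s : ℂ => ∫ x in Ioc a b, φ x * (x : ℂ) ^ (s - 1)) := by
    intro a b ha hφ s
    have hsub : Ioc a b ⊆ Ioi 0 := fun x hx => ha.trans hx.1
    have hφm := hφ.aestronglyMeasurable.mul
      (((continuousOn_ofReal_cpow (-1)).mono hsub).aestronglyMeasurable (μ := volume) measurableSet_Ioc)
    have := (hasDerivAt_integral_exp_mul (μ := volume.restrict (Ioc a b))
      (l := fun x : ℝ => ((Real.log x : ℝ) : ℂ)) (φ := fun x => φ x * (x : ℂ) ^ (-1 : ℂ))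
      (by have : Measurable fun x : ℝ => ((Real.log x : ℝ) : ℂ) := by fun_prop
          exact this.aestronglyMeasurable) hφm isOpen_univ (fun z _ => ?_) (mem_univ s)).2
    · refine this.differentiableAt.congr_of_eventuallyEq (Eventually.of_forall fun z => ?_)
      exact setIntegral_congr_fun measurableSet_Ioc fun x hx => e z x (hsub hx)
    · rcases le_or_gt a b with hab | hab
      · have h1 := intervalIntegrable_mul_cpow ha (ha.trans_le hab)
          ((intervalIntegrable_iff_integrableOn_Ioc_of_le hab).2 hφ) (z - 1)
        rw [intervalIntegrable_iff_integrableOn_Ioc_of_le hab] at h1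
        exact h1.congr_fun (fun x hx => e z x (hsub hx)) measurableSet_Ioc
      · simp [Ioc_eq_empty_of_le hab.le]
  simp only [intervalIntegral]
  exact (key ha hφ.1).sub (key hb hφ.2)

theorem hasDerivAt_ofReal_cpow_sub_one {t : ℝ} (ht : 0 < t) (s : ℂ) :
    HasDerivAt (fun t : ℝ => (t : ℂ) ^ (s - 1)) ((s - 1) * (t : ℂ) ^ (s - 1 - 1)) t := by
  have h1 := (hasDerivAt_id (t : ℂ)).cpow_const (c := s - 1) (ofReal_mem_slitPlane.2 ht)
  exact h1.comp_ofReal.congr_deriv (by simp)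

/-- `P s` is a primitive of `g(t) t ^ (s - 1)` with logarithmic singularities in `S`, and depends
holomorphically on `s`. -/
structure IsPrimitiveFamily (g : ℝ → ℂ) (P : ℂ → ℝ → ℂ) (S : Finset ℝ) : Prop where
  isLogPrimitive : ∀ s, IsLogPrimitive (fun t => g t * (t : ℂ) ^ (s - 1)) (P s) S
  differentiable : ∀ t, 0 < t → t ∉ S → Differentiable ℂ fun s => P s t

namespace IsPrimitiveFamily

variable {g g' : ℝ → ℂ} {P P' : ℂ → ℝ → ℂ} {S S' : Finset ℝ}

theorem mono (h : IsPrimitiveFamily g P S) (hS : S ⊆ S') : IsPrimitiveFamily g P S' where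
  isLogPrimitive s := (h.isLogPrimitive s).mono hS
  differentiable t ht hn := h.differentiable t ht fun hm => hn (hS hm)

theorem congr (h : IsPrimitiveFamily g P S) (hg : ∀ t, 0 < t → t ∉ S → g t = g' t) :
    IsPrimitiveFamily g' P S where
  isLogPrimitive s := (h.isLogPrimitive s).congr fun t ht hn => by rw [hg t ht hn]
  differentiable := h.differentiable

theorem add (h : IsPrimitiveFamily g P S) (h' : IsPrimitiveFamily g' P' S) :
    IsPrimitiveFamily (fun t => g t + g' t) (fun s t => P s t + P' s t) S where
  isLogPrimitive s := by
    simp only [add_mul]; exact (h.isLogPrimitive s).add (h'.isLogPrimitive s)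
  differentiable t ht hn := (h.differentiable t ht hn).add (h'.differentiable t ht hn)

theorem const_mul (h : IsPrimitiveFamily g P S) (b : ℂ) :
    IsPrimitiveFamily (fun t => b * g t) (fun s t => b * P s t) S where
  isLogPrimitive s := by
    simp only [mul_assoc]; exact (h.isLogPrimitive s).const_mul b
  differentiable t ht hn := (h.differentiable t ht hn).const_mul b

theorem zero (S : Finset ℝ) : IsPrimitiveFamily (fun _ => 0) (fun _ _ => 0) S where
  isLogPrimitive s := by simpa using IsLogPrimitive.zero S
  differentiable _ _ _ := differentiable_const _

theorem sum {ι : Type*} {g : ι → ℝ → ℂ} {P : ι → ℂ → ℝ → ℂ} {s : Finset ι}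
    (h : ∀ i ∈ s, IsPrimitiveFamily (g i) (P i) S) :
    IsPrimitiveFamily (fun t => ∑ i ∈ s, g i t) (fun z t => ∑ i ∈ s, P i z t) S := by
  classical
  induction s using Finset.induction_on with
  | empty => simpa using zero S
  | insert a s ha ih =>
    simp only [Finset.sum_insert ha]
    exact (h a (by simp)).add (ih fun i hi => h i (by simp [hi]))

end IsPrimitiveFamily

theorem isPrimitiveFamily_of_continuousOn {g : ℝ → ℂ} (hg : ContinuousOn g (Ioi 0)) :
    IsPrimitiveFamily g (fun s t => ∫ x in (1 : ℝ)..t, g x * (x : ℂ) ^ (s - 1)) ∅ where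
  isLogPrimitive s :=
    { hasDerivAt := fun t ht _ => by
        have hc : ContinuousOn (fun x : ℝ => g x * (x : ℂ) ^ (s - 1)) (Ioi 0) :=
          hg.mul (continuousOn_ofReal_cpow _)
        exact intervalIntegral.integral_hasDerivAt_right
          (hc.mono (uIcc_subset_Ioi one_pos ht)).intervalIntegrable
          (hc.stronglyMeasurableAtFilter isOpen_Ioi t ht) (hc.continuousAt (Ioi_mem_nhds ht))
      expansion := by simp }
  differentiable t ht _ := differentiable_intervalIntegral_mul_cpow one_pos ht
    (hg.mono (uIcc_subset_Ioi one_pos ht)).intervalIntegrable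

theorem intervalIntegrable_log_sub (c a b : ℝ) :
    IntervalIntegrable (fun x : ℝ => ((Real.log (x - c) : ℝ) : ℂ)) volume a b := by
  have h : IntervalIntegrable Real.log volume (a - c) (b - c) := intervalIntegral.intervalIntegrable_log'
  have := h.comp_sub_right c
  simp only [sub_add_cancel] at this
  exact ⟨this.1.ofReal, this.2.ofReal⟩

/-- Integration by parts against `log |t - c|`: the remaining integrand is integrable through `c`,
so its integral may start at `c` and is continuous there. -/
theorem exists_primitiveFamily_inv {c : ℝ} (hc : 0 < c) :
    ∃ P, IsPrimitiveFamily (fun t => (((t - c : ℝ) : ℂ)⁻¹)) P {c} := by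
  have hint : ∀ (s : ℂ) {a b : ℝ}, 0 < a → 0 < b →
      IntervalIntegrable (fun x : ℝ => ((Real.log (x - c) : ℝ) : ℂ) * (x : ℂ) ^ (s - 1)) volume a b :=
    fun s a b ha hb => intervalIntegrable_mul_cpow ha hb (intervalIntegrable_log_sub c a b) _
  refine ⟨fun s t => ((Real.log (t - c) : ℝ) : ℂ) * (t : ℂ) ^ (s - 1) +
    (-(s - 1)) * ∫ x in c..t, ((Real.log (x - c) : ℝ) : ℂ) * (x : ℂ) ^ ((s - 1) - 1), fun s => ?_, ?_⟩
  · constructor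
    · intro t ht htc
      have htc : t ≠ c := by simpa using htc
      have hne : t - c ≠ 0 := sub_ne_zero.2 htc
      have h1 : HasDerivAt (fun t : ℝ => ((Real.log (t - c) : ℝ) : ℂ)) (((t - c : ℝ) : ℂ)⁻¹) t := by
        have := ((Real.hasDerivAt_log hne).comp t ((hasDerivAt_id t).sub_const c)).ofReal_comp
        exact this.congr_deriv (by simp)
      have h2 : HasDerivAt (fun t : ℝ => ∫ x in c..t, ((Real.log (x - c) : ℝ) : ℂ) * (x : ℂ) ^ ((s - 1) - 1))
          (((Real.log (t - c) : ℝ) : ℂ) * (t : ℂ) ^ ((s - 1) - 1)) t := by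
        refine intervalIntegral.integral_hasDerivAt_right (hint (s - 1) hc ht) ?_ ?_
        · refine ContinuousOn.stronglyMeasurableAtFilter (s := Ioi 0 ∩ {c}ᶜ)
            (isOpen_Ioi.inter isOpen_compl_singleton) ?_ t ⟨ht, htc⟩
          refine ContinuousOn.mul ?_ ((continuousOn_ofReal_cpow _).mono inter_subset_left)
          refine continuous_ofReal.comp_continuousOn (ContinuousOn.log (by fun_prop) fun x hx => ?_)
          exact sub_ne_zero.2 hx.2
        · refine ContinuousAt.mul h1.continuousAt ?_
          exact (continuousOn_ofReal_cpow _).continuousAt (Ioi_mem_nhds ht)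
      refine ((h1.mul (hasDerivAt_ofReal_cpow_sub_one ht s)).add (h2.const_mul (-(s - 1)))).congr_deriv ?_
      ring
    · intro x hx hxc
      obtain rfl : x = c := by simpa using hxc
      refine HasLogExpansionAt.add ?_ (HasLogExpansionAt.const_mul (.of_continuousAt ?_) _)
      -- The error is `(t - x) log |t - x|` times a difference quotient of `t^(s-1)`.
      · refine ⟨(x : ℂ) ^ (s - 1), 0, ?_⟩
        have h1 := (hasDerivAt_ofReal_cpow_sub_one hx s).tendsto_slope
        have h2 : Tendsto (fun t : ℝ => (((t - x) * Real.log (t - x) : ℝ) : ℂ)) (𝓝[≠] x) (𝓝 0) := by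
          have : Continuous fun t : ℝ => (((t - x) * Real.log (t - x) : ℝ) : ℂ) :=
            continuous_ofReal.comp (Real.continuous_mul_log.comp (by fun_prop))
          simpa using (this.tendsto x).mono_left (nhdsWithin_le_nhds (s := {x}ᶜ))
        have h3 := h2.mul h1
        rw [zero_mul] at h3
        refine h3.congr' ?_
        filter_upwards [self_mem_nhdsWithin] with t ht
        have hne : ((t - x : ℝ) : ℂ) ≠ 0 := ofReal_ne_zero.2 (sub_ne_zero.2 ht)
        rw [slope_def_module, real_smul, ofReal_inv, ofReal_mul, Polynomial.eval_zero, sub_zero]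
        field_simp
      · have h1 : IntegrableOn (fun y : ℝ => ((Real.log (y - x) : ℝ) : ℂ) * (y : ℂ) ^ ((s - 1) - 1))
            (uIcc (x / 2) (x + 1)) := by
          rw [uIcc_of_le (by linarith), ← intervalIntegrable_iff_integrableOn_Icc_of_le (by linarith)]
          exact hint (s - 1) (by positivity) (by positivity)
        have h2 := intervalIntegral.continuousOn_primitive_interval' (a := x) (b₁ := x / 2) (b₂ := x + 1)
          (μ := volume) (hint (s - 1) (by positivity) (by positivity))
          (by rw [uIcc_of_le (by linarith)]; constructor <;> linarith)
        refine h2.continuousAt ?_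
        rw [uIcc_of_le (by linarith)]
        exact Icc_mem_nhds (by linarith) (by linarith)
  · intro t ht _
    have h1 := differentiable_intervalIntegral_mul_cpow hc ht (intervalIntegrable_log_sub c c t)
    refine Differentiable.add ?_ (Differentiable.mul (by fun_prop) (h1.comp (by fun_prop : Differentiable ℂ fun s : ℂ => s - 1)))
    refine Differentiable.const_mul ?_ _
    exact Differentiable.const_cpow (by fun_prop) (Or.inl (ofReal_ne_zero.2 ht.ne'))

/-- Integration by parts lowers the order of the pole by one and replaces `s` by `s - 1`. -/
theorem exists_primitiveFamily_inv_pow {c : ℝ} (hc : 0 < c) (j : ℕ) :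
    ∃ P, IsPrimitiveFamily (fun t => (((t - c : ℝ) : ℂ)⁻¹) ^ (j + 1)) P {c} := by
  induction j with
  | zero => simpa using exists_primitiveFamily_inv hc
  | succ j ih =>
    obtain ⟨P, hP⟩ := ih
    have hj : ((j + 1 : ℕ) : ℂ) ≠ 0 := by exact_mod_cast Nat.succ_ne_zero j
    refine ⟨fun s t => polarPrimitive c (j + 1) t * (t : ℂ) ^ (s - 1) +
      ((s - 1) / (j + 1 : ℕ)) * P (s - 1) t, fun s => ⟨fun t ht htc => ?_, fun x hx hxc => ?_⟩,
      fun t ht htc => ?_⟩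
    · have htc' : t ≠ c := by simpa using htc
      have h1 := (hasDerivAt_polarPrimitive htc' (j + 1)).mul (hasDerivAt_ofReal_cpow_sub_one ht s)
      have h2 := ((hP.isLogPrimitive (s - 1)).hasDerivAt t ht htc).const_mul ((s - 1) / (j + 1 : ℕ))
      refine (h1.add h2).congr_deriv ?_
      simp only [polarPrimitive, if_neg (Nat.succ_ne_zero j)]
      field_simp
      ring
    · obtain rfl : x = c := by simpa using hxc
      refine HasLogExpansionAt.add ?_ (((hP.isLogPrimitive (s - 1)).expansion x hx hxc).const_mul _)
      refine .of_meromorphicAt (MeromorphicAt.mul ?_ ?_)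
      · have : polarPrimitive x (j + 1) = fun t => -(1 / ((j + 1 : ℕ) : ℂ)) * (((t - x : ℝ) : ℂ)⁻¹) ^ (j + 1) := by
          funext t; simp [polarPrimitive]
        rw [this]
        have h1 : AnalyticAt ℝ (fun t : ℝ => ((t - x : ℝ) : ℂ)) x :=
          (Complex.ofRealCLM.analyticAt _).comp (by fun_prop : AnalyticAt ℝ (fun t : ℝ => t - x) x)
        exact (MeromorphicAt.const _ _).mul (h1.meromorphicAt.inv.pow _)
      · refine AnalyticAt.meromorphicAt ?_
        have h1 : AnalyticAt ℂ (fun z : ℂ => z ^ (s - 1)) (x : ℂ) :=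
          analyticAt_id.cpow analyticAt_const (ofReal_mem_slitPlane.2 hx)
        exact (h1.restrictScalars (𝕜 := ℝ)).comp (Complex.ofRealCLM.analyticAt x)
    · refine Differentiable.add (Differentiable.const_mul ?_ _) (Differentiable.mul (by fun_prop)
        ((hP.differentiable t ht htc).comp (by fun_prop : Differentiable ℂ fun s : ℂ => s - 1)))
      exact Differentiable.const_cpow (by fun_prop) (Or.inl (ofReal_ne_zero.2 ht.ne'))

/-- The polar terms at one point of `S` at a time are removed and integrated explicitly, until a
continuous function remains. -/
theorem exists_primitiveFamily {g : ℝ → ℂ} {S : Finset ℝ} (hS : ∀ c ∈ S, 0 < c)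
    (hm : ∀ c ∈ S, MeromorphicAt g c) (hc : ContinuousOn g (Ioi 0 \ S)) :
    ∃ P, IsPrimitiveFamily g P S := by
  classical
  induction S using Finset.induction_on generalizing g with
  | empty => exact ⟨_, isPrimitiveFamily_of_continuousOn (by simpa using hc)⟩
  | insert c S hcS ih =>
    have hc0 : 0 < c := hS c (by simp)
    obtain ⟨Q, h, hh, heq⟩ := exists_principalPart (hm c (by simp))
    set k : ℝ → ℂ := fun t => if t = c then h c + Q.coeff 0 else
      g t - ∑ j ∈ Finset.range Q.natDegree, Q.coeff (j + 1) * (((t - c : ℝ) : ℂ)⁻¹) ^ (j + 1) with hk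
    have hQ : ∀ y : ℂ, Q.eval y =
        (∑ j ∈ Finset.range Q.natDegree, Q.coeff (j + 1) * y ^ (j + 1)) + Q.coeff 0 := by
      intro y
      rw [Polynomial.eval_eq_sum_range, Finset.sum_range_succ', pow_zero, mul_one]
    have hkne : ∀ t, t ≠ c → k =ᶠ[𝓝 t] fun t => g t - ∑ j ∈ Finset.range Q.natDegree,
        Q.coeff (j + 1) * (((t - c : ℝ) : ℂ)⁻¹) ^ (j + 1) := fun t ht => by
      filter_upwards [isOpen_ne.mem_nhds ht] with s hs
      simp only [hk]; rw [if_neg hs]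
    have hkm : ∀ x ∈ S, MeromorphicAt k x := by
      intro x hx
      have hxc : x ≠ c := fun h => hcS (h ▸ hx)
      refine MeromorphicAt.congr ?_ ((hkne x hxc).symm.filter_mono nhdsWithin_le_nhds)
      refine (hm x (by simp [hx])).sub (MeromorphicAt.fun_sum fun j _ => ?_)
      have h1 : AnalyticAt ℝ (fun t : ℝ => ((t - c : ℝ) : ℂ)) x :=
        (Complex.ofRealCLM.analyticAt _).comp (by fun_prop : AnalyticAt ℝ (fun t : ℝ => t - c) x)
      exact (MeromorphicAt.const _ _).mul (h1.meromorphicAt.inv.pow _)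
    have hkc : ContinuousOn k (Ioi 0 \ S) := by
      intro t ht
      by_cases htc : t = c
      · subst htc
        have h1 : ContinuousAt (fun s => h s + Q.coeff 0) t :=
          hh.continuousAt.add continuousAt_const
        refine (h1.congr ?_).continuousWithinAt
        have : ∀ᶠ s in 𝓝 t, s ≠ t → g s = h s + Q.eval (((s - t : ℝ) : ℂ)⁻¹) :=
          eventually_nhdsWithin_iff.1 heq
        filter_upwards [this] with s hs
        by_cases hst : s = t
        · simp [hk, hst]
        · simp only [hk, if_neg hst, hs hst, hQ]; ring
      · have hopen : IsOpen (Ioi (0 : ℝ) \ ((insert c S : Finset ℝ) : Set ℝ)) :=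
          isOpen_Ioi.sdiff (Finset.finite_toSet _).isClosed
        have htS : t ∈ Ioi (0 : ℝ) \ ((insert c S : Finset ℝ) : Set ℝ) :=
          ⟨ht.1, by simpa [htc] using ht.2⟩
        refine ContinuousAt.continuousWithinAt (ContinuousAt.congr ?_ (hkne t htc).symm)
        refine (hc.continuousAt (hopen.mem_nhds htS)).sub (tendsto_finsetSum _ fun j _ => ?_)
        refine ContinuousAt.mul continuousAt_const (ContinuousAt.pow (ContinuousAt.inv₀ (by fun_prop) ?_) _)
        exact ofReal_ne_zero.2 (sub_ne_zero.2 htc)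
    obtain ⟨P, hP⟩ := ih (fun x hx => hS x (by simp [hx])) hkm hkc
    choose R hR using fun j => exists_primitiveFamily_inv_pow hc0 j
    refine ⟨_, ((hP.mono (Finset.subset_insert c S)).add (IsPrimitiveFamily.sum (s := Finset.range Q.natDegree)
      fun j _ => ((hR j).const_mul (Q.coeff (j + 1))).mono
        (Finset.singleton_subset_iff.2 (Finset.mem_insert_self c S)))).congr fun t _ ht => ?_⟩
    have htc : t ≠ c := fun h => ht (by simp [h])
    simp only [hk, if_neg htc]
    ring

/-! ### Restriction to the imaginary axis -/

theorem analyticAt_I_mul_ofReal (t : ℝ) : AnalyticAt ℝ (fun t : ℝ => I * (t : ℂ)) t :=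
  analyticAt_const.mul (Complex.ofRealCLM.analyticAt _)

theorem _root_.AnalyticAt.comp_I_mul {f : ℂ → ℂ} {t : ℝ} (h : AnalyticAt ℂ f (I * t)) :
    AnalyticAt ℝ (fun t : ℝ => f (I * t)) t :=
  AnalyticAt.comp (f := fun t : ℝ => I * (t : ℂ)) (x := t) h.restrictScalars
    (analyticAt_I_mul_ofReal t)

theorem _root_.MeromorphicAt.comp_I_mul {f : ℂ → ℂ} {t : ℝ} (h : MeromorphicAt f (I * t)) :
    MeromorphicAt (fun t : ℝ => f (I * t)) t := by
  obtain ⟨n, hn⟩ := h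
  refine ⟨n, ?_⟩
  have h1 := (analyticAt_const (𝕜 := ℝ) (v := (I ^ n)⁻¹) (x := t)).mul hn.comp_I_mul
  refine h1.congr (Eventually.of_forall fun x => ?_)
  have hI : (I : ℂ) ^ n ≠ 0 := pow_ne_zero _ I_ne_zero
  simp only [Pi.mul_apply, smul_eq_mul, ← mul_sub, mul_pow, real_smul, ofReal_pow, ofReal_sub]
  field_simp

theorem tendsto_I_mul_nhdsNE (t : ℝ) :
    Tendsto (fun t : ℝ => I * (t : ℂ)) (𝓝[≠] t) (𝓝[≠] (I * t)) := by
  refine tendsto_nhdsWithin_of_tendsto_nhds_of_eventually_within _ ?_ ?_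
  · exact ((by fun_prop : Continuous fun t : ℝ => I * (t : ℂ)).tendsto t).mono_left nhdsWithin_le_nhds
  · filter_upwards [self_mem_nhdsWithin] with x hx
    simpa [I_ne_zero] using hx

/-- In normal form a non-analytic point is a pole, so `f` tends to infinity there, in particular
along the imaginary axis. -/
theorem meromorphicOrderAt_comp_I_mul_neg {f : ℂ → ℂ} {t : ℝ} (h : MeromorphicNFAt f (I * t))
    (hf : ¬ AnalyticAt ℂ f (I * t)) : meromorphicOrderAt (fun t : ℝ => f (I * t)) t < 0 := by
  rw [← tendsto_cobounded_iff_meromorphicOrderAt_neg h.meromorphicAt.comp_I_mul]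
  have h1 : meromorphicOrderAt f (I * t) < 0 := by
    rwa [← not_le, h.meromorphicOrderAt_nonneg_iff_analyticAt]
  exact ((tendsto_cobounded_iff_meromorphicOrderAt_neg h.meromorphicAt).2 h1).comp
    (tendsto_I_mul_nhdsNE t)

theorem analyticAt_of_tendsto {f : ℂ → ℂ} {t : ℝ} {v : ℂ} (h : MeromorphicNFAt f (I * t))
    (hv : Tendsto (fun t : ℝ => f (I * t)) (𝓝[≠] t) (𝓝 v)) : AnalyticAt ℂ f (I * t) := by
  by_contra hf
  have h1 := meromorphicOrderAt_comp_I_mul_neg h hf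
  have h2 := (tendsto_nhds_iff_meromorphicOrderAt_nonneg h.meromorphicAt.comp_I_mul).1 ⟨v, hv⟩
  exact absurd h1 (not_lt.2 h2)

theorem analyticAt_ofReal_cpow {t : ℝ} (ht : 0 < t) (z : ℂ) :
    AnalyticAt ℝ (fun t : ℝ => (t : ℂ) ^ z) t := by
  have : AnalyticAt ℂ (fun w : ℂ => w ^ z) (t : ℂ) :=
    analyticAt_id.cpow analyticAt_const (ofReal_mem_slitPlane.2 ht)
  exact AnalyticAt.comp (f := fun t : ℝ => (t : ℂ)) (x := t) this.restrictScalars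
    (Complex.ofRealCLM.analyticAt _)

theorem meromorphicAt_mellinIntegrand {f : ℂ → ℂ} {t : ℝ} (ht : 0 < t)
    (h : MeromorphicAt f (I * t)) (s : ℂ) : MeromorphicAt (mellinIntegrand f s) t :=
  h.comp_I_mul.mul (analyticAt_ofReal_cpow ht _).meromorphicAt

theorem meromorphicOrderAt_mellinIntegrand {f : ℂ → ℂ} {t : ℝ} (ht : 0 < t)
    (h : MeromorphicAt f (I * t)) (s : ℂ) : meromorphicOrderAt (mellinIntegrand f s) t =
      meromorphicOrderAt (fun t : ℝ => f (I * t)) t := by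
  have h1 := analyticAt_ofReal_cpow ht (s - 1)
  have h2 : meromorphicOrderAt (fun t : ℝ => (t : ℂ) ^ (s - 1)) t = 0 := by
    have h3 : (t : ℂ) ^ (s - 1) ≠ 0 := by
      rw [Ne, cpow_eq_zero_iff]; exact fun h => ht.ne' (ofReal_eq_zero.1 h.1)
    rw [h1.meromorphicOrderAt_eq, h1.analyticOrderAt_eq_zero.2 h3]; rfl
  have := meromorphicOrderAt_mul h.comp_I_mul h1.meromorphicAt
  rw [h2, add_zero] at this
  exact this

/-! ### Splittings -/

/-- The bound `M` is part of the induction: applied with `M` equal to the new maximum, it places the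
previous last separating point below it. -/
theorem exists_separating (S : Finset ℝ) : ∀ M : ℝ, 0 < M → (∀ c ∈ S, 0 < c ∧ c < M) →
    ∃ (n : ℕ) (a : Fin (n + 1) → ℝ) (c : Fin n → ℝ), 0 < a 0 ∧ StrictMono a ∧
      (∀ j, c j ∈ Ioo (a j.castSucc) (a j.succ)) ∧ (∀ t, t ∈ S ↔ ∃ j, t = c j) ∧
      a (Fin.last n) < M := by
  classical
  induction S using Finset.induction_on_max with
  | empty =>
    intro M hM _
    exact ⟨0, fun _ => M / 2, Fin.elim0, by linarith, fun i j h => by have := i.2; have := j.2; rw [Fin.lt_def] at h; omega,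
      fun j => j.elim0, by simp, by linarith⟩
  | insert x S hx ih =>
    intro M hM hS
    have hx0 := hS x (by simp)
    obtain ⟨n, a, c, ha0, ha, hc, hSc, hl⟩ := ih x hx0.1 fun y hy => ⟨(hS y (by simp [hy])).1, hx y hy⟩
    refine ⟨n + 1, Fin.snoc a ((x + M) / 2), Fin.snoc c x, ?_, ?_, ?_, ?_, ?_⟩
    · rw [← Fin.castSucc_zero, Fin.snoc_castSucc]; exact ha0
    · rw [Fin.strictMono_iff_lt_succ]
      intro i
      induction i using Fin.lastCases with
      | last => rw [Fin.snoc_castSucc, Fin.succ_last, Fin.snoc_last]; linarith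
      | cast i =>
        rw [Fin.snoc_castSucc, ← Fin.castSucc_succ, Fin.snoc_castSucc]
        exact ha i.castSucc_lt_succ
    · intro j
      induction j using Fin.lastCases with
      | last =>
        rw [Fin.snoc_last, Fin.snoc_castSucc, Fin.succ_last, Fin.snoc_last]
        exact ⟨hl, by linarith⟩
      | cast j =>
        rw [Fin.snoc_castSucc, Fin.snoc_castSucc, ← Fin.castSucc_succ, Fin.snoc_castSucc]
        exact hc j
    · intro t
      rw [Finset.mem_insert, hSc, Fin.exists_fin_succ']
      simp only [Fin.snoc_castSucc, Fin.snoc_last]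
      tauto
    · rw [Fin.snoc_last]; linarith

namespace IsSplitting

variable {g : ℝ → ℂ} {n : ℕ} {a : Fin (n + 1) → ℝ} {c : Fin n → ℝ}

theorem pos_a (h : IsSplitting g a c) (i : Fin (n + 1)) : 0 < a i :=
  h.pos.trans_le (h.strictMono.monotone (Fin.zero_le i))

theorem pos_c (h : IsSplitting g a c) (j : Fin n) : 0 < c j := (h.pos_a _).trans (h.mem j).1

theorem lt_last (h : IsSplitting g a c) (j : Fin n) : c j < a (Fin.last n) :=
  (h.mem j).2.trans_le (h.strictMono.monotone (Fin.le_last _))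

theorem zero_lt (h : IsSplitting g a c) (j : Fin n) : a 0 < c j :=
  (h.strictMono.monotone (Fin.zero_le _)).trans_lt (h.mem j).1

theorem eq_of_mem_Icc (h : IsSplitting g a c) {i j : Fin n}
    (hi : c i ∈ Icc (a j.castSucc) (a j.succ)) : i = j := by
  rcases lt_trichotomy i j with hij | hij | hij
  · have : a i.succ ≤ a j.castSucc := h.strictMono.monotone (Fin.succ_le_castSucc_iff.2 hij)
    exact absurd ((h.mem i).2.trans_le (this.trans hi.1)) (lt_irrefl _)
  · exact hij
  · have : a j.succ ≤ a i.castSucc := h.strictMono.monotone (Fin.succ_le_castSucc_iff.2 hij)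
    exact absurd ((hi.2.trans this).trans_lt (h.mem i).1) (lt_irrefl _)

theorem a_ne (h : IsSplitting g a c) (i : Fin (n + 1)) (j : Fin n) : a i ≠ c j := by
  intro he
  rcases le_or_gt i j.castSucc with hi | hi
  · exact absurd ((h.strictMono.monotone hi).trans_lt (h.mem j).1) (by simp [he])
  · have := (h.mem j).2.trans_le (h.strictMono.monotone (Fin.castSucc_lt_iff_succ_le.1 hi))
    exact absurd this (by simp [he])

theorem eq_pole_iff (h : IsSplitting g a c) {t : ℝ} (ht : 0 < t) :
    (∃ j, t = c j) ↔ ¬ AnalyticAt ℝ g t := by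
  constructor
  · rintro ⟨j, rfl⟩ han
    exact absurd (h.pole j) (not_lt.2 han.meromorphicOrderAt_nonneg)
  · intro hn
    by_contra! hne
    exact hn (h.analytic t ht hne)

end IsSplitting

theorem eq_of_eventuallyEq_nhdsNE {X : Type*} [TopologicalSpace X] {g h : X → ℂ} {x : X}
    [(𝓝[≠] x).NeBot] (hg : ContinuousAt g x) (hh : ContinuousAt h x) (he : g =ᶠ[𝓝[≠] x] h) :
    g x = h x :=
  tendsto_nhds_unique (hg.mono_left nhdsWithin_le_nhds)
    ((hh.tendsto.mono_left nhdsWithin_le_nhds).congr' he.symm)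

/-- High up `f` is holomorphic by its Fourier expansion; near `0` the inversion formula provides
finite limits along the axis. The poles left lie in a compact interval and are isolated. -/
theorem finite_nonanalytic_of_inversion {f : ℂ → ℂ} {Y Y' : ℝ} (hf : MeromorphicNFOn f upperHalf)
    (hY : DifferentiableOn ℂ f {τ | Y < τ.im}) (hY' : 0 < Y') {h : ℝ → ℂ}
    (hh : ContinuousOn h (Ioi Y'))
    (he : ∀ t : ℝ, 0 < t → ∀ᶠ x in 𝓝[≠] t, f (I * ((1 / x : ℝ) : ℂ)) = h x) :
    {t : ℝ | 0 < t ∧ ¬ AnalyticAt ℂ f (I * t)}.Finite := by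
  have hmem : ∀ t : ℝ, 0 < t → I * (t : ℂ) ∈ upperHalf := fun t ht => by simpa [upperHalf] using ht
  have hsub : {t : ℝ | 0 < t ∧ ¬ AnalyticAt ℂ f (I * t)} ⊆
      Icc (1 / Y') Y \ {t : ℝ | AnalyticAt ℂ f (I * t)} := by
    rintro t ⟨ht, hn⟩
    refine ⟨⟨?_, ?_⟩, hn⟩
    · by_contra! hlt
      refine hn (analyticAt_of_tendsto (v := h (1 / t)) (hf (hmem t ht)) ?_)
      have hlt' : Y' < 1 / t := by rwa [lt_div_comm₀ hY' ht]
      have h1 : Tendsto h (𝓝[≠] (1 / t)) (𝓝 (h (1 / t))) :=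
        (hh.continuousAt (Ioi_mem_nhds hlt')).mono_left nhdsWithin_le_nhds
      have h2 := h1.comp (tendsto_one_div_nhdsNE ht.ne')
      refine h2.congr' ?_
      filter_upwards [(tendsto_one_div_nhdsNE ht.ne').eventually (he (1 / t) (by positivity))] with x hx
      rw [Function.comp_apply, ← hx, one_div_one_div]
    · by_contra! hlt
      refine hn (hY.analyticAt ((isOpen_im_gt Y).mem_nhds ?_))
      simpa using hlt
  refine Finite.subset (IsCompact.finite_sdiff_of_mem_codiscreteWithin isCompact_Icc ?_) hsub
  rw [mem_codiscreteWithin_iff_forall_mem_nhdsNE]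
  intro t ht
  have ht0 : 0 < t := lt_of_lt_of_le (by positivity) ht.1
  have h1 : ∀ᶠ z in 𝓝[≠] (I * (t : ℂ)), AnalyticAt ℂ f z :=
    (hf (hmem t ht0)).meromorphicAt.eventually_analyticAt
  exact mem_of_superset ((tendsto_I_mul_nhdsNE t).eventually h1) subset_union_left

theorem sum_succ_sub_castSucc {n : ℕ} (φ : Fin (n + 1) → ℂ) :
    ∑ j : Fin n, (φ j.succ - φ j.castSucc) = φ (Fin.last n) - φ 0 := by
  have h1 := Fin.sum_univ_succ φ
  have h2 := Fin.sum_univ_castSucc φ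
  rw [Finset.sum_sub_distrib]
  linear_combination h2 - h1

/-! ### Regularized tails and heads of Mellin integrals -/

/-- Beyond all poles the integral between the two endpoints is an ordinary one, so `v + P T` does
not depend on the endpoint. -/
theorem HasTailIntegral.shift_primitive {g P : ℝ → ℂ} {S : Finset ℝ} {T T' : ℝ} {v : ℂ}
    (h : HasTailIntegral g T v) (hP : IsLogPrimitive g P S) (hg : ContinuousOn g (Ioi 0 \ S))
    (hT : 0 < T) (hT' : 0 < T') (hS : ∀ c ∈ S, c < T) (hS' : ∀ c ∈ S, c < T') :
    HasTailIntegral g T' (v + P T - P T') := by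
  have hsub : uIcc T' T ⊆ Ioi 0 \ (S : Set ℝ) := fun x hx =>
    ⟨(lt_min hT' hT).trans_le hx.1, fun hxS =>
      absurd ((lt_min (hS' x hxS) (hS x hxS)).trans_le hx.1) (lt_irrefl _)⟩
  have hi := (hg.mono hsub).intervalIntegrable (μ := volume)
  have := h.shift hi
  rwa [intervalIntegral.integral_eq_sub_of_hasDerivAt
    (fun x hx => hP.hasDerivAt x (hsub hx).1 (hsub hx).2) hi, ← add_sub_assoc] at this

theorem exists_gt_finset (S : Finset ℝ) (Y : ℝ) : ∃ T, Y < T ∧ ∀ c ∈ S, c < T := by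
  obtain ⟨M, hM⟩ := (insert Y S).exists_le
  exact ⟨M + 1, by have := hM Y (by simp); linarith, fun c hc => by
    have := hM c (by simp [hc]); linarith⟩

theorem exists_lt_finset (S : Finset ℝ) (hS : ∀ c ∈ S, 0 < c) : ∃ T, 0 < T ∧ ∀ c ∈ S, T < c := by
  obtain ⟨M, hM, h⟩ := exists_gt_finset (S.image fun t => 1 / t) 0
  refine ⟨1 / M, by positivity, fun c hc => ?_⟩
  have := h (1 / c) (Finset.mem_image_of_mem _ hc)
  exact (one_div_lt hM (hS c hc)).2 this

/-- `S` is the set of poles of `f` on the imaginary axis, `P s` is a primitive of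
`f(it) t ^ (s - 1)`, and `E` is the holomorphic part of its regularized integral towards `∞`. -/
structure IsTailData (f : ℂ → ℂ) (S : Finset ℝ) (P : ℂ → ℝ → ℂ) (E : ℂ → ℂ) : Prop where
  mem_iff : ∀ t, t ∈ S ↔ 0 < t ∧ ¬ AnalyticAt ℂ f (I * t)
  primitive : IsPrimitiveFamily (fun t => f (I * t)) P S
  differentiable : Differentiable ℂ E
  tail : ∀ s : ℂ, fourierCoefficient f 0 = 0 ∨ s.re < 0 → ∀ T : ℝ, 0 < T → (∀ c ∈ S, c < T) →
    HasTailIntegral (mellinIntegrand f s) T (E s - fourierCoefficient f 0 / s - P s T)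
  remainder : ∀ (s : ℂ) (T : ℝ), 0 < T → (∀ c ∈ S, c < T) → ∃ v, HasTailIntegral
    (fun t => mellinIntegrand f s t - fourierCoefficient f 0 * (t : ℂ) ^ (s - 1)) T v

theorem continuousOn_of_mem_iff {f : ℂ → ℂ} {S : Finset ℝ}
    (hS : ∀ t, t ∈ S ↔ 0 < t ∧ ¬ AnalyticAt ℂ f (I * t)) :
    ContinuousOn (fun t : ℝ => f (I * t)) (Ioi 0 \ S) := fun t ht => by
  have h : AnalyticAt ℂ f (I * t) := by
    by_contra hn
    exact ht.2 ((hS t).2 ⟨ht.1, hn⟩)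
  exact h.comp_I_mul.continuousAt.continuousWithinAt

theorem continuousOn_mellinIntegrand {f : ℂ → ℂ} {S : Finset ℝ}
    (hS : ∀ t, t ∈ S ↔ 0 < t ∧ ¬ AnalyticAt ℂ f (I * t)) (s : ℂ) :
    ContinuousOn (mellinIntegrand f s) (Ioi 0 \ S) :=
  (continuousOn_of_mem_iff hS).mul ((continuousOn_ofReal_cpow _).mono sdiff_subset)

theorem exists_isTailData {f : ℂ → ℂ} (hf : MeromorphicNFOn f upperHalf)
    (hf' : MeromorphicAtInfinity f) (hfin : {t : ℝ | 0 < t ∧ ¬ AnalyticAt ℂ f (I * t)}.Finite) :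
    ∃ S P E, IsTailData f S P E := by
  set S := hfin.toFinset
  have hS : ∀ t, t ∈ S ↔ 0 < t ∧ ¬ AnalyticAt ℂ f (I * t) := fun t => by simp [S]
  have hF : HasFourierExpansion f (fourierCoefficient f) := by
    have : fourierCoefficient f = hf'.choose := by
      funext n; rw [fourierCoefficient, dif_pos hf']
    rw [this]; exact hf'.choose_spec
  obtain ⟨P, hP⟩ := exists_primitiveFamily (g := fun t : ℝ => f (I * t)) (S := S)
    (fun c hc => ((hS c).1 hc).1)
    (fun c hc => (hf (by simpa [upperHalf] using ((hS c).1 hc).1)).meromorphicAt.comp_I_mul)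
    (continuousOn_of_mem_iff hS)
  obtain ⟨Y, hY, -, htail⟩ := hF.exists_tail
  obtain ⟨T₀, hT₀, hT₀S⟩ := exists_gt_finset S Y
  have hT₀0 : 0 < T₀ := hY.trans hT₀
  obtain ⟨E₀, hE₀, hE⟩ := htail T₀ hT₀
  have hT₀n : T₀ ∉ S := fun h => (hT₀S T₀ h).false
  have hTc : (T₀ : ℂ) ≠ 0 := ofReal_ne_zero.2 hT₀0.ne'
  set a := fourierCoefficient f 0
  -- The entire quotient `(T₀^s - 1)/s` reduces the constant term's contribution `-a T₀^s / s` to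
  -- the exact polar part `-a / s`.
  have hd : Differentiable ℂ (dslope (fun s : ℂ => (T₀ : ℂ) ^ s) 0) := by
    rw [← differentiableOn_univ, Complex.differentiableOn_dslope univ_mem]
    exact fun s _ => (differentiableAt_id.const_cpow (Or.inl hTc)).differentiableWithinAt
  refine ⟨S, P, fun s => E₀ s + P s T₀ - a * dslope (fun s : ℂ => (T₀ : ℂ) ^ s) 0 s, hS, hP,
    (hE₀.add (hP.differentiable T₀ hT₀0 hT₀n)).sub (hd.const_mul a), ?_, ?_⟩
  · intro s hs T hT hTS
    have h1 : HasTailIntegral (mellinIntegrand f s) T₀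
        (E₀ s - a * dslope (fun s : ℂ => (T₀ : ℂ) ^ s) 0 s - a / s) := by
      rcases hs with ha | hs
      · have h2 := (hE s).congr (g' := mellinIntegrand f s) (fun t _ => by rw [show a = 0 from ha]; ring)
        rw [show a = 0 from ha]
        convert h2 using 1
        ring
      · have hs0 : s ≠ 0 := by rintro rfl; simp at hs
        have h2 := ((hE s).add ((hasTailIntegral_cpow hT₀0 hs).const_mul a)).congr
          (g' := mellinIntegrand f s) (fun t _ => by ring)
        have h3 : dslope (fun s : ℂ => (T₀ : ℂ) ^ s) 0 s = s⁻¹ * ((T₀ : ℂ) ^ s - 1) := by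
          rw [dslope_of_ne _ hs0, slope_def_module]; simp
        rw [h3]
        convert h2 using 1
        field_simp
        ring
    have h4 := h1.shift_primitive (hP.isLogPrimitive s) (continuousOn_mellinIntegrand hS s)
      hT₀0 hT hT₀S hTS
    convert h4 using 1
    ring
  · intro s T hT hTS
    have hsub : uIcc T T₀ ⊆ Ioi 0 \ (S : Set ℝ) := fun x hx =>
      ⟨(lt_min hT hT₀0).trans_le hx.1, fun hxS =>
        absurd ((lt_min (hTS x hxS) (hT₀S x hxS)).trans_le hx.1) (lt_irrefl _)⟩
    refine ⟨_, (hE s).shift (ContinuousOn.intervalIntegrable ?_)⟩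
    exact ((continuousOn_mellinIntegrand hS s).mono hsub).sub
      (continuousOn_const.mul ((continuousOn_ofReal_cpow _).mono (hsub.trans sdiff_subset)))

/-- `A` and `B` are the meromorphic continuations of the two ends of the regularized Mellin
integral of `f`, normalized by the primitive `P`. -/
structure IsMellinData (f : ℂ → ℂ) (S : Finset ℝ) (P : ℂ → ℝ → ℂ) (A B : ℂ → ℂ) : Prop where
  meromorphicNFOn : MeromorphicNFOn f upperHalf
  mem_iff : ∀ t, t ∈ S ↔ 0 < t ∧ ¬ AnalyticAt ℂ f (I * t)
  primitive : IsPrimitiveFamily (fun t => f (I * t)) P S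
  meromorphic_tail : MeromorphicOn A univ
  meromorphic_head : MeromorphicOn B univ
  tail : ∃ σ : ℝ, ∀ s : ℂ, s.re < σ → ∀ T : ℝ, 0 < T → (∀ c ∈ S, c < T) →
    HasTailIntegral (mellinIntegrand f s) T (A s - P s T)
  head : ∃ σ : ℝ, ∀ s : ℂ, σ < s.re → ∀ T : ℝ, 0 < T → (∀ c ∈ S, T < c) →
    HasHeadIntegral (mellinIntegrand f s) T (B s + P s T)
  tail_eq : ∀ (s : ℂ) (T : ℝ) (v : ℂ), 0 < T → (∀ c ∈ S, c < T) →
    HasTailIntegral (mellinIntegrand f s) T v → AnalyticAt ℂ A s ∧ v = A s - P s T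
  head_eq : ∀ (s : ℂ) (T : ℝ) (v : ℂ), 0 < T → (∀ c ∈ S, T < c) →
    HasHeadIntegral (mellinIntegrand f s) T v → AnalyticAt ℂ B s ∧ v = B s + P s T

/-- `f(i / t) = ∑_r C r * t ^ (e - r) * G r (i t)` for `t > 0`, as an identity of meromorphic functions. -/
def IsInversion (f : ℂ → ℂ) (q : ℕ) (e : ℤ) (C : ℕ → ℂ) (G : ℕ → ℂ → ℂ) : Prop :=
  ∀ t : ℝ, 0 < t → ∀ᶠ x in 𝓝[≠] t, f (I * ((1 / x : ℝ) : ℂ)) =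
    ∑ r ∈ Finset.range (q + 1), C r * (x : ℂ) ^ (e - r) * G r (I * x)

/-! ### Inversion of the Mellin integrand and comparison of primitives -/

section Inversion

variable {f : ℂ → ℂ} {q : ℕ} {e : ℤ} {C : ℕ → ℂ} {G : ℕ → ℂ → ℂ}

/-- The factor `t^(-2)` and the power `(1/t)^(s-1)` combine with `t^(e-r)` to `t^((e-r-s)-1)`; this
is the source of the reflection `s ↦ e - r - s`. -/
theorem reflect_mellinIntegrand {x : ℝ} (hx : 0 < x)
    (h : f (I * ((1 / x : ℝ) : ℂ)) =
      ∑ r ∈ Finset.range (q + 1), C r * (x : ℂ) ^ (e - r) * G r (I * x)) (s : ℂ) :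
    1 / (x : ℂ) ^ 2 * mellinIntegrand f s (1 / x) =
      ∑ r ∈ Finset.range (q + 1), C r * mellinIntegrand (G r) (e - r - s) x := by
  have hx0 : (x : ℂ) ≠ 0 := ofReal_ne_zero.2 hx.ne'
  have h1 : ((1 / x : ℝ) : ℂ) ^ (s - 1) = (x : ℂ) ^ (1 - s) := by
    rw [one_div, ofReal_inv, inv_cpow _ _ (by rw [arg_ofReal_of_nonneg hx.le]; exact Real.pi_pos.ne),
      ← cpow_neg, neg_sub]
  rw [mellinIntegrand, h, h1, Finset.sum_mul, Finset.mul_sum]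
  refine Finset.sum_congr rfl fun r _ => ?_
  have h2 : (x : ℂ) ^ ((e : ℂ) - r - s - 1) = (x : ℂ) ^ (e - r) * (x : ℂ) ^ (1 - s) * (1 / (x : ℂ) ^ 2) := by
    have : ((e : ℂ) - r - s - 1) = ((e - r : ℤ) : ℂ) + (1 - s) - (2 : ℕ) := by push_cast; ring
    rw [this, cpow_sub _ _ hx0, cpow_add _ _ hx0, cpow_intCast, cpow_natCast, one_div, div_eq_mul_inv]
  rw [mellinIntegrand, h2]
  ring

theorem IsInversion.apply_eq (h : IsInversion f q e C G) {x : ℝ} (hx : 0 < x)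
    (hf : AnalyticAt ℂ f (I * ((1 / x : ℝ) : ℂ)))
    (hG : ∀ r ∈ Finset.range (q + 1), AnalyticAt ℂ (G r) (I * x)) :
    f (I * ((1 / x : ℝ) : ℂ)) =
      ∑ r ∈ Finset.range (q + 1), C r * (x : ℂ) ^ (e - r) * G r (I * x) := by
  have hx0 : (x : ℂ) ≠ 0 := ofReal_ne_zero.2 hx.ne'
  refine eq_of_eventuallyEq_nhdsNE (g := fun x : ℝ => f (I * ((1 / x : ℝ) : ℂ)))
    (h := fun x : ℝ => ∑ r ∈ Finset.range (q + 1), C r * (x : ℂ) ^ (e - r) * G r (I * x)) ?_ ?_ (h x hx)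
  · have h1 : ContinuousAt (fun x : ℝ => 1 / x) x := by fun_prop (disch := exact hx.ne')
    exact ContinuousAt.comp (f := fun x : ℝ => 1 / x) (g := fun t : ℝ => f (I * t)) (x := x)
      hf.comp_I_mul.continuousAt h1
  · refine tendsto_finsetSum _ fun r hr => ?_
    refine (continuousAt_const.mul ?_).mul (hG r hr).comp_I_mul.continuousAt
    exact (continuousAt_zpow₀ (x : ℂ) (e - r) (Or.inl hx0)).comp continuous_ofReal.continuousAt

variable {S : Finset ℝ} {P : ℂ → ℝ → ℂ} {S' : ℕ → Finset ℝ} {P' : ℕ → ℂ → ℝ → ℂ}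
  {E' : ℕ → ℂ → ℂ}

/-- Both sides are logarithmic primitives of the same reflected integrand, so they differ by a
constant in `t`; evaluated at a fixed regular point `t₀`, this constant is entire in `s`. -/
theorem IsInversion.exists_primitive_eq (h : IsInversion f q e C G)
    (hS : ∀ t, t ∈ S ↔ 0 < t ∧ ¬ AnalyticAt ℂ f (I * t))
    (hP : IsPrimitiveFamily (fun t => f (I * t)) P S)
    (hG : ∀ r ∈ Finset.range (q + 1), IsTailData (G r) (S' r) (P' r) (E' r)) :
    ∃ κ : ℂ → ℂ, Differentiable ℂ κ ∧ ∀ (s : ℂ) (t : ℝ), 0 < t → 1 / t ∉ S →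
      (∀ r ∈ Finset.range (q + 1), t ∉ S' r) →
      -P s (1 / t) = ∑ r ∈ Finset.range (q + 1), C r * P' r (e - r - s) t + κ s := by
  classical
  set U : Finset ℝ := (S.image fun t => 1 / t) ∪ (Finset.range (q + 1)).biUnion S' with hU
  have hUmem : ∀ t, t ∉ U ↔ 1 / t ∉ S ∧ ∀ r ∈ Finset.range (q + 1), t ∉ S' r := by
    intro t
    simp only [hU, Finset.mem_union, Finset.mem_image, Finset.mem_biUnion, not_or, not_exists, not_and]
    refine and_congr ⟨fun h h1 => h _ h1 (one_div_one_div t), fun h x hx he => h (by rwa [← he, one_div_one_div])⟩ Iff.rfl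
  obtain ⟨t₀, ht₀, htU⟩ := exists_gt_finset U 0
  have ht₀U : t₀ ∉ U := fun hm => (htU _ hm).false
  have key : ∀ s, IsLogPrimitive (fun t : ℝ => 1 / (t : ℂ) ^ 2 * mellinIntegrand f s (1 / t))
      (fun t => ∑ r ∈ Finset.range (q + 1), C r * P' r (e - r - s) t) U := by
    intro s
    have h1 := IsLogPrimitive.sum (s := Finset.range (q + 1))
      (g := fun r t => C r * mellinIntegrand (G r) (e - r - s) t)
      (P := fun r t => C r * P' r (e - r - s) t) (S := U) fun r hr =>
        (((hG r hr).primitive.isLogPrimitive (e - r - s)).const_mul (C r)).mono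
          ((Finset.subset_biUnion_of_mem S' hr).trans Finset.subset_union_right)
    refine h1.congr fun t ht htn => ?_
    obtain ⟨h2, h3⟩ := (hUmem t).1 htn
    refine (reflect_mellinIntegrand ht (h.apply_eq ht ?_ fun r hr => ?_) s).symm
    · by_contra hn; exact h2 ((hS _).2 ⟨by positivity, hn⟩)
    · by_contra hn; exact h3 r hr (((hG r hr).mem_iff _).2 ⟨ht, hn⟩)
  refine ⟨fun s => -P s (1 / t₀) - ∑ r ∈ Finset.range (q + 1), C r * P' r (e - r - s) t₀, ?_, ?_⟩
  · obtain ⟨h2, h3⟩ := (hUmem t₀).1 ht₀U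
    refine (hP.differentiable (1 / t₀) (by positivity) h2).neg.sub
      (Differentiable.fun_sum fun r hr => ?_)
    exact (((hG r hr).primitive.differentiable t₀ ht₀ (h3 r hr)).comp
      (differentiable_const _ |>.sub differentiable_id)).const_mul _
  · intro s t ht h2 h3
    have h4 := (((hP.isLogPrimitive s).one_div).mono (S' := U) Finset.subset_union_left).sub_eq_sub
      (key s) ht ht₀ ((hUmem t).2 ⟨h2, h3⟩) ht₀U
    linear_combination h4

end Inversion

theorem analyticAt_sub_div {E : ℂ → ℂ} (hE : Differentiable ℂ E) {a s : ℂ} (h : a = 0 ∨ s ≠ 0) :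
    AnalyticAt ℂ (fun z => E z - a / z) s := by
  rcases h with rfl | h
  · simpa using hE.analyticAt s
  · exact (hE.analyticAt s).sub (analyticAt_const.div analyticAt_id h)

theorem meromorphicAt_sub_div {E : ℂ → ℂ} (hE : Differentiable ℂ E) (a s : ℂ) :
    MeromorphicAt (fun z => E z - a / z) s :=
  (hE.analyticAt s).meromorphicAt.sub ((MeromorphicAt.const a s).div analyticAt_id.meromorphicAt)

theorem analyticAt_const_sub (w s : ℂ) : AnalyticAt ℂ (fun z => w - z) s :=
  analyticAt_const.sub analyticAt_id

theorem _root_.MeromorphicAt.comp_const_sub {g : ℂ → ℂ} {w s : ℂ} (h : MeromorphicAt g (w - s)) :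
    MeromorphicAt (fun z => g (w - z)) s :=
  MeromorphicAt.comp_analyticAt (g := fun z => w - z) h (analyticAt_const_sub w s)

theorem _root_.AnalyticAt.comp_const_sub {g : ℂ → ℂ} {w s : ℂ} (h : AnalyticAt ℂ g (w - s)) :
    AnalyticAt ℂ (fun z => g (w - z)) s :=
  AnalyticAt.comp (f := fun z => w - z) (x := s) h (analyticAt_const_sub w s)

theorem re_of_ne_zero {s : ℂ} (h : s.re < 0) : s ≠ 0 := by
  rintro rfl; simp at h

/-- Subtracting the part that always has a regularized tail leaves a multiple of `t^(s-1)`, which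
has one only for trivial reasons. -/
theorem IsTailData.tail_eq {f : ℂ → ℂ} {S : Finset ℝ} {P : ℂ → ℝ → ℂ} {E : ℂ → ℂ}
    (h : IsTailData f S P E) {s : ℂ} {T : ℝ} {v : ℂ} (hT : 0 < T) (hS : ∀ c ∈ S, c < T)
    (hv : HasTailIntegral (mellinIntegrand f s) T v) :
    (fourierCoefficient f 0 = 0 ∨ s.re < 0) ∧ v = E s - fourierCoefficient f 0 / s - P s T := by
  obtain ⟨w, hw⟩ := h.remainder s T hT hS
  have h1 := (hv.add (hw.const_mul (-1))).congr
    (g' := fun t : ℝ => ∑ r ∈ Finset.range 1, (fun _ => fourierCoefficient f 0) r * (t : ℂ) ^ (s - r - 1))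
    (fun t _ => by simp)
  have h2 := h1.sum_cpow_coeff hT 0 one_pos
  simp only [Nat.cast_zero, sub_zero] at h2
  exact ⟨h2, hv.unique (h.tail s h2 T hT hS)⟩

section Inversion

variable {f : ℂ → ℂ} {q : ℕ} {e : ℤ} {C : ℕ → ℂ} {G : ℕ → ℂ → ℂ} {S : Finset ℝ} {P : ℂ → ℝ → ℂ}
  {E : ℂ → ℂ} {S' : ℕ → Finset ℝ} {P' : ℕ → ℂ → ℝ → ℂ} {E' : ℕ → ℂ → ℂ}

theorem HasTailIntegral.sum_mellinIntegrand {T : ℝ} (hT : 0 < T) {s : ℂ}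
    (hG : ∀ r ∈ Finset.range (q + 1), IsTailData (G r) (S' r) (P' r) (E' r))
    (hS' : ∀ r ∈ Finset.range (q + 1), ∀ c ∈ S' r, c < T)
    (hs : ∀ r ∈ Finset.range (q + 1), C r * fourierCoefficient (G r) 0 = 0 ∨ ((e : ℂ) - r - s).re < 0) :
    HasTailIntegral (fun t => ∑ r ∈ Finset.range (q + 1), C r * mellinIntegrand (G r) (e - r - s) t) T
      (∑ r ∈ Finset.range (q + 1), C r * (E' r (e - r - s) -
        fourierCoefficient (G r) 0 / (e - r - s) - P' r (e - r - s) T)) := by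
  refine HasTailIntegral.sum fun r hr => ?_
  rcases eq_or_ne (C r) 0 with hC | hC
  · simpa [hC] using HasTailIntegral.zero T
  · exact ((hG r hr).tail _ ((hs r hr).imp_left fun h => (mul_eq_zero.1 h).resolve_left hC) T hT
      (hS' r hr)).const_mul _

/-- The exponents `e - r - s` have distinct real parts, so divergent contributions of different
components cannot cancel. -/
theorem HasTailIntegral.coeff_of_sum_mellinIntegrand {T : ℝ} (hT : 0 < T) {s v : ℂ}
    (hG : ∀ r ∈ Finset.range (q + 1), IsTailData (G r) (S' r) (P' r) (E' r))
    (hS' : ∀ r ∈ Finset.range (q + 1), ∀ c ∈ S' r, c < T)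
    (h : HasTailIntegral
      (fun t => ∑ r ∈ Finset.range (q + 1), C r * mellinIntegrand (G r) (e - r - s) t) T v) :
    ∀ r ∈ Finset.range (q + 1), C r * fourierCoefficient (G r) 0 = 0 ∨ ((e : ℂ) - r - s).re < 0 := by
  choose! w hw using fun r hr => (hG r hr).remainder (e - r - s) T hT (hS' r hr)
  have h1 := (h.add ((HasTailIntegral.sum fun r hr => (hw r hr).const_mul (C r)).const_mul (-1))).congr
    (g' := fun t : ℝ => ∑ r ∈ Finset.range (q + 1), (fun r => C r * fourierCoefficient (G r) 0) r *
      (t : ℂ) ^ ((e - s : ℂ) - r - 1)) (fun t _ => by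
        rw [Finset.mul_sum, ← Finset.sum_add_distrib]
        refine Finset.sum_congr rfl fun r _ => ?_
        rw [show (e : ℂ) - s - r - 1 = e - r - s - 1 by ring]
        ring)
  intro r hr
  have h2 := h1.sum_cpow_coeff hT r (Finset.mem_range.1 hr)
  rwa [show (e : ℂ) - s - r = e - r - s by ring] at h2

/-- By definition the head over `(0, T)` is a tail over `(1/T, ∞)`. The reflected primitive moves
the endpoint to any `T'` beyond the reflected poles, in particular to one beyond the poles of the
components as well. -/
theorem hasTailIntegral_reflect_iff (hS : ∀ t, t ∈ S ↔ 0 < t ∧ ¬ AnalyticAt ℂ f (I * t))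
    (hP : IsPrimitiveFamily (fun t => f (I * t)) P S) {s v : ℂ} {T T' : ℝ} (hT : 0 < T) (hT' : 0 < T')
    (hST : ∀ c ∈ S, T < c) (hST' : ∀ c ∈ S, 1 / c < T') :
    HasHeadIntegral (mellinIntegrand f s) T v ↔ HasTailIntegral
      (fun t : ℝ => 1 / (t : ℂ) ^ 2 * mellinIntegrand f s (1 / t)) T' (v - P s T + P s (1 / T')) := by
  have h1 := (hP.isLogPrimitive s).one_div
  have h2 : ContinuousOn (fun t : ℝ => 1 / (t : ℂ) ^ 2 * mellinIntegrand f s (1 / t))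
      (Ioi 0 \ (S.image fun t => 1 / t : Finset ℝ)) := by
    refine ContinuousOn.mul (ContinuousOn.div continuousOn_const (by fun_prop) fun t ht =>
      pow_ne_zero _ (ofReal_ne_zero.2 (ne_of_gt ht.1))) ?_
    refine (continuousOn_mellinIntegrand hS s).comp (f := fun t : ℝ => 1 / t)
      (continuousOn_const.div continuousOn_id fun t ht => ne_of_gt ht.1) fun t ht => ?_
    refine ⟨mem_Ioi.2 (one_div_pos.2 ht.1), fun hm => ht.2 ?_⟩
    exact Finset.mem_coe.2 (Finset.mem_image.2 ⟨1 / t, hm, one_div_one_div t⟩)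
  have h3 : ∀ c ∈ S.image fun t => 1 / t, c < 1 / T := by
    intro c hc
    obtain ⟨x, hx, rfl⟩ := Finset.mem_image.1 hc
    exact one_div_lt_one_div_of_lt hT (hST x hx)
  have h4 : ∀ c ∈ S.image fun t => 1 / t, c < T' := by
    intro c hc
    obtain ⟨x, hx, rfl⟩ := Finset.mem_image.1 hc
    exact hST' x hx
  constructor
  · intro h
    convert HasTailIntegral.shift_primitive h h1 h2 (by positivity) hT' h3 h4 using 1
    rw [one_div_one_div]; ring
  · intro h
    have := HasTailIntegral.shift_primitive h h1 h2 hT' (by positivity) h4 h3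
    rw [one_div_one_div] at this
    unfold HasHeadIntegral
    convert this using 1
    ring

variable {κ : ℂ → ℂ}

/-- After reflection beyond all poles the head is the tail of a sum over components; existence is
decided by their constant terms and the value by their tail data. The products `C r * a` occur
because a component with `C r = 0` imposes no condition. -/
theorem IsInversion.hasHeadIntegral_iff (h : IsInversion f q e C G)
    (hS : ∀ t, t ∈ S ↔ 0 < t ∧ ¬ AnalyticAt ℂ f (I * t))
    (hP : IsPrimitiveFamily (fun t => f (I * t)) P S)
    (hG : ∀ r ∈ Finset.range (q + 1), IsTailData (G r) (S' r) (P' r) (E' r))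
    (hκ : ∀ (s : ℂ) (t : ℝ), 0 < t → 1 / t ∉ S → (∀ r ∈ Finset.range (q + 1), t ∉ S' r) →
      -P s (1 / t) = ∑ r ∈ Finset.range (q + 1), C r * P' r (e - r - s) t + κ s)
    {s v : ℂ} {T : ℝ} (hT : 0 < T) (hST : ∀ c ∈ S, T < c) :
    HasHeadIntegral (mellinIntegrand f s) T v ↔
      (∀ r ∈ Finset.range (q + 1), C r * fourierCoefficient (G r) 0 = 0 ∨ ((e : ℂ) - r - s).re < 0) ∧
      v = ∑ r ∈ Finset.range (q + 1), C r * (E' r (e - r - s) -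
        fourierCoefficient (G r) 0 / (e - r - s)) + κ s + P s T := by
  classical
  obtain ⟨T', hT', hU⟩ := exists_gt_finset
    ((S.image fun t => 1 / t) ∪ (Finset.range (q + 1)).biUnion S') 0
  have hST' : ∀ c ∈ S, 1 / c < T' := fun c hc =>
    hU _ (Finset.mem_union_left _ (Finset.mem_image_of_mem _ hc))
  have hS' : ∀ r ∈ Finset.range (q + 1), ∀ c ∈ S' r, c < T' := fun r hr c hc =>
    hU _ (Finset.mem_union_right _ (Finset.mem_biUnion.2 ⟨r, hr, hc⟩))
  have hnS : ∀ t, T' ≤ t → 1 / t ∉ S := fun t ht hm => by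
    have := hST' _ hm
    rw [one_div_one_div] at this
    exact absurd (this.trans_le ht) (lt_irrefl _)
  have hrefl : ∀ t, T' < t → 1 / (t : ℂ) ^ 2 * mellinIntegrand f s (1 / t) =
      ∑ r ∈ Finset.range (q + 1), C r * mellinIntegrand (G r) (e - r - s) t := by
    intro t ht
    have ht0 := hT'.trans ht
    refine reflect_mellinIntegrand ht0 (h.apply_eq ht0 ?_ fun r hr => ?_) s
    · by_contra hn; exact hnS t ht.le ((hS _).2 ⟨by positivity, hn⟩)
    · by_contra hn
      exact absurd (hS' r hr t (((hG r hr).mem_iff _).2 ⟨ht0, hn⟩)) (not_lt.2 ht.le)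
  have hPT := hκ s T' hT' (hnS T' le_rfl) fun r hr hm => (hS' r hr T' hm).false
  rw [hasTailIntegral_reflect_iff hS hP hT hT' hST hST']
  constructor
  · intro h1
    have h2 := h1.congr hrefl
    have h3 := h2.coeff_of_sum_mellinIntegrand hT' hG hS'
    refine ⟨h3, ?_⟩
    have h4 := h2.unique (HasTailIntegral.sum_mellinIntegrand hT' hG hS' h3)
    simp only [mul_sub, Finset.sum_sub_distrib] at h4 ⊢
    linear_combination h4 + hPT
  · rintro ⟨h3, rfl⟩
    have h4 := (HasTailIntegral.sum_mellinIntegrand hT' hG hS' h3).congr fun t ht => (hrefl t ht).symm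
    convert h4 using 1
    simp only [mul_sub, Finset.sum_sub_distrib]
    linear_combination -hPT

theorem IsInversion.isMellinData (h : IsInversion f q e C G) (hf : MeromorphicNFOn f upperHalf)
    (hD : IsTailData f S P E)
    (hG : ∀ r ∈ Finset.range (q + 1), IsTailData (G r) (S' r) (P' r) (E' r))
    (hκd : Differentiable ℂ κ)
    (hκ : ∀ (s : ℂ) (t : ℝ), 0 < t → 1 / t ∉ S → (∀ r ∈ Finset.range (q + 1), t ∉ S' r) →
      -P s (1 / t) = ∑ r ∈ Finset.range (q + 1), C r * P' r (e - r - s) t + κ s) :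
    IsMellinData f S P (fun s => E s - fourierCoefficient f 0 / s)
      (fun s => ∑ r ∈ Finset.range (q + 1), C r * (E' r (e - r - s) -
        fourierCoefficient (G r) 0 / (e - r - s)) + κ s) where
  meromorphicNFOn := hf
  mem_iff := hD.mem_iff
  primitive := hD.primitive
  meromorphic_tail s _ := meromorphicAt_sub_div hD.differentiable _ s
  meromorphic_head s _ := by
    refine (MeromorphicAt.fun_sum fun r hr => ?_).add (hκd.analyticAt s).meromorphicAt
    exact (MeromorphicAt.const _ _).mul
      (meromorphicAt_sub_div (hG r ‹_›).differentiable _ _).comp_const_sub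
  tail := ⟨0, fun s hs T hT hS => hD.tail s (Or.inr hs) T hT hS⟩
  head := by
    -- For `Re s > e` every exponent `e - r - s` has negative real part, so all component tails
    -- exist.
    refine ⟨e, fun s hs T hT hS => (h.hasHeadIntegral_iff hD.mem_iff hD.primitive hG hκ hT hS).2
      ⟨fun r _ => Or.inr ?_, rfl⟩⟩
    have : (0 : ℝ) ≤ r := r.cast_nonneg
    simp only [sub_re, intCast_re, natCast_re]
    linarith
  tail_eq s T v hT hS hv := by
    obtain ⟨h1, h2⟩ := hD.tail_eq hT hS hv
    exact ⟨analyticAt_sub_div hD.differentiable (h1.imp_right re_of_ne_zero), h2⟩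
  head_eq s T v hT hS hv := by
    obtain ⟨h1, h2⟩ := (h.hasHeadIntegral_iff hD.mem_iff hD.primitive hG hκ hT hS).1 hv
    refine ⟨(Finset.analyticAt_fun_sum _ fun r hr => ?_).add (hκd.analyticAt s), h2⟩
    rcases eq_or_ne (C r) 0 with hC | hC
    · simpa [hC] using analyticAt_const
    · refine analyticAt_const.mul (analyticAt_sub_div (hG r hr).differentiable
        ((h1 r hr).imp (fun h => (mul_eq_zero.1 h).resolve_left hC) re_of_ne_zero)).comp_const_sub

/-- The substitution `t ↦ 1 / t` exchanges the heads of the Mellin integrals of the `G r` with the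
tail of that of `f`. -/
theorem IsInversion.sum_head_eq (h : IsInversion f q e C G) {A B : ℂ → ℂ} {A' B' : ℕ → ℂ → ℂ}
    (hM : IsMellinData f S P A B)
    (hG : ∀ r ∈ Finset.range (q + 1), IsTailData (G r) (S' r) (P' r) (E' r))
    (hM' : ∀ r ∈ Finset.range (q + 1), IsMellinData (G r) (S' r) (P' r) (A' r) (B' r))
    (hκ : ∀ (s : ℂ) (t : ℝ), 0 < t → 1 / t ∉ S → (∀ r ∈ Finset.range (q + 1), t ∉ S' r) →
      -P s (1 / t) = ∑ r ∈ Finset.range (q + 1), C r * P' r (e - r - s) t + κ s) :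
    ∃ σ : ℝ, ∀ s : ℂ, s.re < σ →
      ∑ r ∈ Finset.range (q + 1), C r * B' r (e - r - s) = A s + κ s := by
  classical
  obtain ⟨σ, hσ⟩ := hM.tail
  choose! τ hτ using fun r hr => (hM' r hr).head
  obtain ⟨N, hN⟩ : ∃ N : ℝ, ∀ r ∈ Finset.range (q + 1), τ r ≤ N := by
    obtain ⟨N, hN⟩ := ((Finset.range (q + 1)).image τ).exists_le
    exact ⟨N, fun r hr => hN _ (Finset.mem_image_of_mem _ hr)⟩
  obtain ⟨T', hT', hU⟩ := exists_lt_finset ((S.image fun t => 1 / t) ∪ (Finset.range (q + 1)).biUnion S')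
    (by
      intro c hc
      rcases Finset.mem_union.1 hc with hc | hc
      · obtain ⟨x, hx, rfl⟩ := Finset.mem_image.1 hc
        exact one_div_pos.2 ((hM.mem_iff x).1 hx).1
      · obtain ⟨r, hr, hc⟩ := Finset.mem_biUnion.1 hc
        exact (((hM' r hr).mem_iff c).1 hc).1)
  have hST' : ∀ c ∈ S, T' < 1 / c := fun c hc =>
    hU _ (Finset.mem_union_left _ (Finset.mem_image_of_mem _ hc))
  have hS' : ∀ r ∈ Finset.range (q + 1), ∀ c ∈ S' r, T' < c := fun r hr c hc =>
    hU _ (Finset.mem_union_right _ (Finset.mem_biUnion.2 ⟨r, hr, hc⟩))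
  have hS1 : ∀ c ∈ S, c < 1 / T' := fun c hc =>
    (lt_one_div hT' ((hM.mem_iff c).1 hc).1).1 (hST' c hc)
  have hT'1 : 0 < 1 / T' := by positivity
  -- To the left of this bound the tail of `f` exists at `s`, and the head of each `G r` exists at
  -- `e - r - s`, whose real part exceeds `N` since `r ≤ q`.
  refine ⟨min σ (e - q - N), fun s hs => ?_⟩
  have h1 := hσ s (hs.trans_le (min_le_left _ _)) (1 / T') hT'1 hS1
  have h2 : HasTailIntegral (fun t => ∑ r ∈ Finset.range (q + 1),
      C r * (1 / (t : ℂ) ^ 2 * mellinIntegrand (G r) (e - r - s) (1 / t))) (1 / T')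
      (∑ r ∈ Finset.range (q + 1), C r * (B' r (e - r - s) + P' r (e - r - s) T')) := by
    refine HasTailIntegral.sum fun r hr => HasTailIntegral.const_mul (hτ r hr _ ?_ T' hT' (hS' r hr)) _
    have h3 : (r : ℝ) ≤ q := by exact_mod_cast Nat.lt_succ_iff.1 (Finset.mem_range.1 hr)
    have h4 := hs.trans_le (min_le_right _ _)
    have h5 := hN r hr
    simp only [sub_re, intCast_re, natCast_re]
    linarith
  have h3 := h1.unique (h2.congr fun t ht => by
    have ht0 : 0 < t := hT'1.trans ht
    have hx0 : 0 < 1 / t := by positivity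
    have hlt : 1 / t < T' := (one_div_lt hT' ht0).1 ht
    have h4 := reflect_mellinIntegrand hx0 (h.apply_eq hx0 ?_ fun r hr => ?_) s
    · rw [one_div_one_div] at h4
      have ht' : (t : ℂ) ≠ 0 := ofReal_ne_zero.2 ht0.ne'
      calc _ = 1 / (t : ℂ) ^ 2 * ∑ r ∈ Finset.range (q + 1), C r * mellinIntegrand (G r) (e - r - s) (1 / t) := by
            rw [Finset.mul_sum]
            exact Finset.sum_congr rfl fun r _ => by ring
        _ = mellinIntegrand f s t := by
            rw [← h4]
            push_cast
            field_simp
    · by_contra hn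
      rw [one_div_one_div] at hn
      exact absurd (hS1 t ((hM.mem_iff t).2 ⟨ht0, hn⟩)) (not_lt.2 ht.le)
    · by_contra hn
      exact absurd (hS' r hr _ (((hG r hr).mem_iff _).2 ⟨hx0, hn⟩)) (not_lt.2 hlt.le))
  have h4 := hκ s T' hT' (fun hm => by
      have := hST' _ hm
      rw [one_div_one_div] at this
      exact this.false) fun r hr hm => (hS' r hr T' hm).false
  simp only [mul_add, Finset.sum_add_distrib] at h3
  linear_combination -h3 + h4

end Inversion

/-! ### The completed `L`-function -/

theorem eventuallyEq_codiscrete_iff {g h : ℂ → ℂ} :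
    g =ᶠ[codiscrete ℂ] h ↔ ∀ s, g =ᶠ[𝓝[≠] s] h := by
  rw [EventuallyEq, Filter.Eventually, codiscrete, mem_codiscreteWithin_iff_forall_mem_nhdsNE]
  simp only [mem_univ, true_implies, compl_univ, union_empty]
  rfl

theorem eventuallyEq_nhdsNE_of_halfPlane_left {g h : ℂ → ℂ} (hg : MeromorphicOn g univ)
    (hh : MeromorphicOn h univ) {σ : ℝ} (he : ∀ s : ℂ, s.re < σ → g s = h s) (s : ℂ) :
    g =ᶠ[𝓝[≠] s] h := by
  refine eventuallyEq_nhdsNE_of_isPreconnected hg hh isPreconnected_univ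
    (mem_univ ((σ - 1 : ℝ) : ℂ)) (mem_univ s) ?_
  refine EventuallyEq.filter_mono ?_ nhdsWithin_le_nhds
  filter_upwards [(isOpen_re_lt σ).mem_nhds (show (((σ - 1 : ℝ) : ℂ)).re < σ by simp)] with z hz
  exact he z hz

theorem eventuallyEq_nhdsNE_of_halfPlane_right {g h : ℂ → ℂ} (hg : MeromorphicOn g univ)
    (hh : MeromorphicOn h univ) {σ : ℝ} (he : ∀ s : ℂ, σ < s.re → g s = h s) (s : ℂ) :
    g =ᶠ[𝓝[≠] s] h := by
  refine eventuallyEq_nhdsNE_of_isPreconnected hg hh isPreconnected_univ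
    (mem_univ ((σ + 1 : ℝ) : ℂ)) (mem_univ s) ?_
  refine EventuallyEq.filter_mono ?_ nhdsWithin_le_nhds
  filter_upwards [(isOpen_re_gt σ).mem_nhds (show σ < (((σ + 1 : ℝ) : ℂ)).re by simp)] with z hz
  exact he z hz

namespace IsMellinData

variable {f : ℂ → ℂ} {S : Finset ℝ} {P : ℂ → ℝ → ℂ} {A B : ℂ → ℂ}

theorem meromorphicNFAt (h : IsMellinData f S P A B) {t : ℝ} (ht : 0 < t) :
    MeromorphicNFAt f (I * t) :=
  h.meromorphicNFOn (by simpa [upperHalf] using ht)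

/-- The factor `t^(s-1)` is analytic without zeros, so every splitting, of `f(it)` or of the
integrand, has exactly the points of `S` as its poles. -/
theorem mem_iff_of_isSplitting (h : IsMellinData f S P A B) {s : ℂ} {n : ℕ} {a : Fin (n + 1) → ℝ}
    {c : Fin n → ℝ}
    (hs : IsSplitting (fun t : ℝ => f (I * t)) a c ∨ IsSplitting (mellinIntegrand f s) a c) (t : ℝ) :
    t ∈ S ↔ ∃ j, t = c j := by
  rw [h.mem_iff]
  rcases hs with hs | hs
  · constructor
    · rintro ⟨ht, hn⟩
      refine (hs.eq_pole_iff ht).2 fun han => ?_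
      exact absurd (meromorphicOrderAt_comp_I_mul_neg (h.meromorphicNFAt ht) hn)
        (not_lt.2 han.meromorphicOrderAt_nonneg)
    · rintro ⟨j, rfl⟩
      exact ⟨hs.pos_c j, fun han => (hs.eq_pole_iff (hs.pos_c j)).1 ⟨j, rfl⟩ han.comp_I_mul⟩
  · constructor
    · rintro ⟨ht, hn⟩
      refine (hs.eq_pole_iff ht).2 fun han => ?_
      have h1 := meromorphicOrderAt_comp_I_mul_neg (h.meromorphicNFAt ht) hn
      rw [← meromorphicOrderAt_mellinIntegrand ht (h.meromorphicNFAt ht).meromorphicAt s] at h1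
      exact absurd h1 (not_lt.2 han.meromorphicOrderAt_nonneg)
    · rintro ⟨j, rfl⟩
      exact ⟨hs.pos_c j, fun han => (hs.eq_pole_iff (hs.pos_c j)).1 ⟨j, rfl⟩
        (han.comp_I_mul.mul (analyticAt_ofReal_cpow (hs.pos_c j) _))⟩

variable {g : ℝ → ℂ} {n : ℕ} {a : Fin (n + 1) → ℝ} {c : Fin n → ℝ}

theorem hasFinitePartIntegral (h : IsMellinData f S P A B) (hs : IsSplitting g a c)
    (hS : ∀ t, t ∈ S ↔ ∃ j, t = c j) (j : Fin n) (s : ℂ) :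
    HasFinitePartIntegral (mellinIntegrand f s) (a j.castSucc) (a j.succ) (c j)
      (P s (a j.succ) - P s (a j.castSucc)) := by
  have hn : ∀ t ∈ Icc (a j.castSucc) (a j.succ), t ≠ c j → t ∉ S := by
    intro t ht htc htS
    obtain ⟨i, rfl⟩ := (hS t).1 htS
    exact htc (by rw [hs.eq_of_mem_Icc ht])
  refine (h.primitive.isLogPrimitive s).hasFinitePartIntegral (hs.pos_a _) (hs.mem j).1 (hs.mem j).2
    (meromorphicAt_mellinIntegrand (hs.pos_c j) (h.meromorphicNFAt (hs.pos_c j)).meromorphicAt s)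
    ((continuousOn_mellinIntegrand h.mem_iff s).mono fun t ht => ⟨(hs.pos_a _).trans_le ht.1.1, ?_⟩) hn
  exact hn t ht.1 ht.2

/-- The values of `P s` at the splitting points telescope, and what remains does not refer to the
splitting. -/
theorem eventuallyEq_of_isCompletedLFunction (h : IsMellinData f S P A B) {L : ℂ → ℂ}
    (hL : IsCompletedLFunction f L) (s : ℂ) : L =ᶠ[𝓝[≠] s] fun s => A s + B s := by
  obtain ⟨-, n, a, c, A', B', M, hs, hA', ⟨σ, hσ⟩, hB', ⟨τ, hτ⟩, hM, hL⟩ := hL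
  have hS := h.mem_iff_of_isSplitting (s := 0) (Or.inl hs)
  have hlast : ∀ c ∈ S, c < a (Fin.last n) := fun x hx => by
    obtain ⟨j, rfl⟩ := (hS x).1 hx; exact hs.lt_last j
  have hzero : ∀ c ∈ S, a 0 < c := fun x hx => by
    obtain ⟨j, rfl⟩ := (hS x).1 hx; exact hs.zero_lt j
  have hd : ∀ i, Differentiable ℂ fun s => P s (a i) := fun i =>
    h.primitive.differentiable _ (hs.pos_a i) fun hm => by
      obtain ⟨j, hj⟩ := (hS _).1 hm; exact hs.a_ne i j hj
  have hm : ∀ i, MeromorphicOn (fun s => P s (a i)) univ := fun i s _ =>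
    ((hd i).analyticAt s).meromorphicAt
  have h1 : A' =ᶠ[𝓝[≠] s] fun s => A s - P s (a (Fin.last n)) :=
    eventuallyEq_nhdsNE_of_halfPlane_left hA' (fun z hz => (h.meromorphic_tail z hz).sub (hm _ z hz))
      (fun z hz => (h.tail_eq z _ _ (hs.pos_a _) hlast (hσ z hz)).2) s
  have h2 : B' =ᶠ[𝓝[≠] s] fun s => B s + P s (a 0) :=
    eventuallyEq_nhdsNE_of_halfPlane_right hB' (fun z hz => (h.meromorphic_head z hz).add (hm _ z hz))
      (fun z hz => (h.head_eq z _ _ (hs.pos_a _) hzero (hτ z hz)).2) s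
  filter_upwards [eventuallyEq_codiscrete_iff.1 hL s, h1, h2] with z hz hz1 hz2
  rw [hz, hz1, hz2, Finset.sum_congr rfl fun j _ =>
    (hM j z).unique (h.hasFinitePartIntegral hs hS j z), sum_succ_sub_castSucc fun i => P z (a i)]
  ring

theorem meromorphicOn_add (h : IsMellinData f S P A B) : MeromorphicOn (fun s => A s + B s) univ :=
  fun z hz => (h.meromorphic_tail z hz).add (h.meromorphic_head z hz)

theorem isCompletedLFunction (h : IsMellinData f S P A B) :
    IsCompletedLFunction f (toMeromorphicNFOn (fun s => A s + B s) univ) := by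
  refine ⟨meromorphicNFOn_toMeromorphicNFOn _ _, ?_⟩
  obtain ⟨M, hM, hMS⟩ := exists_gt_finset S 0
  obtain ⟨n, a, c, ha0, ha, hc, hS, -⟩ := exists_separating S M hM fun c hc =>
    ⟨((h.mem_iff c).1 hc).1, hMS c hc⟩
  have hcS : ∀ j, c j ∈ S := fun j => (hS _).2 ⟨j, rfl⟩
  have hs : IsSplitting (fun t : ℝ => f (I * t)) a c :=
    { pos := ha0
      strictMono := ha
      mem := hc
      pole := fun j => by
        obtain ⟨h1, h2⟩ := (h.mem_iff _).1 (hcS j)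
        exact meromorphicOrderAt_comp_I_mul_neg (h.meromorphicNFAt h1) h2
      analytic := fun t ht hne => by
        have : t ∉ S := fun hm => by obtain ⟨j, hj⟩ := (hS t).1 hm; exact hne j hj
        refine AnalyticAt.comp_I_mul ?_
        by_contra hn
        exact this ((h.mem_iff t).2 ⟨ht, hn⟩) }
  have hlast : ∀ c ∈ S, c < a (Fin.last n) := fun x hx => by
    obtain ⟨j, rfl⟩ := (hS x).1 hx; exact hs.lt_last j
  have hzero : ∀ c ∈ S, a 0 < c := fun x hx => by
    obtain ⟨j, rfl⟩ := (hS x).1 hx; exact hs.zero_lt j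
  have hm : ∀ i, MeromorphicOn (fun s => P s (a i)) univ := fun i s _ =>
    (((h.primitive.differentiable _ (hs.pos_a i) fun hm => by
      obtain ⟨j, hj⟩ := (hS _).1 hm; exact hs.a_ne i j hj).analyticAt s)).meromorphicAt
  obtain ⟨σ, hσ⟩ := h.tail
  obtain ⟨τ, hτ⟩ := h.head
  refine ⟨n, a, c, fun s => A s - P s (a (Fin.last n)), fun s => B s + P s (a 0),
    fun j s => P s (a j.succ) - P s (a j.castSucc), hs,
    fun z hz => (h.meromorphic_tail z hz).sub (hm _ z hz),
    ⟨σ, fun z hz => hσ z hz _ (hs.pos_a _) hlast⟩,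
    fun z hz => (h.meromorphic_head z hz).add (hm _ z hz),
    ⟨τ, fun z hz => hτ z hz _ (hs.pos_a _) hzero⟩, h.hasFinitePartIntegral hs hS, ?_⟩
  refine eventuallyEq_codiscrete_iff.2 fun z => ?_
  filter_upwards [MeromorphicOn.toMeromorphicNFOn_eq_self_on_nhdsNE h.meromorphicOn_add (mem_univ z)] with w hw
  rw [hw, sum_succ_sub_castSucc fun i => P w (a i)]
  ring

theorem isCompletedLFunction_unique (h : IsMellinData f S P A B) {L L' : ℂ → ℂ}
    (hL : IsCompletedLFunction f L) (hL' : IsCompletedLFunction f L') : L = L' := by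
  funext s
  exact (((hL.1 (mem_univ s)).eventuallyEq_nhdsNE_iff_eventuallyEq_nhds (hL'.1 (mem_univ s))).1
    ((h.eventuallyEq_of_isCompletedLFunction hL s).trans
      (h.eventuallyEq_of_isCompletedLFunction hL' s).symm)).self_of_nhds

theorem isCompletedLFunction_completedL (h : IsMellinData f S P A B) :
    IsCompletedLFunction f (completedL f) := by
  have hex : ∃ L, IsCompletedLFunction f L := ⟨_, h.isCompletedLFunction⟩
  rw [completedL, dif_pos hex]
  exact hex.choose_spec

theorem completedL_eventuallyEq (h : IsMellinData f S P A B) (s : ℂ) :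
    completedL f =ᶠ[𝓝[≠] s] fun s => A s + B s :=
  h.eventuallyEq_of_isCompletedLFunction h.isCompletedLFunction_completedL s

theorem meromorphicNFOn_completedL (h : IsMellinData f S P A B) :
    MeromorphicNFOn (completedL f) univ := h.isCompletedLFunction_completedL.1

/-- If the regularized integral exists at `s`, then `A` and `B` are both analytic there, so
`completedL f`, being in normal form, takes the value `A s + B s`; cancelling poles of `A` and `B`
cannot interfere. -/
theorem hasMeromorphicExtension (h : IsMellinData f S P A B) : HasMeromorphicExtension f := by
  have hL := h.isCompletedLFunction_completedL
  refine ⟨⟨_, hL, fun L hL' => h.isCompletedLFunction_unique hL' hL⟩, hL, fun s v hv => ?_⟩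
  obtain ⟨n, a, c, v₀, v₁, m, hs, h0, hm, h1, rfl⟩ := hv
  have hS := h.mem_iff_of_isSplitting (Or.inr hs)
  have hlast : ∀ c ∈ S, c < a (Fin.last n) := fun x hx => by
    obtain ⟨j, rfl⟩ := (hS x).1 hx; exact hs.lt_last j
  have hzero : ∀ c ∈ S, a 0 < c := fun x hx => by
    obtain ⟨j, rfl⟩ := (hS x).1 hx; exact hs.zero_lt j
  obtain ⟨hA, rfl⟩ := h.tail_eq s _ _ (hs.pos_a _) hlast h1
  obtain ⟨hB, rfl⟩ := h.head_eq s _ _ (hs.pos_a _) hzero h0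
  have h2 := (((hL.1 (mem_univ s)).eventuallyEq_nhdsNE_iff_eventuallyEq_nhds
    (hA.add hB).meromorphicNFAt).1 (h.completedL_eventuallyEq s)).self_of_nhds
  rw [h2, Finset.sum_congr rfl fun j _ => (hm j).unique (h.hasFinitePartIntegral hs hS j s),
    sum_succ_sub_castSucc fun i => P s (a i)]
  simp only [Pi.add_apply]
  ring

end IsMellinData

theorem tendsto_const_sub_nhdsNE (w s : ℂ) : Tendsto (fun z => w - z) (𝓝[≠] s) (𝓝[≠] (w - s)) := by
  refine tendsto_nhdsWithin_of_tendsto_nhds_of_eventually_within _ ?_ ?_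
  · exact ((by fun_prop : Continuous fun z => w - z).tendsto s).mono_left nhdsWithin_le_nhds
  · filter_upwards [self_mem_nhdsWithin] with x hx
    simpa [sub_right_inj] using hx

/-! ### Functional equation and explicit polar part -/

namespace IsInversion

variable {f : ℂ → ℂ} {q : ℕ} {e : ℤ} {C : ℕ → ℂ} {G : ℕ → ℂ → ℂ} {S : Finset ℝ} {P : ℂ → ℝ → ℂ}
  {E : ℂ → ℂ} {S' : ℕ → Finset ℝ} {P' : ℕ → ℂ → ℝ → ℂ} {E' : ℕ → ℂ → ℂ} {B' : ℕ → ℂ → ℂ}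

theorem exists_isMellinData (h : IsInversion f q e C G) (hf : MeromorphicNFOn f upperHalf)
    (hD : IsTailData f S P E)
    (hG : ∀ r ∈ Finset.range (q + 1), IsTailData (G r) (S' r) (P' r) (E' r)) :
    ∃ B, IsMellinData f S P (fun s => E s - fourierCoefficient f 0 / s) B := by
  obtain ⟨κ, hκd, hκ⟩ := h.exists_primitive_eq hD.mem_iff hD.primitive hG
  exact ⟨_, h.isMellinData hf hD hG hκd hκ⟩

/-- The head of `f` accounts for the tails of the components and the heads of the components for the
tail of `f`, with the same `κ` in both relations; it cancels. Equality near `s` passes to `s` by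
continuity. -/
theorem completedL_eq (h : IsInversion f q e C G) (hf : MeromorphicNFOn f upperHalf)
    (hD : IsTailData f S P E)
    (hG : ∀ r ∈ Finset.range (q + 1), IsTailData (G r) (S' r) (P' r) (E' r))
    (hM' : ∀ r ∈ Finset.range (q + 1), IsMellinData (G r) (S' r) (P' r)
      (fun s => E' r s - fourierCoefficient (G r) 0 / s) (B' r)) {s : ℂ}
    (hs : AnalyticAt ℂ (completedL f) s)
    (hs' : ∀ r ∈ Finset.range (q + 1), AnalyticAt ℂ (completedL (G r)) (e - r - s)) :
    completedL f s = ∑ r ∈ Finset.range (q + 1), C r * completedL (G r) (e - r - s) := by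
  obtain ⟨κ, hκd, hκ⟩ := h.exists_primitive_eq hD.mem_iff hD.primitive hG
  have hM := h.isMellinData hf hD hG hκd hκ
  obtain ⟨σ, hσ⟩ := h.sum_head_eq hM hG hM' hκ
  have h1 := eventuallyEq_nhdsNE_of_halfPlane_left
    (g := fun s => ∑ r ∈ Finset.range (q + 1), C r * B' r (e - r - s))
    (h := fun s => E s - fourierCoefficient f 0 / s + κ s)
    (fun z _ => MeromorphicAt.fun_sum fun r hr => (MeromorphicAt.const _ _).mul
      ((hM' r ‹_›).meromorphic_head _ (mem_univ _)).comp_const_sub)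
    (fun z hz => (hM.meromorphic_tail z hz).add (hκd.analyticAt z).meromorphicAt) hσ s
  refine eq_of_eventuallyEq_nhdsNE
    (h := fun s => ∑ r ∈ Finset.range (q + 1), C r * completedL (G r) (e - r - s)) hs.continuousAt
    (tendsto_finsetSum _ fun r hr => continuousAt_const.mul (hs' r hr).comp_const_sub.continuousAt) ?_
  have h2 : ∀ᶠ z in 𝓝[≠] s, ∀ r ∈ Finset.range (q + 1), completedL (G r) (e - r - z) =
      E' r (e - r - z) - fourierCoefficient (G r) 0 / (e - r - z) + B' r (e - r - z) :=
    (eventually_all_finset _).2 fun r hr => (tendsto_const_sub_nhdsNE _ s).eventually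
      ((hM' r hr).completedL_eventuallyEq _)
  filter_upwards [h1, h2, hM.completedL_eventuallyEq s] with z hz1 hz2 hz3
  rw [hz3, Finset.sum_congr rfl fun r hr => congrArg (C r * ·) (hz2 r hr)]
  simp only [mul_add, Finset.sum_add_distrib] at hz1 ⊢
  rw [hz1]
  ring

/-- All non-entire terms come from constant Fourier coefficients: that of `f` through its tail,
those of the `G r` through the reflected head. -/
theorem exists_completedL_eventuallyEq (h : IsInversion f q e C G) (hf : MeromorphicNFOn f upperHalf)
    (hD : IsTailData f S P E)
    (hG : ∀ r ∈ Finset.range (q + 1), IsTailData (G r) (S' r) (P' r) (E' r)) :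
    ∃ H : ℂ → ℂ, Differentiable ℂ H ∧ ∀ s, completedL f =ᶠ[𝓝[≠] s] fun z => H z -
      fourierCoefficient f 0 / z +
        ∑ r ∈ Finset.range (q + 1), C r * fourierCoefficient (G r) 0 / (z - (e - r)) := by
  obtain ⟨κ, hκd, hκ⟩ := h.exists_primitive_eq hD.mem_iff hD.primitive hG
  have hM := h.isMellinData hf hD hG hκd hκ
  refine ⟨fun z => E z + κ z + ∑ r ∈ Finset.range (q + 1), C r * E' r (e - r - z), ?_, fun s => ?_⟩
  · exact (hD.differentiable.add hκd).add (Differentiable.fun_sum fun r hr =>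
      ((hG r hr).differentiable.comp (differentiable_const _ |>.sub differentiable_id)).const_mul _)
  · filter_upwards [hM.completedL_eventuallyEq s] with z hz
    have h1 : ∀ r : ℕ, C r * fourierCoefficient (G r) 0 / (z - (e - r)) =
        -(C r * (fourierCoefficient (G r) 0 / (e - r - z))) := by
      intro r
      rw [show z - (e - r) = -(e - r - z) by ring, div_neg, mul_div_assoc]
    rw [hz]
    simp only [h1, mul_sub, Finset.sum_sub_distrib, Finset.sum_neg_distrib]
    ring

end IsInversion

/-! ### Simple poles and residues read off from a polar expansion -/

section Poles

variable {L H : ℂ → ℂ} {a : ℂ} {q : ℕ} {b w : ℕ → ℂ}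

theorem analyticAt_of_polar (hL : MeromorphicNFOn L univ) (hH : Differentiable ℂ H)
    (h : ∀ s, L =ᶠ[𝓝[≠] s] fun z => H z - a / z + ∑ r ∈ Finset.range q, b r / (z - w r)) {s : ℂ}
    (hs : s ≠ 0) (hw : ∀ r ∈ Finset.range q, s ≠ w r) : AnalyticAt ℂ L s := by
  have h1 : AnalyticAt ℂ (fun z => H z - a / z + ∑ r ∈ Finset.range q, b r / (z - w r)) s :=
    (analyticAt_sub_div hH (Or.inr hs)).add (Finset.analyticAt_fun_sum _ fun r hr =>
      analyticAt_const.div (analyticAt_id.sub analyticAt_const) (sub_ne_zero.2 (hw r hr)))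
  exact h1.congr (((hL (mem_univ s)).eventuallyEq_nhdsNE_iff_eventuallyEq_nhds
    h1.meromorphicNFAt).1 (h s)).symm

theorem tendsto_sub_mul_div (s w b : ℂ) : Tendsto (fun z : ℂ => (z - s) * (b / (z - w))) (𝓝[≠] s)
    (𝓝 (if s = w then b else 0)) := by
  by_cases hsw : s = w
  · subst hsw
    rw [if_pos rfl]
    refine tendsto_const_nhds.congr' ?_
    filter_upwards [self_mem_nhdsWithin] with z hz
    field_simp [sub_ne_zero.2 hz]
  · rw [if_neg hsw]
    have hc : ContinuousAt (fun z : ℂ => (z - s) * (b / (z - w))) s := by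
      have : s - w ≠ 0 := sub_ne_zero.2 hsw
      fun_prop (disch := assumption)
    simpa using hc.tendsto.mono_left nhdsWithin_le_nhds

theorem tendsto_sub_mul_of_polar (hH : Differentiable ℂ H) {s : ℂ}
    (h : L =ᶠ[𝓝[≠] s] fun z => H z - a / z + ∑ r ∈ Finset.range q, b r / (z - w r)) :
    Tendsto (fun z => (z - s) * L z) (𝓝[≠] s)
      (𝓝 ((if s = 0 then -a else 0) + ∑ r ∈ Finset.range q, if s = w r then b r else 0)) := by
  have h1 : Tendsto (fun z => (z - s) * H z) (𝓝[≠] s) (𝓝 0) := by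
    have hc : ContinuousAt (fun z => (z - s) * H z) s :=
      (continuousAt_id.sub continuousAt_const).mul hH.continuous.continuousAt
    simpa using hc.tendsto.mono_left nhdsWithin_le_nhds
  have h2 := (h1.add (tendsto_sub_mul_div s 0 (-a))).add
    (tendsto_finsetSum (Finset.range q) fun r _ => tendsto_sub_mul_div s (w r) (b r))
  rw [zero_add] at h2
  refine h2.congr' ?_
  filter_upwards [h] with z hz
  rw [hz, ← Finset.mul_sum, sub_zero]
  ring

/-- A finite limit after multiplication by `z - s` makes the order of the product nonnegative, and
the factor has order one. -/
theorem neg_one_le_meromorphicOrderAt {s v : ℂ} (hL : MeromorphicAt L s)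
    (h : Tendsto (fun z => (z - s) * L z) (𝓝[≠] s) (𝓝 v)) :
    ((-1 : ℤ) : WithTop ℤ) ≤ meromorphicOrderAt L s := by
  have h1 : AnalyticAt ℂ (fun z : ℂ => z - s) s := analyticAt_id.sub analyticAt_const
  have h2 : meromorphicOrderAt (fun z : ℂ => z - s) s = 1 := by
    rw [show (1 : WithTop ℤ) = ((1 : ℤ) : WithTop ℤ) from rfl, meromorphicOrderAt_eq_int_iff h1.meromorphicAt]
    exact ⟨fun _ => 1, analyticAt_const, one_ne_zero, Eventually.of_forall fun z => by simp⟩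
  have h3 := (tendsto_nhds_iff_meromorphicOrderAt_nonneg (h1.meromorphicAt.mul hL)).1 ⟨v, h⟩
  rw [meromorphicOrderAt_mul h1.meromorphicAt hL, h2] at h3
  cases h4 : meromorphicOrderAt L s with
  | top => exact le_top
  | coe n =>
    rw [h4] at h3
    have h5 : (0 : ℤ) ≤ 1 + n := by exact_mod_cast h3
    exact_mod_cast (by omega : -1 ≤ n)

end Poles

/-! ### Quasi-modular forms -/

theorem mobius_mem_upperHalf (γ : SL(2, ℤ)) {τ : ℂ} (hτ : τ ∈ upperHalf) :
    ((γ 1 0 : ℤ) * τ + (γ 1 1 : ℤ) : ℂ) ≠ 0 ∧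
      ((γ 0 0 : ℤ) * τ + (γ 0 1 : ℤ)) / ((γ 1 0 : ℤ) * τ + (γ 1 1 : ℤ)) ∈ upperHalf := by
  have h1 := UpperHalfPlane.denom_ne_zero (γ : GL (Fin 2) ℝ) ⟨τ, hτ⟩
  have h2 := (γ • (⟨τ, hτ⟩ : UpperHalfPlane)).im_pos
  have h3 := UpperHalfPlane.specialLinearGroup_apply γ ⟨τ, hτ⟩
  rw [UpperHalfPlane.im, h3] at h2
  simp [UpperHalfPlane.denom] at h1 h2
  exact ⟨h1, h2⟩

theorem tendsto_mobius_nhdsNE (γ : SL(2, ℤ)) {τ : ℂ} (hτ : τ ∈ upperHalf) :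
    Tendsto (fun z : ℂ => ((γ 0 0 : ℤ) * z + (γ 0 1 : ℤ)) / ((γ 1 0 : ℤ) * z + (γ 1 1 : ℤ)))
      (𝓝[≠] τ) (𝓝[≠] (((γ 0 0 : ℤ) * τ + (γ 0 1 : ℤ)) / ((γ 1 0 : ℤ) * τ + (γ 1 1 : ℤ)))) := by
  have h0 := (mobius_mem_upperHalf γ hτ).1
  have hdet : ((γ 0 0 : ℤ) * (γ 1 1 : ℤ) - (γ 0 1 : ℤ) * (γ 1 0 : ℤ) : ℂ) = 1 := by
    have := γ.det_coe
    rw [Matrix.det_fin_two] at this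
    exact_mod_cast this
  refine tendsto_nhdsWithin_of_tendsto_nhds_of_eventually_within _ ?_ ?_
  · have : ContinuousAt (fun z : ℂ => ((γ 0 0 : ℤ) * z + (γ 0 1 : ℤ)) /
        ((γ 1 0 : ℤ) * z + (γ 1 1 : ℤ))) τ := by fun_prop (disch := assumption)
    exact this.tendsto.mono_left nhdsWithin_le_nhds
  · filter_upwards [self_mem_nhdsWithin, nhdsWithin_le_nhds ((isOpen_im_gt 0).mem_nhds hτ)]
      with z hz hz0 he
    have h1 := (mobius_mem_upperHalf γ hz0).1
    rw [mem_singleton_iff, div_eq_div_iff h1 h0] at he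
    refine hz ?_
    rw [mem_singleton_iff]
    linear_combination he - (z - τ) * hdet

namespace IsQuasiModular

variable {k : ℤ} {p : ℕ} {f : ℂ → ℂ} {F : ℕ → ℂ → ℂ}

/-- The points where one of the functions fails to be regular are isolated, and Möbius maps preserve
punctured neighbourhoods. -/
theorem eventually_transformation (h : IsQuasiModular k p f F) (γ : SL(2, ℤ)) {τ : ℂ}
    (hτ : τ ∈ upperHalf) : ∀ᶠ z in 𝓝[≠] τ, ((γ 1 0 : ℤ) * z + (γ 1 1 : ℤ)) ^ (-k) *
        f (((γ 0 0 : ℤ) * z + (γ 0 1 : ℤ)) / ((γ 1 0 : ℤ) * z + (γ 1 1 : ℤ))) =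
      ∑ r ∈ Finset.range (p + 1),
        F r z * ((γ 1 0 : ℤ) / ((γ 1 0 : ℤ) * z + (γ 1 1 : ℤ))) ^ r := by
  have h1 := (tendsto_mobius_nhdsNE γ hτ).eventually
    (h.meromorphic (mobius_mem_upperHalf γ hτ).2).meromorphicAt.eventually_analyticAt
  have h2 : ∀ᶠ z in 𝓝[≠] τ, ∀ r ∈ Finset.range (p + 1), AnalyticAt ℂ (F r) z :=
    (eventually_all_finset _).2 fun r hr => (h.meromorphic_component r
      (Nat.lt_succ_iff.1 (Finset.mem_range.1 hr)) hτ).meromorphicAt.eventually_analyticAt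
  filter_upwards [h1, h2, nhdsWithin_le_nhds ((isOpen_im_gt 0).mem_nhds hτ)] with z hz1 hz2 hz
  exact h.transformation γ z hz hz1 fun r hr => hz2 r (Finset.mem_range.2 (Nat.lt_succ_iff.2 hr))

/-- For `γ = 1` the lower left entry is `0`, and only the term `r = 0` survives. -/
theorem eq_component_zero (h : IsQuasiModular k p f F) {τ : ℂ} (hτ : τ ∈ upperHalf) :
    f τ = F 0 τ := by
  refine (((h.meromorphic hτ).eventuallyEq_nhdsNE_iff_eventuallyEq_nhds
    (h.meromorphic_component 0 (Nat.zero_le _) hτ)).1 ?_).self_of_nhds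
  filter_upwards [h.eventually_transformation 1 hτ] with z hz
  simpa [Finset.sum_range_succ'] using hz

theorem meromorphicAtInfinity (h : IsQuasiModular k p f F) : MeromorphicAtInfinity f := by
  obtain ⟨a, hN, Y, hY, ha⟩ := h.meromorphicAtInfinity_component 0 (Nat.zero_le _)
  refine ⟨a, hN, Y, hY, fun τ hτ => ?_⟩
  rw [h.eq_component_zero (show τ ∈ upperHalf from hY.trans hτ)]
  exact ha τ hτ

end IsQuasiModular

/-- The matrix `(1 0; c 1)`. -/
def lowerUnipotent (c : ℤ) : SL(2, ℤ) := ⟨!![1, 0; c, 1], by simp [Matrix.det_fin_two]⟩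

/-- The matrix `(0 -1; 1 -c)`. -/
def lowerUnipotentMulS (c : ℤ) : SL(2, ℤ) := ⟨!![0, -1; 1, -c], by simp [Matrix.det_fin_two]⟩

-- With `X = c/(τ - c)` one has `cτ/(τ - c) = τX` and `1/(τ - c) = (X + 1)/τ`, so the hypotheses say
-- that a polynomial of degree at most `p` vanishes at the `p + 1` distinct values of `X`. The
-- coefficient of `X^m`, with `(X + 1)^r` expanded binomially, is the claim.
open Polynomial in
theorem coeff_eq_of_transformation {p : ℕ} {k : ℤ} {τ : ℂ} (hτ : τ ≠ 0) {x y : ℕ → ℂ}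
    (hc : ∀ c ∈ Finset.range (p + 1), τ - c ≠ 0)
    (h : ∀ c ∈ Finset.range (p + 1), ∑ m ∈ Finset.range (p + 1), x m * (c * τ / (τ - c)) ^ m =
      τ ^ k * ∑ r ∈ Finset.range (p + 1), y r * (1 / (τ - c)) ^ r) {m : ℕ} (hm : m ≤ p) :
    x m = ∑ r ∈ Finset.range (p - m + 1),
      ((m + r).choose r : ℂ) * τ ^ (k - 2 * m - r) * y (m + r) := by
  set Q : ℂ[X] := ∑ m ∈ Finset.range (p + 1), C (x m * τ ^ m) * X ^ m -
    ∑ r ∈ Finset.range (p + 1), C (τ ^ (k - r) * y r) * (X + 1) ^ r with hQ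
  have hdeg : Q.degree < ((Finset.range (p + 1)).card : ℕ) := by
    rw [Finset.card_range]
    refine (degree_sub_le _ _).trans_lt (max_lt ?_ ?_)
    · refine (degree_sum_le _ _).trans_lt ((Finset.sup_lt_iff (WithBot.bot_lt_coe _)).2 fun r hr => ?_)
      exact (degree_C_mul_X_pow_le _ _).trans_lt (by exact_mod_cast Finset.mem_range.1 hr)
    · refine (degree_sum_le _ _).trans_lt ((Finset.sup_lt_iff (WithBot.bot_lt_coe _)).2 fun r hr => ?_)
      refine lt_of_le_of_lt ?_ (by exact_mod_cast Finset.mem_range.1 hr : ((r : ℕ) : WithBot ℕ) < ((p + 1 : ℕ) : WithBot ℕ))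
      rw [← C_1]
      compute_degree
      exact le_rfl
  have hQ0 : Q = 0 := by
    refine eq_zero_of_degree_lt_of_eval_index_eq_zero (s := Finset.range (p + 1))
      (v := fun c : ℕ => (c : ℂ) / (τ - c)) ?_ hdeg fun c hc' => ?_
    · intro c hc1 d hd1 hcd
      have h1 := hc c hc1
      have h2 := hc d hd1
      have h3 : (c : ℂ) / (τ - c) = d / (τ - d) := hcd
      rw [div_eq_div_iff h1 h2] at h3
      have h4 : τ * ((c : ℂ) - d) = 0 := by linear_combination h3
      have h5 := (mul_eq_zero.1 h4).resolve_left hτ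
      exact_mod_cast sub_eq_zero.1 h5
    · have h1 := hc c hc'
      have h2 := h c hc'
      simp only [hQ, eval_sub, eval_finsetSum, eval_mul, eval_C, eval_pow, eval_X, eval_add, eval_one]
      rw [Finset.mul_sum] at h2
      have e1 : (c : ℂ) / (τ - c) + 1 = τ / (τ - c) := by field_simp; ring
      rw [sub_eq_zero, e1]
      convert h2 using 2 with m _ r _
      · rw [mul_assoc, ← mul_pow]; congr 2; ring
      · rw [zpow_sub₀ hτ, zpow_natCast, div_pow, div_pow, one_pow]
        field_simp
  have h1 := congrArg (fun Q => Q.coeff m) hQ0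
  simp only [hQ, coeff_sub, finsetSum_coeff, coeff_C_mul, coeff_X_pow, coeff_X_add_one_pow, coeff_zero] at h1
  rw [Finset.sum_eq_single m (fun b _ hb => by simp [hb.symm]) (fun hn => absurd (Finset.mem_range.2 (by omega)) hn)] at h1
  rw [if_pos rfl, mul_one, sub_eq_zero] at h1
  have hsplit : p + 1 = m + (p - m + 1) := by omega
  rw [hsplit, Finset.sum_range_add, Finset.sum_eq_zero (s := Finset.range m) (fun r hr => by
    rw [Nat.choose_eq_zero_of_lt (Finset.mem_range.1 hr)]; simp), zero_add] at h1
  have hτm : τ ^ m ≠ 0 := pow_ne_zero _ hτ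
  rw [← mul_left_inj' hτm, h1, Finset.sum_mul]
  refine Finset.sum_congr rfl fun r _ => ?_
  have e2 : τ ^ (k - ((m + r : ℕ) : ℤ)) = τ ^ (k - 2 * m - r) * τ ^ m := by
    rw [← zpow_natCast, ← zpow_add₀ hτ]; congr 1; push_cast; ring
  rw [e2, Nat.choose_symm_add]
  ring

namespace IsQuasiModular

variable {k : ℤ} {p : ℕ} {f : ℂ → ℂ} {F : ℕ → ℂ → ℂ}

theorem neg_inv_mem_upperHalf {τ : ℂ} (hτ : τ ∈ upperHalf) : -1 / τ ∈ upperHalf := by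
  simpa using (mobius_mem_upperHalf ⟨!![0, -1; 1, 0], by simp [Matrix.det_fin_two]⟩ hτ).2

/-- `(1 0; c 1)` applied to `-1/z` and `(0 -1; 1 -c)` applied to `z` give the same point `-1/(z -
c)`. Expanding `f` there in both ways relates the `F m (-1/z)` to the `F r z` for every `c = 0, …,
p`, which determines each `F m (-1/z)`. -/
theorem eventually_component (h : IsQuasiModular k p f F) {τ : ℂ} (hτ : τ ∈ upperHalf) {m : ℕ}
    (hm : m ≤ p) : ∀ᶠ z in 𝓝[≠] τ, F m (-1 / z) = ∑ r ∈ Finset.range (p - m + 1),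
      ((m + r).choose r : ℂ) * z ^ (k - 2 * m - r) * F (m + r) z := by
  have hS : Tendsto (fun z : ℂ => -1 / z) (𝓝[≠] τ) (𝓝[≠] (-1 / τ)) := by
    simpa using tendsto_mobius_nhdsNE ⟨!![0, -1; 1, 0], by simp [Matrix.det_fin_two]⟩ hτ
  have h1 : ∀ᶠ z in 𝓝[≠] τ, ∀ c ∈ Finset.range (p + 1), _ := (eventually_all_finset _).2 fun c _ =>
    hS.eventually (h.eventually_transformation (lowerUnipotent (c : ℕ)) (neg_inv_mem_upperHalf hτ))
  have h2 : ∀ᶠ z in 𝓝[≠] τ, ∀ c ∈ Finset.range (p + 1), _ := (eventually_all_finset _).2 fun c _ =>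
    h.eventually_transformation (lowerUnipotentMulS (c : ℕ)) hτ
  filter_upwards [h1, h2, nhdsWithin_le_nhds ((isOpen_im_gt 0).mem_nhds hτ)] with z hz1 hz2 hz
  have hz0 : z ≠ 0 := by rintro rfl; simp at hz
  have hc : ∀ c : ℕ, z - c ≠ 0 := by
    intro c hc
    have : (0 : ℝ) < z.im := hz
    rw [sub_eq_zero.1 hc] at this
    simp at this
  refine coeff_eq_of_transformation (k := k) (x := fun m => F m (-1 / z)) (y := fun r => F r z) hz0
    (fun c _ => hc c) (fun c hc' => ?_) hm
  have e1 := hz1 c hc'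
  have e2 := hz2 c hc'
  simp [lowerUnipotent] at e1
  simp [lowerUnipotentMulS] at e2
  have hA : (c : ℂ) * (-1 / z) + 1 = (z - c) / z := by field_simp; ring
  have hB : -1 / z / ((z - c) / z) = -1 / (z - c) := by field_simp
  have hC : (c : ℂ) / ((z - c) / z) = c * z / (z - c) := by field_simp
  rw [hA, hB] at e1
  simp only [hC] at e1
  rw [← sub_eq_add_neg] at e2
  simp only [one_div, inv_pow]
  rw [← e1, ← e2, div_zpow]
  field_simp

end IsQuasiModular

theorem MeromorphicAtInfinity.exists_differentiableOn {f : ℂ → ℂ}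
    (h : MeromorphicAtInfinity f) : ∃ Y : ℝ, 0 < Y ∧ DifferentiableOn ℂ f {τ | Y < τ.im} := by
  obtain ⟨a, ha⟩ := h
  obtain ⟨Y, hY, hd, -⟩ := ha.exists_tail
  exact ⟨Y, hY, hd⟩

theorem IsInversion.finite_nonanalytic {f : ℂ → ℂ} {q : ℕ} {e : ℤ} {C : ℕ → ℂ} {G : ℕ → ℂ → ℂ}
    (h : IsInversion f q e C G) (hf : MeromorphicNFOn f upperHalf) (hf' : MeromorphicAtInfinity f)
    (hG : ∀ r ∈ Finset.range (q + 1), MeromorphicAtInfinity (G r)) :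
    {t : ℝ | 0 < t ∧ ¬ AnalyticAt ℂ f (I * t)}.Finite := by
  obtain ⟨Y, -, hd⟩ := hf'.exists_differentiableOn
  choose! Z hZ0 hZ using fun r hr => (hG r hr).exists_differentiableOn
  obtain ⟨Y', hY', hY'Z⟩ := exists_gt_finset ((Finset.range (q + 1)).image Z) 0
  refine finite_nonanalytic_of_inversion hf hd hY' (continuousOn_finsetSum _ fun r hr => ?_) h
  refine ContinuousOn.mul (continuousOn_const.mul fun x hx => ?_) ?_
  · have hx0 : (x : ℂ) ≠ 0 := ofReal_ne_zero.2 (hY'.trans hx).ne'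
    exact ((continuousAt_zpow₀ (x : ℂ) (e - r) (Or.inl hx0)).comp
      continuous_ofReal.continuousAt).continuousWithinAt
  · refine (hZ r hr).continuousOn.comp (f := fun x : ℝ => I * (x : ℂ)) (by fun_prop) fun x hx => ?_
    have := hY'Z (Z r) (Finset.mem_image_of_mem _ hr)
    simpa using this.trans hx

namespace IsQuasiModular

variable {k : ℤ} {p : ℕ} {f : ℂ → ℂ} {F : ℕ → ℂ → ℂ}

theorem isInversion_component (h : IsQuasiModular k p f F) {m : ℕ} (hm : m ≤ p) :
    IsInversion (F m) (p - m) (k - 2 * m) (fun r => I ^ (k - 2 * m - r) * ((m + r).choose r : ℂ))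
      (fun r => F (m + r)) := by
  intro t ht
  have h1 := (tendsto_I_mul_nhdsNE t).eventually
    (h.eventually_component (show I * (t : ℂ) ∈ upperHalf by simpa [upperHalf] using ht) hm)
  filter_upwards [h1] with x hx
  have e1 : I * ((1 / x : ℝ) : ℂ) = -1 / (I * x) := by
    rw [neg_div, one_div, one_div, mul_inv, inv_I]; push_cast; ring
  rw [e1, hx]
  refine Finset.sum_congr rfl fun r _ => ?_
  rw [mul_zpow]
  ring

theorem isInversion (h : IsQuasiModular k p f F) :
    IsInversion f p k (fun r => I ^ (k - r)) F := by
  intro t ht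
  filter_upwards [h.isInversion_component (Nat.zero_le p) t ht,
    nhdsWithin_le_nhds (Ioi_mem_nhds ht)] with x hx hx0
  rw [h.eq_component_zero (by have : 0 < x := hx0; simpa [upperHalf] using this), hx]
  simp

end IsQuasiModular

end QuasiModular

end

/-! ### The main theorem -/

open QuasiModular in
theorem theorem1p3 (k : ℤ) (p : ℕ) (f : ℂ → ℂ) (F : ℕ → ℂ → ℂ)
    (hf : IsQuasiModular k p f F) :
    -- meromorphic continuation and functional equation
    (HasMeromorphicExtension f ∧
      MeromorphicOn (completedL f) Set.univ ∧
      ∀ s : ℂ, AnalyticAt ℂ (completedL f) s →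
        (∀ r ≤ p, AnalyticAt ℂ (completedL (F r)) (k - r - s)) →
        completedL f s =
          ∑ r ∈ Finset.range (p + 1), Complex.I ^ (k - r) * completedL (F r) (k - r - s)) ∧
    -- poles and residues
    ((∀ s : ℂ, s ≠ 0 → (∀ n : ℤ, k - p ≤ n → n ≤ k → s ≠ n) →
        AnalyticAt ℂ (completedL f) s) ∧
      (∀ s : ℂ, (-1 : ℤ) ≤ meromorphicOrderAt (completedL f) s) ∧
      Filter.Tendsto (fun s : ℂ => s * completedL f s) (nhdsWithin 0 {0}ᶜ)
        (nhds (-fourierCoefficient f 0 +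
          if 0 ≤ k ∧ k ≤ p then fourierCoefficient (F k.toNat) 0 else 0)) ∧
      ∀ n : ℤ, n ≠ 0 → k - p ≤ n → n ≤ k →
        Filter.Tendsto (fun s : ℂ => (s - n) * completedL f s) (nhdsWithin (n : ℂ) {(n : ℂ)}ᶜ)
          (nhds (Complex.I ^ n * fourierCoefficient (F (k - n).toNat) 0))) ∧
    -- functional equations of the components
    ∀ m ≤ p, HasMeromorphicExtension (F m) ∧
      ∀ s : ℂ, AnalyticAt ℂ (completedL (F m)) s →
        (∀ r ≤ p - m, AnalyticAt ℂ (completedL (F (m + r))) (k - 2 * m - r - s)) →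
        completedL (F m) s =
          ∑ r ∈ Finset.range (p - m + 1),
            Complex.I ^ (k - 2 * m - r) * ((m + r).choose r : ℂ) *
              completedL (F (m + r)) (k - 2 * m - r - s) := by
  have hNF := hf.meromorphic_component
  have hlt : ∀ {q r : ℕ}, r ∈ Finset.range (q + 1) → r ≤ q := fun hr =>
    Nat.lt_succ_iff.1 (Finset.mem_range.1 hr)
  have hfinf := hf.meromorphicAtInfinity
  choose! S P E hD using fun m (hm : m ≤ p) => exists_isTailData (hNF m hm)
    (hf.meromorphicAtInfinity_component m hm)
    ((hf.isInversion_component hm).finite_nonanalytic (hNF m hm)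
      (hf.meromorphicAtInfinity_component m hm) fun r hr =>
        hf.meromorphicAtInfinity_component (m + r) (by have := hlt hr; omega))
  have hD' : ∀ m ≤ p, ∀ r ∈ Finset.range (p - m + 1),
      IsTailData (F (m + r)) (S (m + r)) (P (m + r)) (E (m + r)) := fun m hm r hr =>
    hD (m + r) (by have := hlt hr; omega)
  choose! B hM using fun m (hm : m ≤ p) => (hf.isInversion_component hm).exists_isMellinData
    (hNF m hm) (hD m hm) (hD' m hm)
  obtain ⟨S₀, P₀, E₀, hD₀⟩ := exists_isTailData hf.meromorphic hfinf
    (hf.isInversion.finite_nonanalytic hf.meromorphic hfinf fun r hr =>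
      hf.meromorphicAtInfinity_component r (hlt hr))
  have hDF : ∀ r ∈ Finset.range (p + 1), IsTailData (F r) (S r) (P r) (E r) := fun r hr =>
    hD r (hlt hr)
  obtain ⟨B₀, hM₀⟩ := hf.isInversion.exists_isMellinData hf.meromorphic hD₀ hDF
  obtain ⟨H, hH, hL⟩ := hf.isInversion.exists_completedL_eventuallyEq hf.meromorphic hD₀ hDF
  have hNFL := hM₀.meromorphicNFOn_completedL
  have hres := fun s => tendsto_sub_mul_of_polar hH (hL s)
  -- At most one component, `r = k - n`, has its polar term at `n`.
  have hsum : ∀ n : ℤ, (∑ r ∈ Finset.range (p + 1), if (n : ℂ) = (k : ℂ) - r then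
      Complex.I ^ (k - r) * fourierCoefficient (F r) 0 else 0) =
      if k - p ≤ n ∧ n ≤ k then Complex.I ^ n * fourierCoefficient (F (k - n).toNat) 0 else 0 := by
    intro n
    have h1 : ∀ r : ℕ, (n : ℂ) = (k : ℂ) - r ↔ n = k - r := fun r => by norm_cast
    simp only [h1]
    split_ifs with hn
    · rw [Finset.sum_eq_single (k - n).toNat]
      · have h2 : ((k - n).toNat : ℤ) = k - n := Int.toNat_of_nonneg (by omega)
        rw [if_pos (by omega), h2]
        congr 2
        omega
      · intro r _ hr
        rw [if_neg (by omega)]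
      · intro hr
        exact absurd (Finset.mem_range.2 (by omega)) hr
    · refine Finset.sum_eq_zero fun r hr => if_neg ?_
      have := hlt hr
      omega
  refine ⟨⟨hM₀.hasMeromorphicExtension, hNFL.meromorphicOn, fun s hs hs' => ?_⟩,
    ⟨fun s hs hn => ?_, fun s => ?_, ?_, fun n hn0 hn1 hn2 => ?_⟩, fun m hm =>
    ⟨(hM m hm).hasMeromorphicExtension, fun s hs hs' => ?_⟩⟩
  · exact hf.isInversion.completedL_eq hf.meromorphic hD₀ hDF (fun r hr => hM r (hlt hr)) hs
      fun r hr => hs' r (hlt hr)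
  · refine analyticAt_of_polar hNFL hH hL hs fun r hr => ?_
    have := hlt hr
    have h1 := hn (k - r) (by omega) (by omega)
    push_cast at h1
    exact h1
  · exact neg_one_le_meromorphicOrderAt (hNFL (Set.mem_univ s)).meromorphicAt (hres s)
  -- At `s = 0` the polar term of `f` meets that of `F k`, whose factor `i^(k-r)` is `1` at `r = k`.
  · have h1 := hres 0
    have h2 := hsum 0
    rw [Int.cast_zero] at h2
    rw [if_pos rfl, h2] at h1
    simp only [sub_zero, zpow_zero, one_mul] at h1
    convert h1 using 4
    constructor <;> intro h <;> omega
  · have h1 := hres n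
    rwa [if_neg (by exact_mod_cast hn0), zero_add, hsum, if_pos ⟨hn1, hn2⟩] at h1
  · have h1 := (hf.isInversion_component hm).completedL_eq (hNF m hm) (hD m hm) (hD' m hm)
      (fun r hr => hM (m + r) (by have := hlt hr; omega)) hs (fun r hr => by
        push_cast
        exact hs' r (hlt hr))
    push_cast at h1
    exact h1
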